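/- Let $-\infty\le a<b\le\infty$ and $n\in\mathbb N$. Let $J\in\mathbb C^{n\times n}$ be invertible and skew-Hermitian, and let $q,w$ be $n\times n$ matrices of distributions of order $0$ on $(a,b)$ (equivalently, of set functions on $(a,b)$ which are complex measures on each compact subset), with $q$ Hermitian and $w$ non-negative, such that $2J\pm\Delta_q(x)$ is invertible for every $x\in(a,b)$, where $\Delta_q(x)=q(\{x\})$ is the jump at $x$ of an antiderivative of $q$. Let $\mathcal L^2(w)$ be the space of measurable $f:(a,b)\to\mathbb C^n$ with $\int f^*wf<\infty$, and let $L^2(w)$ be the Hilbert space obtained by identifying $f$ and $g$ if $\int (f-g)^*w(f-g)=0$, with scalar product $\langle f,g\rangle=\int f^*wg$. A function $u:(a,b)\to\mathbb C^n$ of locally bounded variation with one-sided limits $u^\pm$ is called balanced if $u=(u^++u^-)/2$. Let $\mathcal T_{\max}$ be the set of pairs $(u,f)\in\mathcal L^2(w)\times\mathcal L^2(w)$ such that $u$ is balanced and of locally bounded variation on $(a,b)$ and $Ju'+qu=wf$ in the sense of distributions; let $T_{\max}\subset L^2(w)\times L^2(w)$ be the relation of all pairs of classes $([u],[f])$ with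 $(u,f)\in\mathcal T_{\max}$, and let $T_{\min}$ consist of those $([u],[f])$ for which, in addition, $\operatorname{supp}u$ is compact in $(a,b)$. The adjoint of a relation $S$ is $S^*=\{(v,g):\langle g,u\rangle=\langle v,f\rangle\text{ for all }(u,f)\in S\}$, and a linear relation $T$ is self-adjoint if $T=T^*$. For $\lambda\in\mathbb C$ let $D_\lambda=\{(u,\lambda u)\in T_{\min}^*\}$ (where $T_{\min}^*=T_{\max}$), let $n_\pm=\dim D_{\pm i}$ be the deficiency indices of $T_{\min}$, and let $V=D_i\oplus D_{-i}$. For $([v],[g]),([u],[f])\in T_{\max}$, with representatives $(v,g),(u,f)\in\mathcal T_{\max}$, let $(v^*Ju)^-(b)$ be the limit of the left limits $(v^*Ju)^-(x)$ as $x\uparrow b$, and $(v^*Ju)^+(a)$ the limit of the right limits $(v^*Ju)^+(x)$ as $x\downarrow a$. Theorem. Suppose that $n_+=n_->0$. (0) The limits $(v^*Ju)^-(b)$ and $(v^*Ju)^+(a)$ exist, and their difference $(v^*Ju)^-(b)-(v^*Ju)^+(a)$ depends only on the classes $([v],[g])$ and $([u],[f])$ and not on the chosen representatives. (1) Let $(v_1,g_1),\dots,(v_{n_+},g_{n_+})$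 be linearly independent elements of $V$ with $\langle(v_k,g_k),(g_\ell,-v_\ell)\rangle=0$ for all $1\le k,\ell\le n_+$. Then $(g_j,-v_j)\in T_{\max}$ for every $j$ (so that $g_j$ has a representative belonging to a pair in $\mathcal T_{\max}$ that represents $(g_j,-v_j)$, and such representatives are used in what follows), and $$T=\{(u,f)\in T_{\max}:(g_j^*Ju)^-(b)-(g_j^*Ju)^+(a)=0\text{ for }j=1,\dots,n_+\}$$ is a self-adjoint restriction of $T_{\max}$. (2) A linear relation $T$ in $L^2(w)\times L^2(w)$ is a self-adjoint restriction of $T_{\max}$ if and only if there are $(v_1,g_1),\dots,(v_{n_+},g_{n_+})$ as in (1) for which $T$ is the relation displayed in (1). -/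

import Mathlib

open MeasureTheory Filter Topology Matrix
open scoped ContDiff ComplexOrder

namespace DistODE

/-- The open interval `(a, b)` of real numbers, where `a = -∞` and `b = ∞` are allowed. -/
def interval (a b : EReal) : Set ℝ := {x | a < (x : EReal) ∧ (x : EReal) < b}

/-- Complex-valued test functions on `(a, b)`: smooth, with compact support in `(a, b)`. -/
structure IsTestFunction (a b : EReal) (φ : ℝ → ℂ) : Prop where
  smooth : ContDiff ℝ ∞ φ
  compact : HasCompactSupport φ
  subset : tsupport φ ⊆ interval a b

/-- An `n × n` matrix of distributions of order `0` on `(a, b)`, that is, of set functions on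
`(a, b)` which restrict to complex measures on every compact subset. It is written as `h • μ`, where
`μ` is a positive measure carried by `(a, b)` and finite on the compact subsets of `(a, b)`, and `h`
is a locally `μ`-integrable matrix function. The distribution is `φ ↦ ∫ φ h dμ`. -/
structure MatrixMeasure (a b : EReal) (n : ℕ) where
  μ : Measure ℝ
  carried : μ (interval a b)ᶜ = 0
  finite_of_compact : ∀ K : Set ℝ, IsCompact K → K ⊆ interval a b → μ K < ⊤
  h : ℝ → Matrix (Fin n) (Fin n) ℂ
  locallyIntegrable : ∀ i j, LocallyIntegrableOn (fun x => h x i j) (interval a b) μ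

namespace MatrixMeasure

variable {a b : EReal} {n : ℕ}

/-- The distribution `q f : φ ↦ ∫ φ f dq = ∫ φ (h f) dμ`. -/
noncomputable def mulApply (q : MatrixMeasure a b n) (f : ℝ → Fin n → ℂ) (φ : ℝ → ℂ) :
    Fin n → ℂ :=
  ∫ x, φ x • (q.h x *ᵥ f x) ∂q.μ

/-- `Δ_q(x) = Q⁺(x) - Q⁻(x)`, the jump at `x` of an antiderivative `Q` of `q`; this is the mass which
`q` assigns to the point `x`. -/
noncomputable def jump (q : MatrixMeasure a b n) (x : ℝ) : Matrix (Fin n) (Fin n) ℂ :=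
  (q.μ.real {x} : ℂ) • q.h x

/-- `q` is Hermitian: `q* = q`. -/
def IsHermitian (q : MatrixMeasure a b n) : Prop := ∀ᵐ x ∂q.μ, (q.h x).IsHermitian

/-- `q` is non-negative: `c* q c` is a non-negative measure for every `c ∈ ℂⁿ`. -/
def IsNonneg (q : MatrixMeasure a b n) : Prop := ∀ᵐ x ∂q.μ, (q.h x).PosSemidef

end MatrixMeasure

/-- A non-negative matrix of distributions of order `0`. -/
structure Weight (a b : EReal) (n : ℕ) extends MatrixMeasure a b n where
  nonneg : toMatrixMeasure.IsNonneg

section L2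

variable {a b : EReal} {n : ℕ} (w : Weight a b n)

/-- The density of the complex measure `f* w g`. -/
noncomputable def sesq (f g : ℝ → Fin n → ℂ) (x : ℝ) : ℂ := star (f x) ⬝ᵥ (w.h x *ᵥ g x)

/-- `f ∈ 𝓛²(w)`: `f` is measurable and `∫ f* w f < ∞`. -/
structure MemL2 (f : ℝ → Fin n → ℂ) : Prop where
  meas : AEStronglyMeasurable f w.μ
  int : Integrable (sesq w f f) w.μ

theorem sesq_meas {f g : ℝ → Fin n → ℂ} (hf : AEStronglyMeasurable f w.μ)
    (hg : AEStronglyMeasurable g w.μ) : AEStronglyMeasurable (sesq w f g) w.μ := by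
  have hr : w.μ.restrict (interval a b) = w.μ :=
    Measure.restrict_eq_self_of_ae_mem (by
      rw [ae_iff]; exact w.carried)
  have hh : ∀ i j, AEStronglyMeasurable (fun x => w.h x i j) w.μ := fun i j => by
    have := (w.locallyIntegrable i j).aestronglyMeasurable
    rwa [hr] at this
  have hf' : ∀ i, AEStronglyMeasurable (fun x => f x i) w.μ := fun i =>
    (continuous_apply i).comp_aestronglyMeasurable hf
  have hg' : ∀ i, AEStronglyMeasurable (fun x => g x i) w.μ := fun i =>
    (continuous_apply i).comp_aestronglyMeasurable hg
  unfold sesq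
  simp only [dotProduct, mulVec, Pi.star_apply]
  refine Finset.aestronglyMeasurable_fun_sum _ fun i _ => ?_
  refine AEStronglyMeasurable.mul (continuous_star.comp_aestronglyMeasurable (hf' i)) ?_
  exact Finset.aestronglyMeasurable_fun_sum _ fun j _ => (hh i j).mul (hg' j)

theorem sesq_add_left (f f' g : ℝ → Fin n → ℂ) (x : ℝ) :
    sesq w (f + f') g x = sesq w f g x + sesq w f' g x := by
  simp [sesq, add_dotProduct]

theorem sesq_add_right (f g g' : ℝ → Fin n → ℂ) (x : ℝ) :
    sesq w f (g + g') x = sesq w f g x + sesq w f g' x := by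
  simp [sesq, mulVec_add, dotProduct_add]

theorem sesq_smul_left (c : ℂ) (f g : ℝ → Fin n → ℂ) (x : ℝ) :
    sesq w (c • f) g x = star c * sesq w f g x := by
  simp [sesq, smul_dotProduct]

theorem sesq_smul_right (c : ℂ) (f g : ℝ → Fin n → ℂ) (x : ℝ) :
    sesq w f (c • g) x = c * sesq w f g x := by
  simp [sesq, mulVec_smul, dotProduct_smul]

theorem sesq_star : ∀ᵐ x ∂w.μ, ∀ f g : ℝ → Fin n → ℂ, star (sesq w g f x) = sesq w f g x := by
  filter_upwards [w.nonneg] with x hx f g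
  unfold sesq
  rw [← star_dotProduct_star, star_star, star_mulVec, hx.isHermitian.eq, ← dotProduct_mulVec]

theorem sesq_self_nonneg : ∀ᵐ x ∂w.μ, ∀ f : ℝ → Fin n → ℂ, 0 ≤ sesq w f f x := by
  filter_upwards [w.nonneg] with x hx f
  exact hx.dotProduct_mulVec_nonneg (f x)

theorem sesq_integrable {f g : ℝ → Fin n → ℂ} (hf : MemL2 w f) (hg : MemL2 w g) :
    Integrable (sesq w f g) w.μ := by
  refine Integrable.mono' (g := fun x => 2 * ((sesq w f f x).re + (sesq w g g x).re))
    ((hf.int.re.add hg.int.re).const_mul 2) (sesq_meas w hf.meas hg.meas) ?_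
  filter_upwards [sesq_self_nonneg w, sesq_star w] with x hp hs
  have key : ∀ c : ℂ, 0 ≤ (sesq w f f x + c * sesq w f g x +
      star c * (star (sesq w f g x) + c * sesq w g g x)).re := by
    intro c
    have h := (Complex.le_def.1 (hp (f + c • g))).1
    rw [sesq_add_left, sesq_add_right, sesq_add_right, sesq_smul_left, sesq_smul_left,
      sesq_smul_right, sesq_smul_right, ← hs g f] at h
    refine le_of_le_of_eq h ?_
    congr 1
    ring
  have h1 := key 1
  have h2 := key (-1)
  have h3 := key Complex.I
  have h4 := key (-Complex.I)
  simp at h1 h2 h3 h4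
  have h5 := Complex.norm_le_abs_re_add_abs_im (sesq w f g x)
  have h6 : |(sesq w f g x).re| ≤ (sesq w f f x).re + (sesq w g g x).re := by
    have h7 := (Complex.le_def.1 (hp f)).1
    have h8 := (Complex.le_def.1 (hp g)).1
    simp at h7 h8
    rw [abs_le]; constructor <;> linarith
  have h9 : |(sesq w f g x).im| ≤ (sesq w f f x).re + (sesq w g g x).re := by
    have h7 := (Complex.le_def.1 (hp f)).1
    have h8 := (Complex.le_def.1 (hp g)).1
    simp at h7 h8
    rw [abs_le]; constructor <;> linarith
  linarith

/-- `𝓛²(w)` as a subspace of the space of all functions. -/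
def l2Submodule : Submodule ℂ (ℝ → Fin n → ℂ) where
  carrier := {f | MemL2 w f}
  zero_mem' := ⟨aestronglyMeasurable_zero, by
    have : sesq w 0 0 = 0 := by funext x; simp [sesq]
    rw [this]; exact integrable_zero _ _ _⟩
  add_mem' := fun {f g} hf hg => ⟨hf.meas.add hg.meas, by
    have : sesq w (f + g) (f + g) =
        fun x => (sesq w f f x + sesq w f g x) + (sesq w g f x + sesq w g g x) := by
      funext x; rw [sesq_add_left, sesq_add_right, sesq_add_right]
    rw [this]
    exact (hf.int.add (sesq_integrable w hf hg)).add ((sesq_integrable w hg hf).add hg.int)⟩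
  smul_mem' := fun c f hf => ⟨hf.meas.const_smul c, by
    have : sesq w (c • f) (c • f) = fun x => star c * (c * sesq w f f x) := by
      funext x; rw [sesq_smul_left, sesq_smul_right]
    rw [this]
    exact (hf.int.const_mul c).const_mul (star c)⟩

/-- The space `𝓛²(w)` of functions. -/
def ScriptL2 : Type := l2Submodule w

noncomputable instance : AddCommGroup (ScriptL2 w) := inferInstanceAs (AddCommGroup (l2Submodule w))

noncomputable instance : Module ℂ (ScriptL2 w) := inferInstanceAs (Module ℂ (l2Submodule w))

variable {w} in
/-- The function underlying an element of `𝓛²(w)`. -/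
def ScriptL2.fn (f : ScriptL2 w) : ℝ → Fin n → ℂ := f.1

theorem ScriptL2.memL2 (f : ScriptL2 w) : MemL2 w f.fn := f.2

/-- The semi-scalar product `⟨f, g⟩ = ∫ f* w g` on `𝓛²(w)`, linear in the second entry. -/
@[reducible] noncomputable def l2Core : PreInnerProductSpace.Core ℂ (ScriptL2 w) where
  inner f g := ∫ x, sesq w f.fn g.fn x ∂w.μ
  conj_inner_symm f g := by
    change star (∫ x, sesq w g.fn f.fn x ∂w.μ) = ∫ x, sesq w f.fn g.fn x ∂w.μ
    rw [Complex.star_def, ← integral_conj]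
    refine integral_congr_ae ?_
    filter_upwards [sesq_star w] with x hx
    exact hx f.fn g.fn
  re_inner_nonneg f := by
    have h : 0 ≤ ∫ x, sesq w f.fn f.fn x ∂w.μ := by
      refine integral_nonneg_of_ae ?_
      filter_upwards [sesq_self_nonneg w] with x hx
      exact hx f.fn
    exact (Complex.le_def.1 h).1
  add_left f g h := by
    rw [← integral_add (sesq_integrable w f.memL2 h.memL2) (sesq_integrable w g.memL2 h.memL2)]
    exact integral_congr_ae (Eventually.of_forall fun x => sesq_add_left w f.fn g.fn h.fn x)
  smul_left f g c := by
    rw [← integral_const_mul]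
    exact integral_congr_ae (Eventually.of_forall fun x => sesq_smul_left w c f.fn g.fn x)

noncomputable instance : SeminormedAddCommGroup (ScriptL2 w) :=
  @InnerProductSpace.Core.toSeminormedAddCommGroup ℂ (ScriptL2 w) _ _ _ (l2Core w)

noncomputable instance : InnerProductSpace ℂ (ScriptL2 w) := InnerProductSpace.ofCore (l2Core w)

/-- The space `L²(w)`: elements of `𝓛²(w)` are identified when their difference has norm `0`. -/
abbrev L2 : Type := SeparationQuotient (ScriptL2 w)

variable {w} in
/-- The class `[f] ∈ L²(w)` of `f ∈ 𝓛²(w)`. -/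
noncomputable def cls (f : ScriptL2 w) : L2 w := SeparationQuotient.mk f

end L2

section Relations

/-- The adjoint `{(v, g) : ⟨g, u⟩ = ⟨v, f⟩ for all (u, f) ∈ S}` of a relation `S ⊆ H × H`. -/
def adjoint {H : Type*} [NormedAddCommGroup H] [InnerProductSpace ℂ H] (S : Set (H × H)) :
    Submodule ℂ (H × H) where
  carrier := {p | ∀ s ∈ S, inner ℂ p.2 s.1 = inner ℂ p.1 s.2}
  zero_mem' := fun s _ => by simp
  add_mem' := fun {p p'} hp hp' s hs => by
    simp only [Prod.snd_add, Prod.fst_add, inner_add_left, hp s hs, hp' s hs]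
  smul_mem' := fun c p hp s hs => by
    simp only [Prod.smul_snd, Prod.smul_fst, inner_smul_left, hp s hs]

/-- A linear relation `T` is self-adjoint if `T = T*`. -/
def IsSelfAdjointRelation {H : Type*} [NormedAddCommGroup H] [InnerProductSpace ℂ H]
    (T : Submodule ℂ (H × H)) : Prop := T = adjoint (T : Set (H × H))

/-- The deficiency space `D_λ = {(u, λ u) ∈ S*}` of a relation `S`. -/
def deficiencySpace {H : Type*} [NormedAddCommGroup H] [InnerProductSpace ℂ H] (S : Set (H × H))
    (lam : ℂ) : Submodule ℂ (H × H) where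
  carrier := {p | p ∈ adjoint S ∧ p.2 = lam • p.1}
  zero_mem' := ⟨(adjoint S).zero_mem, by simp⟩
  add_mem' := fun {p p'} hp hp' => ⟨(adjoint S).add_mem hp.1 hp'.1, by
    rw [Prod.snd_add, Prod.fst_add, smul_add, hp.2, hp'.2]⟩
  smul_mem' := fun c p hp => ⟨(adjoint S).smul_mem c hp.1, by
    rw [Prod.smul_snd, Prod.smul_fst, hp.2, smul_comm]⟩

end Relations

section System

variable {a b : EReal} {n : ℕ}

/-- `u` is a balanced function of locally bounded variation on `(a, b)`, that is, its value at each
point is the mean of its one-sided limits. -/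
structure IsBalancedBV (a b : EReal) (u : ℝ → Fin n → ℂ) : Prop where
  bv : LocallyBoundedVariationOn u (interval a b)
  balanced : ∀ x ∈ interval a b,
    u x = (1 / 2 : ℂ) • (Function.leftLim u x + Function.rightLim u x)

/-- `J u' + q u = w f` as distributions on `(a, b)`. -/
def SolvesSystem (J : Matrix (Fin n) (Fin n) ℂ) (q w : MatrixMeasure a b n)
    (u f : ℝ → Fin n → ℂ) : Prop :=
  ∀ φ : ℝ → ℂ, IsTestFunction a b φ →
    -(∫ x, deriv φ x • (J *ᵥ u x)) + q.mulApply u φ = w.mulApply f φ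

/-- `(u, f) ∈ 𝓣_max`. -/
structure IsMaxPair (J : Matrix (Fin n) (Fin n) ℂ) (q : MatrixMeasure a b n) (w : Weight a b n)
    (u f : ScriptL2 w) : Prop where
  balancedBV : IsBalancedBV a b u.fn
  solves : SolvesSystem J q w.toMatrixMeasure u.fn f.fn

/-- `(u, f) ∈ 𝓣_min`: moreover the support of `u` is compact in `(a, b)`. -/
structure IsMinPair (J : Matrix (Fin n) (Fin n) ℂ) (q : MatrixMeasure a b n) (w : Weight a b n)
    (u f : ScriptL2 w) : Prop extends IsMaxPair J q w u f where
  compactSupport : ∃ K : Set ℝ, IsCompact K ∧ K ⊆ interval a b ∧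
    ∀ x ∈ interval a b, x ∉ K → u.fn x = 0

/-- The maximal relation `T_max`. -/
noncomputable def Tmax (J : Matrix (Fin n) (Fin n) ℂ) (q : MatrixMeasure a b n) (w : Weight a b n) :
    Set (L2 w × L2 w) :=
  {p | ∃ u f : ScriptL2 w, IsMaxPair J q w u f ∧ p = (cls u, cls f)}

/-- The minimal relation `T_min`. -/
noncomputable def Tmin (J : Matrix (Fin n) (Fin n) ℂ) (q : MatrixMeasure a b n) (w : Weight a b n) :
    Set (L2 w × L2 w) :=
  {p | ∃ u f : ScriptL2 w, IsMinPair J q w u f ∧ p = (cls u, cls f)}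

/-- `V = D_i ⊕ D_{-i}`. -/
noncomputable def defectSum (J : Matrix (Fin n) (Fin n) ℂ) (q : MatrixMeasure a b n) (w : Weight a b n) :
    Submodule ℂ (L2 w × L2 w) :=
  deficiencySpace (Tmin J q w) Complex.I ⊔ deficiencySpace (Tmin J q w) (-Complex.I)

/-- The filter of real `x` with `x ↓ a`. -/
noncomputable def atLeftEnd (a : EReal) : Filter ℝ := comap (fun x : ℝ => (x : EReal)) (𝓝[>] a)

/-- The filter of real `x` with `x ↑ b`. -/
noncomputable def atRightEnd (b : EReal) : Filter ℝ := comap (fun x : ℝ => (x : EReal)) (𝓝[<] b)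

/-- The limits `(v*Ju)⁻(b)` of `(v*Ju)⁻(x)` as `x ↑ b` and `(v*Ju)⁺(a)` of `(v*Ju)⁺(x)` as `x ↓ a`
exist, and `(v*Ju)⁻(b) - (v*Ju)⁺(a) = c`. -/
def HasBoundaryForm (a b : EReal) (J : Matrix (Fin n) (Fin n) ℂ) (v u : ℝ → Fin n → ℂ) (c : ℂ) :
    Prop :=
  ∃ β α : ℂ,
    Tendsto (Function.leftLim fun x => star (v x) ⬝ᵥ (J *ᵥ u x)) (atRightEnd b) (𝓝 β) ∧
    Tendsto (Function.rightLim fun x => star (v x) ⬝ᵥ (J *ᵥ u x)) (atLeftEnd a) (𝓝 α) ∧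
    β - α = c

/-- `(v*Ju)⁻(b) - (v*Ju)⁺(a) = c` for classes `P = ([v], [g])` and `Q = ([u], [f])`, whichever
representatives `(v, g), (u, f) ∈ 𝓣_max` are chosen. -/
def BoundaryFormEq (J : Matrix (Fin n) (Fin n) ℂ) (q : MatrixMeasure a b n) (w : Weight a b n)
    (P Q : L2 w × L2 w) (c : ℂ) : Prop :=
  ∀ v g u f : ScriptL2 w, IsMaxPair J q w v g → P = (cls v, cls g) →
    IsMaxPair J q w u f → Q = (cls u, cls f) → HasBoundaryForm a b J v.fn u.fn c

/-- The relation given by the boundary conditions `(g_j*Ju)⁻(b) - (g_j*Ju)⁺(a) = 0` for all `j`,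
where `x j = (v_j, g_j)`; as `(g_j, -v_j)` lies in `T_max`, the representative of `g_j` is taken such
that `(g_j, -v_j)` is in `𝓣_max`. -/
def boundaryRelation (J : Matrix (Fin n) (Fin n) ℂ) (q : MatrixMeasure a b n) (w : Weight a b n)
    {N : ℕ} (x : Fin N → L2 w × L2 w) : Set (L2 w × L2 w) :=
  {p | p ∈ Tmax J q w ∧ ∀ j, BoundaryFormEq J q w ((x j).2, -(x j).1) p 0}

/-- `x j = (v_j, g_j)`, `j = 1, …, N`, are linearly independent elements of `V = D_i ⊕ D_{-i}` such
that `⟨(v_k, g_k), (g_l, -v_l)⟩ = 0` for all `k, l`. -/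
structure IsIsotropicSystem (J : Matrix (Fin n) (Fin n) ℂ) (q : MatrixMeasure a b n)
    (w : Weight a b n) {N : ℕ} (x : Fin N → L2 w × L2 w) : Prop where
  linearIndependent : LinearIndependent ℂ x
  mem : ∀ j, x j ∈ defectSum J q w
  isotropic : ∀ k l, inner ℂ (x k).1 (x l).2 + inner ℂ (x k).2 (-(x l).1) = 0

end System

end DistODE

/-! Put $H=L^2(w)$ and let $U(u,f)=(f,-u)$ on the Hilbert sum $H\oplus H$. This is an isometry with
$U^2=-1$, and the adjoint of a relation $T$ is $\{p : Up\perp T\}$. The theorem thus separates into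
the geometry of $U$ and two analytic facts about the system.

Geometry. Let $M=T_{\min}^*$, a closed subspace with $M^*\subseteq M$. Then $M$ is the orthogonal
sum of $M^*$ and $V=M\cap U^{-1}M$. The space $V$ is $D_i\oplus D_{-i}$, because $U$ acts on $D_{\pm
i}$ as $\pm i$; so $\dim V=2N$. On $V$ the form $\langle x,Uy\rangle$ is nondegenerate. Subspaces
$X\subseteq V$ with $\dim X=N$ and $X\perp UX$ satisfy $UX=X^\perp\cap V$, and this makes $M\cap
X^\perp$ self-adjoint. Conversely a self-adjoint $T\subseteq M$ is $M\cap X^\perp$ with $X=U(T\cap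
V)$. See `skewOrthogonal_eq_self`, `exists_isotropic` and their translation
`symmetric_selfAdjoint_extensions`. The orthogonal decompositions need $L^2(w)$ complete, which is
`completeSpace_scriptL2`.

First analytic fact. Green's formula, in the limit at both ends, gives
$(v^*Ju)^-(b)-(v^*Ju)^+(a)=\langle v,f\rangle-\langle g,u\rangle$ (`IsMaxPair.hasBoundaryForm`). The
right side depends on classes only. With $(g_j,-v_j)$ in place of $(v,g)$ it becomes $\langle
g_j,f\rangle+\langle v_j,u\rangle$, so the $j$-th boundary condition says that $(u,f)$ is orthogonal
to $(v_j,g_j)$ in $H\oplus H$. Green's formula rests on a product rule which has no correction at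
atoms because the functions are balanced (`HasDensity.mul`).

Second analytic fact. $T_{\min}^*=T_{\max}$ (`adjoint_Tmin`). Invertibility of $2J\pm\Delta_q$ lets
an initial value problem be solved across atoms in both directions (`exists_solution`). If $f$ lives
on $[c,d)$ and is orthogonal there to all homogeneous solutions, its solution with zero initial
value has compact support (`exists_isMinPair`). Hence for $(v,g)\in T_{\min}^*$ the function $v$
agrees, modulo the kernel of $w$, with a solution of $Ju'+qu=wg$. -/

namespace DistODE

/-! ### Lagrangian subspaces for an isometry with square $-1$. -/

section Symplectic

variable {K : Type*} [NormedAddCommGroup K] [InnerProductSpace ℂ K]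

local notation "⟪" x ", " y "⟫" => inner ℂ x y

/-- The vectors whose image under `U` is orthogonal to `T`. -/
noncomputable def skewOrthogonal (U : K →ₗ[ℂ] K) (T : Submodule ℂ K) : Submodule ℂ K :=
  Tᗮ.comap U

theorem mem_skewOrthogonal {U : K →ₗ[ℂ] K} {T : Submodule ℂ K} {p : K} :
    p ∈ skewOrthogonal U T ↔ ∀ t ∈ T, ⟪t, U p⟫ = 0 := Iff.rfl

variable {U : K →ₗ[ℂ] K} (hU : ∀ x y, ⟪U x, U y⟫ = ⟪x, y⟫) (hU2 : ∀ x, U (U x) = -x)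
include hU hU2

theorem inner_skew (x y : K) : ⟪U x, y⟫ = -⟪x, U y⟫ := by
  rw [← hU x (U y), hU2, inner_neg_right, neg_neg]

omit hU2 in
theorem isClosed_skewOrthogonal (T : Submodule ℂ K) :
    IsClosed (skewOrthogonal U T : Set K) := by
  have hc : Continuous U := by
    refine (LinearMap.mkContinuous U 1 fun x => ?_).continuous
    have h : ‖U x‖ ^ 2 = ‖x‖ ^ 2 := by
      have := hU x x
      rw [inner_self_eq_norm_sq_to_K, inner_self_eq_norm_sq_to_K] at this
      exact_mod_cast this
    rw [one_mul]
    exact (pow_le_pow_iff_left₀ (norm_nonneg _) (norm_nonneg _) two_ne_zero).1 h.le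
  exact T.isClosed_orthogonal.preimage hc

/-- Since `U` maps `Mᗮ` into `skewOrthogonal U M`, a vector orthogonal to the latter has its image
under `U` orthogonal to `Mᗮ`. This image is in `M` because `M` is closed. -/
theorem exists_decomposition [CompleteSpace K] {M : Submodule ℂ K} (hM : IsClosed (M : Set K))
    (hle : skewOrthogonal U M ≤ M) {p : K} (hp : p ∈ M) :
    ∃ p₀ ∈ skewOrthogonal U M, ∃ p₁ ∈ M ⊓ M.comap U, p = p₀ + p₁ := by
  have hcl := isClosed_skewOrthogonal hU M
  have : CompleteSpace (skewOrthogonal U M) := hcl.completeSpace_coe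
  obtain ⟨p₀, h0, p₁, h1, rfl⟩ := (skewOrthogonal U M).exists_add_mem_mem_orthogonal p
  have hp1 : p₁ ∈ M := by simpa using M.sub_mem hp (hle h0)
  refine ⟨p₀, h0, p₁, ⟨hp1, ?_⟩, rfl⟩
  have : CompleteSpace M := hM.completeSpace_coe
  change U p₁ ∈ M
  rw [← Submodule.orthogonal_orthogonal M, Submodule.mem_orthogonal]
  intro z hz
  have hz' : U z ∈ skewOrthogonal U M := by
    change U (U z) ∈ Mᗮ
    rw [hU2]; exact Mᗮ.neg_mem hz
  have := (Submodule.mem_orthogonal _ _).1 h1 _ hz'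
  rw [inner_skew hU hU2] at this
  simpa using this

-- The two summands of `M` are orthogonal: `U` preserves the inner product, sends `p₁` into `M` and
-- sends `p₀` into `Mᗮ`.
omit hU2 in
theorem inner_skewOrthogonal_defect {M : Submodule ℂ K} {p₀ p₁ : K}
    (h0 : p₀ ∈ skewOrthogonal U M) (h1 : p₁ ∈ M ⊓ M.comap U) : ⟪p₁, p₀⟫ = 0 := by
  have := mem_skewOrthogonal.1 h0 _ h1.2
  rwa [hU] at this

/-- Isotropy puts the image of `X` under `U` inside the part of `M ⊓ M.comap U` orthogonal to `X`.
Both have dimension `N`, so they coincide and `M ⊓ Xᗮ` is the sum of `skewOrthogonal U M` and that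
image. The hypothesis `hback` stands for the fact that an extension of a relation has a smaller
adjoint. -/
theorem skewOrthogonal_eq_self [CompleteSpace K] {M : Submodule ℂ K} (hM : IsClosed (M : Set K))
    (hle : skewOrthogonal U M ≤ M) (hback : ∀ T : Submodule ℂ K, skewOrthogonal U M ≤ T →
      skewOrthogonal U T ≤ M)
    {N : ℕ} [FiniteDimensional ℂ ↥(M ⊓ M.comap U)] (hV : Module.finrank ℂ ↥(M ⊓ M.comap U) = N + N)
    {X : Submodule ℂ K} (hX : X ≤ M ⊓ M.comap U) (hXN : Module.finrank ℂ X = N)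
    (hiso : ∀ x ∈ X, ∀ y ∈ X, ⟪x, U y⟫ = 0) :
    skewOrthogonal U (M ⊓ Xᗮ) = M ⊓ Xᗮ := by
  have hUX : X.map U = Xᗮ ⊓ (M ⊓ M.comap U) := by
    have hinj : Function.Injective U := fun x y h => by
      have := congrArg U h
      rw [hU2, hU2] at this
      exact neg_injective this
    have hle' : X.map U ≤ Xᗮ ⊓ (M ⊓ M.comap U) := by
      rintro _ ⟨x, hx, rfl⟩
      refine ⟨fun y hy => hiso y hy x hx, (hX hx).2, ?_⟩
      change U (U x) ∈ M
      rw [hU2]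
      exact M.neg_mem (hX hx).1
    have hfd : FiniteDimensional ℂ ↥(Xᗮ ⊓ (M ⊓ M.comap U)) :=
      Submodule.finiteDimensional_of_le inf_le_right
    refine Submodule.eq_of_le_of_finrank_le hle' ?_
    rw [Submodule.finrank_add_inf_finrank_orthogonal' hX (n := N) (by rw [hXN, hV]),
      ← (Submodule.equivMapOfInjective U hinj X).finrank_eq, hXN]
  have hM0 : skewOrthogonal U M ≤ M ⊓ Xᗮ := fun p hp => ⟨hle hp, fun x hx =>
    inner_skewOrthogonal_defect hU hp (hX hx)⟩
  ext p
  constructor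
  · intro hp
    refine ⟨hback _ hM0 hp, fun x hx => ?_⟩
    -- Orthogonality of `p` to `x` comes from testing `U p` against `U x`.
    have h1 : U x ∈ M ⊓ Xᗮ := by
      have : U x ∈ X.map U := ⟨x, hx, rfl⟩
      rw [hUX] at this
      exact ⟨this.2.1, this.1⟩
    have := mem_skewOrthogonal.1 hp _ h1
    rwa [hU] at this
  · intro hp
    rw [mem_skewOrthogonal]
    intro t ht
    obtain ⟨t₀, h0, t₁, h1, rfl⟩ := exists_decomposition hU hU2 hM hle ht.1
    have ht1 : t₁ ∈ X.map U := by
      rw [hUX]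
      refine ⟨?_, h1⟩
      have := Xᗮ.sub_mem ht.2 (hM0 h0).2
      simpa using this
    obtain ⟨x, hx, rfl⟩ := ht1
    rw [inner_add_left, hU, hp.2 x hx, add_zero]
    have := mem_skewOrthogonal.1 h0 _ hp.1
    rw [← inner_conj_symm, inner_skew hU hU2, this]
    simp

/-- The witness is the image under `U` of `L = T ⊓ V`. Self-adjointness makes `L` the orthogonal
complement of `X` in `V`; since `U` is injective, `X` and `L` have the same dimension, and these
dimensions add up to `N + N`. -/
theorem exists_isotropic [CompleteSpace K] {M : Submodule ℂ K} (hM : IsClosed (M : Set K))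
    (hle : skewOrthogonal U M ≤ M)
    {N : ℕ} [FiniteDimensional ℂ ↥(M ⊓ M.comap U)] (hV : Module.finrank ℂ ↥(M ⊓ M.comap U) = N + N)
    {T : Submodule ℂ K} (hTM : T ≤ M) (hT : skewOrthogonal U T = T) :
    ∃ X : Submodule ℂ K, X ≤ M ⊓ M.comap U ∧ Module.finrank ℂ X = N ∧
      (∀ x ∈ X, ∀ y ∈ X, ⟪x, U y⟫ = 0) ∧ T = M ⊓ Xᗮ := by
  set V := M ⊓ M.comap U with hVdef
  have hinj : Function.Injective U := fun x y h => by
    have := congrArg U h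
    rw [hU2, hU2] at this
    exact neg_injective this
  have hUV : ∀ x ∈ V, U x ∈ V := fun x hx =>
    ⟨hx.2, by change U (U x) ∈ M; rw [hU2]; exact M.neg_mem hx.1⟩
  have hMT : skewOrthogonal U M ≤ T := by
    intro p hp
    rw [← hT]
    exact fun t ht => hp t (hTM ht)
  set L := T ⊓ V
  set X := L.map U with hXdef
  have hXV : X ≤ V := by
    rintro _ ⟨x, hx, rfl⟩
    exact hUV x hx.2
  have hLX : Xᗮ ⊓ V = L := by
    ext p
    constructor
    · rintro ⟨hp, hpV⟩
      refine ⟨?_, hpV⟩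
      change p ∈ T
      rw [← hT, mem_skewOrthogonal]
      intro t ht
      obtain ⟨t₀, h0, t₁, h1, rfl⟩ := exists_decomposition hU hU2 hM hle (hTM ht)
      have ht1 : t₁ ∈ T := by simpa using T.sub_mem ht (hMT h0)
      have e1 : ⟪t₀, U p⟫ = 0 := by
        rw [← inner_conj_symm, inner_skewOrthogonal_defect hU h0 (hUV p hpV), map_zero]
      have e2 : ⟪t₁, U p⟫ = 0 := by
        have := hp (U t₁) ⟨t₁, ⟨ht1, h1⟩, rfl⟩
        rw [inner_skew hU hU2] at this
        simpa using this
      rw [inner_add_left, e1, e2, add_zero]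
    · rintro ⟨hp, hpV⟩
      refine ⟨?_, hpV⟩
      rintro _ ⟨l, hl, rfl⟩
      rw [inner_skew hU hU2]
      rw [mem_skewOrthogonal.1 (hT.symm ▸ hp : p ∈ skewOrthogonal U T) l hl.1, neg_zero]
  have hXL : Module.finrank ℂ X = Module.finrank ℂ L :=
    (Submodule.equivMapOfInjective U hinj L).finrank_eq.symm
  have hdim := Submodule.finrank_add_inf_finrank_orthogonal hXV
  rw [hLX, hXL, hV] at hdim
  refine ⟨X, hXV, by omega, ?_, ?_⟩
  · rintro _ ⟨l, hl, rfl⟩ _ ⟨l', hl', rfl⟩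
    rw [hU]
    exact mem_skewOrthogonal.1 (hT.symm ▸ hl'.1 : l' ∈ skewOrthogonal U T) l hl.1
  · ext t
    constructor
    · intro ht
      refine ⟨hTM ht, ?_⟩
      rintro _ ⟨l, hl, rfl⟩
      rw [inner_skew hU hU2]
      rw [mem_skewOrthogonal.1 (hT.symm ▸ ht : t ∈ skewOrthogonal U T) l hl.1, neg_zero]
    · rintro ⟨htM, htX⟩
      obtain ⟨t₀, h0, t₁, h1, rfl⟩ := exists_decomposition hU hU2 hM hle htM
      refine T.add_mem (hMT h0) ?_
      have : t₁ ∈ Xᗮ ⊓ V := by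
        refine ⟨?_, h1⟩
        have h0' : t₀ ∈ Xᗮ := fun x hx => inner_skewOrthogonal_defect hU h0 (hXV hx)
        simpa using Xᗮ.sub_mem htX h0'
      rw [hLX] at this
      exact this.1

end Symplectic

/-! ### Adjoints and self-adjoint extensions of relations in a Hilbert sum. -/

section Transfer

variable {H : Type*} [NormedAddCommGroup H] [InnerProductSpace ℂ H]

/-- The map `(u, f) ↦ (f, -u)` on the Hilbert sum `H ⊕ H`. -/
noncomputable def quarterTurn (H : Type*) [NormedAddCommGroup H] [InnerProductSpace ℂ H] :
    WithLp 2 (H × H) →ₗ[ℂ] WithLp 2 (H × H) where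
  toFun p := WithLp.toLp 2 (p.snd, -p.fst)
  map_add' p q := by
    apply (WithLp.equiv 2 (H × H)).injective
    simp [add_comm]
  map_smul' c p := by
    apply (WithLp.equiv 2 (H × H)).injective
    simp

/-- A relation as a subspace of the Hilbert sum `H ⊕ H`. -/
noncomputable def toSum (T : Submodule ℂ (H × H)) : Submodule ℂ (WithLp 2 (H × H)) :=
  T.comap (WithLp.linearEquiv 2 ℂ (H × H)).toLinearMap

theorem mem_toSum {T : Submodule ℂ (H × H)} {p : WithLp 2 (H × H)} :
    p ∈ toSum T ↔ (p.fst, p.snd) ∈ T := Iff.rfl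

theorem toSum_injective : Function.Injective (toSum (H := H)) :=
  Submodule.comap_injective_of_surjective (WithLp.linearEquiv 2 ℂ (H × H)).surjective

theorem exists_toSum (X : Submodule ℂ (WithLp 2 (H × H))) : ∃ T, toSum T = X :=
  ⟨X.map (WithLp.linearEquiv 2 ℂ (H × H)).toLinearMap,
    Submodule.comap_map_eq_of_injective (WithLp.linearEquiv 2 ℂ (H × H)).injective X⟩

theorem finrank_toSum (T : Submodule ℂ (H × H)) :
    Module.finrank ℂ (toSum T) = Module.finrank ℂ T :=
  ((WithLp.linearEquiv 2 ℂ (H × H)).ofSubmodule' T).finrank_eq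

theorem inner_quarterTurn (x y : WithLp 2 (H × H)) :
    inner ℂ x (quarterTurn H y) = inner ℂ x.fst y.snd - inner ℂ x.snd y.fst := by
  rw [WithLp.prod_inner_apply]
  change inner ℂ x.fst y.snd + inner ℂ x.snd (-y.fst) = _
  rw [inner_neg_right, sub_eq_add_neg]

theorem quarterTurn_isometry (x y : WithLp 2 (H × H)) :
    inner ℂ (quarterTurn H x) (quarterTurn H y) = inner ℂ x y := by
  rw [inner_quarterTurn, WithLp.prod_inner_apply]
  change inner ℂ x.snd y.snd - inner ℂ (-x.fst) y.fst = inner ℂ x.fst y.fst + inner ℂ x.snd y.snd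
  rw [inner_neg_left]
  ring

theorem quarterTurn_quarterTurn (x : WithLp 2 (H × H)) :
    quarterTurn H (quarterTurn H x) = -x := rfl

theorem skewOrthogonal_toSum (T : Submodule ℂ (H × H)) :
    skewOrthogonal (quarterTurn H) (toSum T) = toSum (adjoint (T : Set (H × H))) := by
  ext p
  rw [mem_skewOrthogonal, mem_toSum]
  constructor
  · intro h t ht
    have := h (WithLp.toLp 2 t) ht
    rw [inner_quarterTurn, sub_eq_zero] at this
    change inner ℂ p.snd t.1 = inner ℂ p.fst t.2
    rw [← inner_conj_symm, ← inner_conj_symm p.fst]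
    exact congrArg _ this
  · intro h t ht
    have : inner ℂ p.snd t.fst = inner ℂ p.fst t.snd := h _ ht
    rw [inner_quarterTurn, sub_eq_zero, ← inner_conj_symm, ← inner_conj_symm t.snd]
    exact congrArg _ this

theorem adjoint_antitone {S S' : Set (H × H)} (h : S ⊆ S') : adjoint S' ≤ adjoint S :=
  fun _ hp s hs => hp s (h hs)

theorem subset_adjoint_adjoint (S : Set (H × H)) :
    S ⊆ adjoint ((adjoint S : Submodule ℂ (H × H)) : Set (H × H)) := fun s hs p hp => by
  rw [← inner_conj_symm, ← inner_conj_symm s.1, hp s hs]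

theorem isClosed_toSum_adjoint (S : Set (H × H)) :
    IsClosed (toSum (adjoint S) : Set (WithLp 2 (H × H))) := by
  -- Passing to the span does not change the adjoint, and makes the description by `skewOrthogonal`
  -- available.
  have h : adjoint S = adjoint (Submodule.span ℂ S : Set (H × H)) := by
    refine le_antisymm (fun p hp s hs => ?_) (adjoint_antitone Submodule.subset_span)
    induction hs using Submodule.span_induction with
    | mem s hs => exact hp s hs
    | zero => simp
    | add s t _ _ h1 h2 => simp [h1, h2]
    | smul c s _ h => simp [h]
  rw [h, ← skewOrthogonal_toSum]
  exact isClosed_skewOrthogonal quarterTurn_isometry _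

/-- The sum of the two deficiency spaces consists of the `p ∈ S*` with `(p₂, -p₁) ∈ S*`. -/
theorem toSum_defect (S : Set (H × H)) :
    toSum (deficiencySpace S Complex.I ⊔ deficiencySpace S (-Complex.I)) =
      toSum (adjoint S) ⊓ (toSum (adjoint S)).comap (quarterTurn H) := by
  ext p
  rw [mem_toSum]
  constructor
  · intro h
    obtain ⟨x, hx, y, hy, hxy⟩ := Submodule.mem_sup.1 h
    refine ⟨mem_toSum.2 (hxy ▸ (adjoint S).add_mem hx.1 hy.1), ?_⟩
    change (p.snd, -p.fst) ∈ adjoint S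
    have hx2 : x.2 = Complex.I • x.1 := hx.2
    have hy2 : y.2 = (-Complex.I) • y.1 := hy.2
    -- The rotation $(u,f)\mapsto(f,-u)$ is multiplication by $\pm i$ on $D_{\pm i}$.
    have : (p.snd, -p.fst) = Complex.I • x + (-Complex.I) • y := by
      have h1 : p.fst = x.1 + y.1 := (congrArg Prod.fst hxy).symm
      have h2 : p.snd = x.2 + y.2 := (congrArg Prod.snd hxy).symm
      ext
      · simp [h2, hx2, hy2]
      · simp [h1, hx2, hy2, smul_smul, add_comm]
    rw [this]
    exact (adjoint S).add_mem ((adjoint S).smul_mem _ hx.1) ((adjoint S).smul_mem _ hy.1)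
  · rintro ⟨h1, h2⟩
    have h1' : (p.fst, p.snd) ∈ adjoint S := h1
    have h2' : (p.snd, -p.fst) ∈ adjoint S := h2
    -- With $U^2=-1$, the operators $\tfrac12(1\mp iU)$ project onto the eigenspaces of $U$ for $\pm
    -- i$.
    have e : (p.fst, p.snd) = (1 / 2 : ℂ) • ((p.fst, p.snd) - Complex.I • (p.snd, -p.fst)) +
        (1 / 2 : ℂ) • ((p.fst, p.snd) + Complex.I • (p.snd, -p.fst)) := by
      rw [← smul_add, sub_add_add_cancel, ← two_smul ℂ, smul_smul]
      norm_num
    rw [e]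
    refine Submodule.add_mem_sup ?_ ?_
    · refine Submodule.smul_mem _ _ ⟨(adjoint S).sub_mem h1' ((adjoint S).smul_mem _ h2'), ?_⟩
      simp [smul_sub, smul_smul, add_comm]
    · refine Submodule.smul_mem _ _ ⟨(adjoint S).add_mem h1' ((adjoint S).smul_mem _ h2'), ?_⟩
      change p.snd + Complex.I • -p.fst = (-Complex.I) • (p.fst + Complex.I • p.snd)
      rw [smul_add, smul_smul, neg_mul, Complex.I_mul_I, neg_neg, one_smul, smul_neg, neg_smul,
        add_comm]

theorem deficiencySpace_inf (S : Set (H × H)) :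
    deficiencySpace S Complex.I ⊓ deficiencySpace S (-Complex.I) = ⊥ := by
  refine (Submodule.eq_bot_iff _).2 fun p hp => ?_
  have h1 : p.2 = Complex.I • p.1 := hp.1.2
  have h2 : p.2 = (-Complex.I) • p.1 := hp.2.2
  have h3 : ((2 : ℂ) * Complex.I) • p.1 = 0 := by
    rw [two_mul, add_smul, ← h1]
    nth_rewrite 1 [h2]
    rw [h1, ← add_smul]
    simp
  have h4 : p.1 = 0 := by
    rcases smul_eq_zero.1 h3 with h | h
    · simp at h
    · exact h
  ext
  · exact h4
  · rw [h1, h4, smul_zero]; rfl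

/-- In the Hilbert sum, the condition on `p` is orthogonality to every `x j`, and the condition on
pairs of indices says that the span of the `x j` is orthogonal to its own rotation. Both halves are
then the two symplectic theorems applied to the adjoint of `S`. -/
theorem symmetric_selfAdjoint_extensions [CompleteSpace H] (S : Set (H × H))
    (hS : S ⊆ adjoint S) {N : ℕ} (hN : 0 < N)
    (hplus : Module.finrank ℂ (deficiencySpace S Complex.I) = N)
    (hminus : Module.finrank ℂ (deficiencySpace S (-Complex.I)) = N) :
    (∀ x : Fin N → H × H, LinearIndependent ℂ x →
      (∀ j, x j ∈ deficiencySpace S Complex.I ⊔ deficiencySpace S (-Complex.I)) →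
      (∀ k l, inner ℂ (x k).1 (x l).2 + inner ℂ (x k).2 (-(x l).1) = 0) →
      ∃ T : Submodule ℂ (H × H), (T : Set (H × H)) =
        {p | p ∈ adjoint S ∧ ∀ j, inner ℂ (x j).2 p.2 + inner ℂ (x j).1 p.1 = 0} ∧
        IsSelfAdjointRelation T) ∧
    ∀ T : Submodule ℂ (H × H), T ≤ adjoint S → IsSelfAdjointRelation T →
      ∃ x : Fin N → H × H, LinearIndependent ℂ x ∧
        (∀ j, x j ∈ deficiencySpace S Complex.I ⊔ deficiencySpace S (-Complex.I)) ∧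
        (∀ k l, inner ℂ (x k).1 (x l).2 + inner ℂ (x k).2 (-(x l).1) = 0) ∧
        (T : Set (H × H)) =
          {p | p ∈ adjoint S ∧ ∀ j, inner ℂ (x j).2 p.2 + inner ℂ (x j).1 p.1 = 0} := by
  -- `Module.finrank` is zero on infinite-dimensional spaces, so `0 < N` is what yields finite
  -- dimension.
  have fp : FiniteDimensional ℂ (deficiencySpace S Complex.I) :=
    FiniteDimensional.of_finrank_pos (hplus ▸ hN)
  have fm : FiniteDimensional ℂ (deficiencySpace S (-Complex.I)) :=
    FiniteDimensional.of_finrank_pos (hminus ▸ hN)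
  have hle : skewOrthogonal (quarterTurn H) (toSum (adjoint S)) ≤ toSum (adjoint S) := by
    rw [skewOrthogonal_toSum]
    exact Submodule.comap_mono (adjoint_antitone hS)
  have hcl := isClosed_toSum_adjoint S
  have hdim : Module.finrank ℂ (toSum (deficiencySpace S Complex.I ⊔
      deficiencySpace S (-Complex.I))) = N + N := by
    have h := Submodule.finrank_sup_add_finrank_inf_eq (deficiencySpace S Complex.I)
      (deficiencySpace S (-Complex.I))
    rw [deficiencySpace_inf, finrank_bot, add_zero, hplus, hminus] at h
    rw [finrank_toSum, h]
  have hfd : FiniteDimensional ℂ (toSum (deficiencySpace S Complex.I ⊔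
      deficiencySpace S (-Complex.I))) :=
    FiniteDimensional.of_finrank_pos (by omega)
  rw [toSum_defect] at hdim hfd
  have hmem : ∀ {x : Fin N → H × H} {p : WithLp 2 (H × H)},
      p ∈ (Submodule.span ℂ (Set.range fun j => WithLp.toLp 2 (x j)))ᗮ ↔
        ∀ j, inner ℂ (x j).2 p.snd + inner ℂ (x j).1 p.fst = 0 := by
    intro x p
    have e : ∀ j, inner ℂ (WithLp.toLp 2 (x j)) p =
        inner ℂ (x j).2 p.snd + inner ℂ (x j).1 p.fst := fun j => by
      rw [WithLp.prod_inner_apply, add_comm]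
      rfl
    constructor
    · intro h j
      rw [← e]
      exact h _ (Submodule.subset_span ⟨j, rfl⟩)
    · intro h y hy
      induction hy using Submodule.span_induction with
      | mem y hy => obtain ⟨j, rfl⟩ := hy; exact (e j).trans (h j)
      | zero => simp
      | add y z _ _ h1 h2 => rw [inner_add_left, h1, h2, add_zero]
      | smul c y _ h => rw [inner_smul_left, h, mul_zero]
  constructor
  · intro x hli hxV hiso
    set X := Submodule.span ℂ (Set.range fun j => WithLp.toLp 2 (x j)) with hX
    have hXV : X ≤ toSum (adjoint S) ⊓ (toSum (adjoint S)).comap (quarterTurn H) := by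
      rw [← toSum_defect]
      refine Submodule.span_le.2 ?_
      rintro _ ⟨j, rfl⟩
      exact hxV j
    have hXN : Module.finrank ℂ X = N := by
      have : LinearIndependent ℂ fun j => WithLp.toLp 2 (x j) :=
        hli.map' (WithLp.linearEquiv 2 ℂ (H × H)).symm.toLinearMap
          (WithLp.linearEquiv 2 ℂ (H × H)).symm.ker
      rw [hX, finrank_span_eq_card this, Fintype.card_fin]
    have hXiso : ∀ y ∈ X, ∀ z ∈ X, inner ℂ y (quarterTurn H z) = 0 := by
      intro y hy z hz
      have h1 : X ≤ Xᗮ.comap (quarterTurn H) := by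
        refine Submodule.span_le.2 ?_
        rintro _ ⟨l, rfl⟩
        refine hmem.2 fun k => ?_
        rw [← hiso k l, add_comm]
        rfl
      exact h1 hz y hy
    obtain ⟨T, hT⟩ := exists_toSum (toSum (adjoint S) ⊓ Xᗮ)
    refine ⟨T, ?_, ?_⟩
    · ext p
      change WithLp.toLp 2 p ∈ toSum T ↔ _
      rw [hT]
      exact and_congr Iff.rfl hmem
    · apply toSum_injective
      rw [← skewOrthogonal_toSum, hT]
      refine (skewOrthogonal_eq_self quarterTurn_isometry quarterTurn_quarterTurn hcl hle ?_ hdim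
        hXV hXN hXiso).symm
      -- A relation that contains `S**` contains `S`, so its adjoint lies in `S*`.
      intro T' hT'
      obtain ⟨T', rfl⟩ := exists_toSum T'
      rw [skewOrthogonal_toSum] at hT' ⊢
      refine Submodule.comap_mono (adjoint_antitone fun s hs => ?_)
      exact hT' (show WithLp.toLp 2 s ∈ toSum (adjoint (adjoint S : Set (H × H))) from
        subset_adjoint_adjoint S hs)
  · intro T hTS hT
    obtain ⟨X, hXV, hXN, hXiso, hTX⟩ := exists_isotropic quarterTurn_isometry
      quarterTurn_quarterTurn hcl hle hdim (T := toSum T) (Submodule.comap_mono hTS)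
      (by rw [skewOrthogonal_toSum, ← hT])
    have hXfd : FiniteDimensional ℂ X := FiniteDimensional.of_finrank_pos (hXN ▸ hN)
    let B := Module.finBasisOfFinrankEq ℂ X hXN
    let x : Fin N → H × H := fun j => WithLp.ofLp (B j : WithLp 2 (H × H))
    have hspan : Submodule.span ℂ (Set.range fun j => WithLp.toLp 2 (x j)) = X := by
      have h1 : (fun j => WithLp.toLp 2 (x j)) = X.subtype ∘ B := rfl
      rw [h1, Set.range_comp, Submodule.span_image, B.span_eq, Submodule.map_top,
        Submodule.range_subtype]
    refine ⟨x, ?_, ?_, ?_, ?_⟩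
    · exact (B.linearIndependent.map' X.subtype X.ker_subtype).map'
        (WithLp.linearEquiv 2 ℂ (H × H)).toLinearMap (WithLp.linearEquiv 2 ℂ (H × H)).ker
    · intro j
      rw [← toSum_defect] at hXV
      exact hXV (B j).2
    · intro k l
      have := hXiso _ (B k).2 _ (B l).2
      rwa [WithLp.prod_inner_apply] at this
    · ext p
      change WithLp.toLp 2 p ∈ toSum T ↔ _
      rw [hTX, ← hspan]
      exact and_congr Iff.rfl hmem

end Transfer

/-! ### Measurability of matrix-valued functions. -/

section MatrixMeasurability

variable {α : Type*} [MeasurableSpace α] {μ : Measure α} {m n : ℕ}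

theorem aestronglyMeasurable_matrix {A : α → Matrix (Fin m) (Fin n) ℂ}
    (h : ∀ i j, AEStronglyMeasurable (fun x => A x i j) μ) : AEStronglyMeasurable A μ := by
  have h1 : AEMeasurable (fun x i j => A x i j) μ :=
    aemeasurable_pi_iff.2 fun i => aemeasurable_pi_iff.2 fun j => (h i j).aemeasurable
  exact h1.aestronglyMeasurable

theorem aestronglyMeasurable_mulVec {A : α → Matrix (Fin m) (Fin n) ℂ} {f : α → Fin n → ℂ}
    (hA : AEStronglyMeasurable A μ) (hf : AEStronglyMeasurable f μ) :
    AEStronglyMeasurable (fun x => A x *ᵥ f x) μ := by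
  have hc : Continuous fun p : Matrix (Fin m) (Fin n) ℂ × (Fin n → ℂ) => p.1 *ᵥ p.2 :=
    continuous_fst.matrix_mulVec continuous_snd
  exact hc.comp_aestronglyMeasurable (hA.prodMk hf)

theorem stronglyMeasurable_mulVec {A : α → Matrix (Fin m) (Fin n) ℂ} {f : α → Fin n → ℂ}
    (hA : StronglyMeasurable A) (hf : StronglyMeasurable f) :
    StronglyMeasurable (fun x => A x *ᵥ f x) := by
  have hc : Continuous fun p : Matrix (Fin m) (Fin n) ℂ × (Fin n → ℂ) => p.1 *ᵥ p.2 :=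
    continuous_fst.matrix_mulVec continuous_snd
  exact hc.comp_stronglyMeasurable (hA.prodMk hf)

theorem stronglyMeasurable_matrix_inv {A : α → Matrix (Fin n) (Fin n) ℂ}
    (hA : StronglyMeasurable A) : StronglyMeasurable fun x => (A x)⁻¹ := by
  have h1 : StronglyMeasurable fun x => ((A x).det)⁻¹ :=
    ((continuous_id.matrix_det.comp_stronglyMeasurable hA).measurable.inv).stronglyMeasurable
  have h2 : StronglyMeasurable fun x => (A x).adjugate :=
    continuous_id.matrix_adjugate.comp_stronglyMeasurable hA
  simp only [Matrix.inv_def, Ring.inverse_eq_inv']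
  exact h1.smul h2

theorem aestronglyMeasurable_matrix_inv {A : α → Matrix (Fin n) (Fin n) ℂ}
    (hA : AEStronglyMeasurable A μ) : AEStronglyMeasurable (fun x => (A x)⁻¹) μ :=
  ⟨fun x => (hA.mk A x)⁻¹, stronglyMeasurable_matrix_inv hA.stronglyMeasurable_mk,
    hA.ae_eq_mk.mono fun x hx => by simp only [hx]⟩

end MatrixMeasurability

/-! ### A continuous square root on matrices. -/

section MatrixSqrt

open scoped Matrix.Norms.L2Operator MatrixOrder

/-- Taking the root of $|A|=\sqrt{A^*A}$ instead of $A$ gives a map continuous on all matrices. It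
may therefore be composed with a measurable density that is non-negative only almost everywhere. -/
theorem exists_continuous_sqrt (n : ℕ) :
    ∃ g : Matrix (Fin n) (Fin n) ℂ → Matrix (Fin n) (Fin n) ℂ, Continuous g ∧
      ∀ A, A.PosSemidef → (g A).IsHermitian ∧ g A * g A = A := by
  have hc : Continuous fun A : Matrix (Fin n) (Fin n) ℂ => CFC.sqrt (star A * A) :=
    CFC.continuousOn_sqrt.comp_continuous (by fun_prop) fun A => star_mul_self_nonneg A
  refine ⟨fun A => CFC.sqrt (CFC.sqrt (star A * A)),
    CFC.continuousOn_sqrt.comp_continuous hc fun A => by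
      change 0 ≤ CFC.sqrt (star A * A)
      exact CFC.sqrt_nonneg _, fun A hA => ?_⟩
  have hA' : 0 ≤ A := hA.nonneg
  have h1 : CFC.sqrt (star A * A) = A := by
    rw [(IsSelfAdjoint.of_nonneg hA').star_eq]
    exact CFC.sqrt_mul_self A hA'
  simp only [h1]
  exact ⟨(IsSelfAdjoint.of_nonneg (CFC.sqrt_nonneg A)), CFC.sqrt_mul_sqrt_self A hA'⟩

end MatrixSqrt

/-! ### Regularised inversion of a non-negative operator. -/

section Tikhonov

/-- The regularised solutions converge to the orthogonal projection of `v` onto the range of `T`.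
This provides a preimage of `T v` as a limit of explicit formulas, hence one that is measurable in a
parameter. -/
theorem exists_tendsto_regularized {E : Type*} [NormedAddCommGroup E] [InnerProductSpace ℂ E]
    [FiniteDimensional ℂ E] {T : E →ₗ[ℂ] E} (hT : T.IsSymmetric)
    (hT0 : ∀ x, 0 ≤ (inner ℂ x (T x)).re) {v : E} {ε : ℕ → ℝ} (hε : ∀ j, 0 < ε j)
    (hε0 : Tendsto ε atTop (𝓝 0)) {y : ℕ → E} (hy : ∀ j, T (y j) + (ε j : ℂ) • y j = T v) :
    ∃ p, Tendsto y atTop (𝓝 p) ∧ T p = T v := by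
  obtain ⟨_, ⟨z, rfl⟩, b, hb, rfl⟩ := (LinearMap.range T).exists_add_mem_mem_orthogonal v
  have hTb : T b = 0 := by
    rw [← inner_self_eq_zero (𝕜 := ℂ), hT]
    rw [← inner_conj_symm, hb _ ⟨T b, rfl⟩, map_zero]
  refine ⟨T z, ?_, by rw [map_add, hTb, add_zero]⟩
  have key : ∀ j, ‖y j - T z‖ ≤ 2 * ε j * ‖z‖ := by
    intro j
    -- Removing the first-order error $-\varepsilon z$ leaves a remainder $g$ with
    -- $(T+\varepsilon)g=\varepsilon^2z$. Pairing with $g$ and dropping $\langle g,Tg\rangle\ge0$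
    -- gives $\|g\|\le\varepsilon\|z\|$.
    have hg : T (y j - T z + (ε j : ℂ) • z) + (ε j : ℂ) • (y j - T z + (ε j : ℂ) • z) =
        (ε j : ℂ) • (ε j : ℂ) • z := by
      have := hy j
      rw [map_add, hTb, add_zero] at this
      rw [map_add, map_sub, map_smul, smul_add, smul_sub, ← this]
      abel
    set g := y j - T z + (ε j : ℂ) • z with hgdef
    have h1 : ε j * ‖g‖ ^ 2 ≤ ε j * (ε j * (‖g‖ * ‖z‖)) := by
      have h2 := congrArg (fun t => (inner ℂ g t).re) hg
      simp only [inner_add_right, inner_smul_right, Complex.add_re, Complex.re_ofReal_mul] at h2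
      have h3 : (inner ℂ g g).re = ‖g‖ ^ 2 := by
        rw [inner_self_eq_norm_sq_to_K]; norm_cast
      have h4 := hT0 g
      have h5 : (inner ℂ g z).re ≤ ‖g‖ * ‖z‖ := re_inner_le_norm (𝕜 := ℂ) g z
      rw [h3] at h2
      have h6 : ε j * (ε j * (inner ℂ g z).re) ≤ ε j * (ε j * (‖g‖ * ‖z‖)) := by
        have := (hε j).le
        gcongr
      linarith
    have h2 : ‖g‖ ≤ ε j * ‖z‖ := by
      have h3 := le_of_mul_le_mul_left h1 (hε j)
      rcases (norm_nonneg g).eq_or_lt with h | h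
      · rw [← h]; exact mul_nonneg (hε j).le (norm_nonneg _)
      · refine le_of_mul_le_mul_left ?_ h
        calc ‖g‖ * ‖g‖ = ‖g‖ ^ 2 := (sq _).symm
          _ ≤ _ := h3
          _ = _ := by ring
    calc ‖y j - T z‖ = ‖g - (ε j : ℂ) • z‖ := by rw [hgdef, add_sub_cancel_right]
      _ ≤ ‖g‖ + ‖(ε j : ℂ) • z‖ := norm_sub_le _ _
      _ ≤ ε j * ‖z‖ + ε j * ‖z‖ := by
        gcongr
        rw [norm_smul, Complex.norm_real, Real.norm_of_nonneg (hε j).le]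
      _ = _ := by ring
  rw [tendsto_iff_norm_sub_tendsto_zero]
  refine squeeze_zero (fun j => norm_nonneg _) key ?_
  simpa using (hε0.const_mul 2).mul_const ‖z‖

end Tikhonov

/-! ### Completeness of $\mathcal L^2(w)$. -/

section Completeness

variable {a b : EReal} {n : ℕ} (w : Weight a b n)

theorem MatrixMeasure.aestronglyMeasurable (q : MatrixMeasure a b n) :
    AEStronglyMeasurable q.h q.μ := by
  refine aestronglyMeasurable_matrix fun i j => ?_
  have hr : q.μ.restrict (interval a b) = q.μ :=
    Measure.restrict_eq_self_of_ae_mem (by rw [ae_iff]; exact q.carried)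
  have := (q.locallyIntegrable i j).aestronglyMeasurable
  rwa [hr] at this

theorem exists_sqrt_density : ∃ R : ℝ → Matrix (Fin n) (Fin n) ℂ, AEStronglyMeasurable R w.μ ∧
    ∀ᵐ x ∂w.μ, (R x).IsHermitian ∧ R x * R x = w.h x := by
  obtain ⟨g, hg, hg'⟩ := exists_continuous_sqrt n
  exact ⟨fun x => g (w.h x), hg.comp_aestronglyMeasurable w.aestronglyMeasurable,
    w.nonneg.mono fun x hx => hg' _ hx⟩

variable {w} in
theorem norm_sq_sqrt_mulVec {R W : Matrix (Fin n) (Fin n) ℂ} (hR : R.IsHermitian)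
    (hRW : R * R = W) (v : Fin n → ℂ) :
    ((‖WithLp.toLp 2 (R *ᵥ v)‖ ^ 2 : ℝ) : ℂ) = star v ⬝ᵥ (W *ᵥ v) := by
  have h : inner ℂ (WithLp.toLp 2 (R *ᵥ v)) (WithLp.toLp 2 (R *ᵥ v)) =
      star v ⬝ᵥ (W *ᵥ v) := by
    rw [EuclideanSpace.inner_toLp_toLp, dotProduct_comm, star_mulVec, hR.eq, ← dotProduct_mulVec,
      mulVec_mulVec, hRW]
  rw [← h, inner_self_eq_norm_sq_to_K]
  norm_cast

theorem ScriptL2.ext_fn {f g : ScriptL2 w} (h : f.fn = g.fn) : f = g := Subtype.ext h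

theorem ScriptL2.inner_def (f g : ScriptL2 w) : inner ℂ f g = ∫ x, sesq w f.fn g.fn x ∂w.μ := rfl

/-- With $R=\sqrt{w}$, the map $f\mapsto Rf$ is isometric into the ordinary $L^2$ space of the
scalar measure, so it suffices that its range is closed. A limit has values in the range of $R(x)$
for almost every $x$, because a subsequence converges almost everywhere and these ranges are
finite-dimensional. A measurable preimage comes from regularisation. -/
theorem completeSpace_scriptL2 : CompleteSpace (ScriptL2 w) := by
  obtain ⟨R, hRm, hR⟩ := exists_sqrt_density w
  have hmeas : ∀ f : ℝ → Fin n → ℂ, AEStronglyMeasurable f w.μ →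
      AEStronglyMeasurable (fun x => WithLp.toLp 2 (R x *ᵥ f x)) w.μ := fun f hf =>
    (PiLp.continuous_toLp 2 _).comp_aestronglyMeasurable (aestronglyMeasurable_mulVec hRm hf)
  have hsq : ∀ f : ℝ → Fin n → ℂ, ∀ᵐ x ∂w.μ,
      ((‖WithLp.toLp 2 (R x *ᵥ f x)‖ ^ 2 : ℝ) : ℂ) = sesq w f f x := fun f =>
    hR.mono fun x hx => norm_sq_sqrt_mulVec hx.1 hx.2 (f x)
  have hmem : ∀ f : ℝ → Fin n → ℂ, MemL2 w f →
      MemLp (fun x => WithLp.toLp 2 (R x *ᵥ f x)) 2 w.μ := fun f hf => by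
    rw [memLp_two_iff_integrable_sq_norm (hmeas f hf.meas)]
    refine hf.int.re.congr ((hsq f).mono fun x hx => ?_)
    change (sesq w f f x).re = _
    rw [← hx, Complex.ofReal_re]
  let Φ : ScriptL2 w →+ Lp (EuclideanSpace ℂ (Fin n)) 2 w.μ :=
    { toFun := fun f => (hmem f.fn f.memL2).toLp _
      map_zero' := by
        rw [← MemLp.toLp_zero (MemLp.zero' (p := 2) (μ := w.μ) (ε := EuclideanSpace ℂ (Fin n)))]
        exact MemLp.toLp_congr _ _ (Eventually.of_forall fun x => by
          change WithLp.toLp 2 (R x *ᵥ 0) = 0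
          rw [mulVec_zero]; rfl)
      map_add' := fun f g => by
        rw [← MemLp.toLp_add]
        exact MemLp.toLp_congr _ _ (Eventually.of_forall fun x => by
          change WithLp.toLp 2 (R x *ᵥ (f.fn x + g.fn x)) = WithLp.toLp 2 _ + WithLp.toLp 2 _
          rw [mulVec_add]; rfl) }
  have hΦ : Isometry Φ := by
    refine AddMonoidHomClass.isometry_of_norm Φ fun f => ?_
    rw [@norm_eq_sqrt_re_inner ℂ, @norm_eq_sqrt_re_inner ℂ, L2.inner_def, ScriptL2.inner_def]
    congr 2
    refine integral_congr_ae ?_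
    filter_upwards [hsq f.fn, (hmem f.fn f.memL2).coeFn_toLp] with x hx hx'
    have hx'' : Φ f x = WithLp.toLp 2 (R x *ᵥ f.fn x) := hx'
    rw [hx'', ← hx, inner_self_eq_norm_sq_to_K]
    norm_cast
  refine hΦ.isUniformInducing.completeSpace (IsClosed.isComplete ?_)
  refine isClosed_of_closure_subset fun F hF => ?_
  obtain ⟨s, hs, hsF⟩ := mem_closure_iff_seq_limit.1 hF
  choose f hf using hs
  obtain ⟨ns, -, hns⟩ := (tendstoInMeasure_of_tendsto_Lp hsF).exists_seq_tendsto_ae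
  have hrange : ∀ᵐ x ∂w.μ, ∃ v, F x = WithLp.toLp 2 (R x *ᵥ v) := by
    have h1 : ∀ᵐ x ∂w.μ, ∀ k, s k x = WithLp.toLp 2 (R x *ᵥ (f k).fn x) := by
      rw [ae_all_iff]
      intro k
      rw [← hf k]
      exact (hmem (f k).fn (f k).memL2).coeFn_toLp
    filter_upwards [hns, h1] with x hx hx1
    let S : Submodule ℂ (EuclideanSpace ℂ (Fin n)) :=
      LinearMap.range ((WithLp.linearEquiv 2 ℂ (Fin n → ℂ)).symm.toLinearMap ∘ₗ (R x).mulVecLin)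
    have hS : F x ∈ (S : Set (EuclideanSpace ℂ (Fin n))) :=
      S.closed_of_finiteDimensional.mem_of_tendsto hx (Eventually.of_forall fun k =>
        ⟨(f (ns k)).fn x, (hx1 (ns k)).symm⟩)
    obtain ⟨v, hv⟩ := hS
    exact ⟨v, hv.symm⟩
  let ε : ℕ → ℝ := fun j => 1 / ((j : ℝ) + 1)
  have hε : ∀ j, 0 < ε j := fun j => Nat.one_div_pos_of_nat
  have hε0 : Tendsto ε atTop (𝓝 0) := tendsto_one_div_add_atTop_nhds_zero_nat
  let A : ℕ → ℝ → Matrix (Fin n) (Fin n) ℂ := fun j x => w.h x + (ε j : ℂ) • 1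
  -- If $F=Rv$ then $RF=wv$, so $y_j=(w+\varepsilon_j)^{-1}wv$ is the regularised solution, written
  -- without reference to the unmeasured choice of $v$.
  let y : ℕ → ℝ → Fin n → ℂ := fun j x => (A j x)⁻¹ *ᵥ (R x *ᵥ WithLp.ofLp (F x))
  have hy : ∀ j, AEStronglyMeasurable (y j) w.μ := fun j =>
    aestronglyMeasurable_mulVec (aestronglyMeasurable_matrix_inv
      (w.aestronglyMeasurable.add aestronglyMeasurable_const))
      (aestronglyMeasurable_mulVec hRm
        ((PiLp.continuous_ofLp 2 _).comp_aestronglyMeasurable (Lp.aestronglyMeasurable F)))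
  have hlim : ∀ᵐ x ∂w.μ, ∃ p : Fin n → ℂ, Tendsto (fun j => y j x) atTop (𝓝 p) ∧
      WithLp.toLp 2 (R x *ᵥ p) = F x := by
    filter_upwards [hrange, hR, w.nonneg] with x hx hRx hw
    obtain ⟨v, hv⟩ := hx
    let T := Matrix.toEuclideanLin (w.h x)
    have hTapp : ∀ u : EuclideanSpace ℂ (Fin n), T u = WithLp.toLp 2 (w.h x *ᵥ u.ofLp) :=
      fun u => rfl
    have hT0 : ∀ u : EuclideanSpace ℂ (Fin n), 0 ≤ (inner ℂ u (T u)).re := fun u => by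
      have := (Complex.le_def.1 (hw.dotProduct_mulVec_nonneg u.ofLp)).1
      rw [hTapp]
      change 0 ≤ (inner ℂ (WithLp.toLp 2 u.ofLp) (WithLp.toLp 2 (w.h x *ᵥ u.ofLp))).re
      rw [EuclideanSpace.inner_toLp_toLp, dotProduct_comm]
      exact this
    have hdet : ∀ j, IsUnit (A j x).det := fun j => by
      have : (A j x).PosDef := by
        refine Matrix.PosDef.posSemidef_add hw ?_
        refine Matrix.PosDef.smul Matrix.PosDef.one ?_
        exact_mod_cast hε j
      exact (Matrix.isUnit_iff_isUnit_det _).1 this.isUnit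
    obtain ⟨p, hp, hTp⟩ := exists_tendsto_regularized
      (T := T) (Matrix.isSymmetric_toEuclideanLin_iff.2 hw.isHermitian) hT0
      (v := WithLp.toLp 2 v) hε hε0 (y := fun j => WithLp.toLp 2 (y j x)) (fun j => by
        rw [hTapp, hTapp]
        have h1 : A j x *ᵥ y j x = R x *ᵥ WithLp.ofLp (F x) := by
          change A j x *ᵥ ((A j x)⁻¹ *ᵥ _) = _
          rw [mulVec_mulVec, Matrix.mul_nonsing_inv _ (hdet j), one_mulVec]
        rw [hv] at h1
        change A j x *ᵥ y j x = R x *ᵥ (R x *ᵥ v) at h1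
        rw [mulVec_mulVec v (R x) (R x), hRx.2, add_mulVec, smul_mulVec, one_mulVec] at h1
        exact congrArg (WithLp.toLp 2) h1)
    refine ⟨p.ofLp, ((PiLp.continuous_ofLp 2 _).tendsto p).comp hp, ?_⟩
    -- $w(p-v)=0$ forces $R(p-v)=0$, since $\|Ry\|^2=y^*wy$.
    rw [hv, ← sub_eq_zero]
    have h2 : WithLp.toLp 2 (R x *ᵥ p.ofLp) - WithLp.toLp 2 (R x *ᵥ v) =
        WithLp.toLp 2 (R x *ᵥ (p.ofLp - v)) := by rw [mulVec_sub]; rfl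
    have h3 : w.h x *ᵥ (p.ofLp - v) = 0 := by
      rw [mulVec_sub, sub_eq_zero]
      exact (WithLp.toLp_injective 2) hTp
    rw [h2, ← norm_eq_zero, ← sq_eq_zero_iff, ← Complex.ofReal_eq_zero,
      norm_sq_sqrt_mulVec hRx.1 hRx.2, h3, dotProduct_zero]
  obtain ⟨g, hg, hgl⟩ := exists_stronglyMeasurable_limit_of_tendsto_ae hy
    (hlim.mono fun x ⟨p, hp, _⟩ => ⟨p, hp⟩)
  have hgF : ∀ᵐ x ∂w.μ, WithLp.toLp 2 (R x *ᵥ g x) = F x := by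
    filter_upwards [hlim, hgl] with x ⟨p, hp, hpF⟩ hx
    rw [tendsto_nhds_unique hx hp, hpF]
  have hgm : MemL2 w g := by
    refine ⟨hg.aestronglyMeasurable, ?_⟩
    have h1 := (memLp_two_iff_integrable_sq_norm (Lp.aestronglyMeasurable F)).1 (Lp.memLp F)
    refine h1.ofReal.congr ?_
    filter_upwards [hgF, hsq g] with x hx hx'
    rw [← hx', hx]; rfl
  refine ⟨(⟨g, hgm⟩ : l2Submodule w), Lp.ext ?_⟩
  exact (MemLp.coeFn_toLp (hmem g hgm)).trans hgF

instance : CompleteSpace (ScriptL2 w) := completeSpace_scriptL2 w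

end Completeness

/-! ### Volterra equations over strict initial segments. -/

section Volterra

open scoped ENNReal

variable {α : Type*} [MeasurableSpace α]

/-- The iterated integrals of `1` over the initial segments `S x`. -/
noncomputable def iterIntegral (κ : Measure α) (S : α → Set α) : ℕ → α → ℝ≥0∞
  | 0 => fun _ => 1
  | k + 1 => fun x => ∫⁻ t in S x, iterIntegral κ S k t ∂κ

variable {S : α → Set α} (hS : MeasurableSet {p : α × α | p.2 ∈ S p.1})
  (htrans : ∀ ⦃x t⦄, t ∈ S x → S t ⊆ S x) (hasymm : ∀ ⦃s t⦄, s ∈ S t → t ∉ S s)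
include hS

theorem measurableSet_segment (x : α) : MeasurableSet (S x) :=
  measurable_prodMk_left (x := x) hS

theorem measurable_iterIntegral (κ : Measure α) [SFinite κ] (k : ℕ) :
    Measurable (iterIntegral κ S k) := by
  induction k with
  | zero => exact measurable_const
  | succ k ih =>
    have h : ∀ x, iterIntegral κ S (k + 1) x =
        ∫⁻ t, {p : α × α | p.2 ∈ S p.1}.indicator (fun p => iterIntegral κ S k p.2) (x, t) ∂κ := by
      intro x
      change ∫⁻ t in S x, iterIntegral κ S k t ∂κ = _
      rw [← lintegral_indicator (measurableSet_segment hS x)]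
      rfl
    rw [funext h]
    exact ((ih.comp measurable_snd).indicator hS).lintegral_prod_right'

include htrans hasymm

/-- After exchanging integrals, both terms of the induction integrate the same function of `s` over
pairs `(s, t)` in `S x × S x`, one over `t ∈ S s` and the other over `s ∈ S t`. Asymmetry makes
these regions disjoint, so atoms of `κ` do no harm and the factorial decay familiar from continuous
measures persists. -/
theorem iterIntegral_succ_le (κ : Measure α) [SFinite κ] (k : ℕ) (x : α) :
    (k + 1 : ℕ) * iterIntegral κ S (k + 1) x ≤ iterIntegral κ S k x * κ (S x) := by
  induction k generalizing x with
  | zero => simp [iterIntegral]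
  | succ k ih =>
    have hE := measurable_iterIntegral hS κ k
    set E := iterIntegral κ S k with hEdef
    have hmS := measurableSet_segment hS
    have hmS' : MeasurableSet {p : α × α | p.1 ∈ S p.2} := measurable_swap hS
    calc ((k + 1 + 1 : ℕ) : ℝ≥0∞) * iterIntegral κ S (k + 1 + 1) x
        = (k + 1 : ℕ) * iterIntegral κ S (k + 1 + 1) x + iterIntegral κ S (k + 1 + 1) x := by
          push_cast; ring
      _ ≤ ∫⁻ s in S x, E s * κ (S s) ∂κ + ∫⁻ t in S x, ∫⁻ s in S t, E s ∂κ ∂κ := by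
          refine add_le_add ?_ le_rfl
          change _ * ∫⁻ t in S x, iterIntegral κ S (k + 1) t ∂κ ≤ _
          rw [← lintegral_const_mul _ (measurable_iterIntegral hS κ (k + 1))]
          exact lintegral_mono fun s => ih s
      _ = ∫⁻ s in S x, ∫⁻ t in S x, (S s).indicator (fun _ => E s) t ∂κ ∂κ +
          ∫⁻ s in S x, ∫⁻ t in S x, {t | s ∈ S t}.indicator (fun _ => E s) t ∂κ ∂κ := by
          congr 1
          · refine setLIntegral_congr_fun (hmS x) fun s hs => ?_
            change _ = ∫⁻ t in S x, (S s).indicator (fun _ => E s) t ∂κ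
            rw [lintegral_indicator (hmS s), Measure.restrict_restrict (hmS s),
              Set.inter_eq_left.2 (htrans hs), lintegral_const, Measure.restrict_apply_univ]
          · have h1 : ∫⁻ t in S x, ∫⁻ s in S t, E s ∂κ ∂κ =
                ∫⁻ t in S x, ∫⁻ s in S x, (S t).indicator E s ∂κ ∂κ := by
              refine setLIntegral_congr_fun (hmS x) fun t ht => ?_
              rw [lintegral_indicator (hmS t), Measure.restrict_restrict (hmS t),
                Set.inter_eq_left.2 (htrans ht)]
            rw [h1, lintegral_lintegral_swap]
            · rfl
            · exact ((hE.comp measurable_snd).indicator hS).aemeasurable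
      _ = ∫⁻ s in S x, ∫⁻ t in S x, ((S s).indicator (fun _ => E s) t +
            {t | s ∈ S t}.indicator (fun _ => E s) t) ∂κ ∂κ := by
          rw [← lintegral_add_left]
          · refine lintegral_congr fun s => ?_
            rw [lintegral_add_left (measurable_const.indicator (hmS s))]
          · exact ((hE.comp measurable_fst).indicator hS).lintegral_prod_right'
      _ ≤ ∫⁻ s in S x, ∫⁻ _ in S x, E s ∂κ ∂κ := by
          refine lintegral_mono fun s => lintegral_mono fun t => ?_
          by_cases h1 : t ∈ S s
          · have h2 : s ∉ S t := hasymm h1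
            simp [h1, h2]
          · simp only [Set.indicator_of_notMem h1, zero_add]
            exact Set.indicator_le_self' (fun _ _ => zero_le) t
      _ = iterIntegral κ S (k + 1) x * κ (S x) := by
          simp only [lintegral_const, Measure.restrict_apply_univ]
          rw [lintegral_mul_const _ hE]
          rfl

theorem iterIntegral_le (κ : Measure α) [SFinite κ] (k : ℕ) (x : α) :
    iterIntegral κ S k x ≤ κ (S x) ^ k / (k.factorial : ℝ≥0∞) := by
  have hf : ∀ m : ℕ, (m.factorial : ℝ≥0∞) ≠ 0 := fun m => by
    exact_mod_cast m.factorial_ne_zero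
  rw [ENNReal.le_div_iff_mul_le (Or.inl (hf k)) (Or.inl (ENNReal.natCast_ne_top _))]
  induction k with
  | zero => simp [iterIntegral]
  | succ k ih =>
    calc iterIntegral κ S (k + 1) x * ((k + 1).factorial : ℝ≥0∞)
        = ((k + 1 : ℕ) * iterIntegral κ S (k + 1) x) * (k.factorial : ℝ≥0∞) := by
          rw [Nat.factorial_succ]; push_cast; ring
      _ ≤ (iterIntegral κ S k x * κ (S x)) * (k.factorial : ℝ≥0∞) := by
          exact mul_le_mul_left (iterIntegral_succ_le hS htrans hasymm κ k x) _
      _ = (iterIntegral κ S k x * (k.factorial : ℝ≥0∞)) * κ (S x) := by ring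
      _ ≤ κ (S x) ^ k * κ (S x) := by gcongr
      _ = _ := (pow_succ _ _).symm

omit [MeasurableSpace α] hS htrans hasymm in
theorem tsum_pow_div_factorial_ne_top {r : ℝ≥0∞} (hr : r ≠ ⊤) :
    ∑' k : ℕ, r ^ k / (k.factorial : ℝ≥0∞) ≠ ⊤ := by
  lift r to NNReal using hr
  have h : ∀ k : ℕ, (r : ℝ≥0∞) ^ k / (k.factorial : ℝ≥0∞) =
      ENNReal.ofReal ((r : ℝ) ^ k / k.factorial) := fun k => by
    rw [ENNReal.ofReal_div_of_pos (by exact_mod_cast k.factorial_pos),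
      ENNReal.ofReal_pow r.coe_nonneg, ENNReal.ofReal_coe_nnreal, ENNReal.ofReal_natCast]
  simp_rw [h]
  rw [← ENNReal.ofReal_tsum_of_nonneg (fun k => by positivity)
    (Real.summable_pow_div_factorial _)]
  exact ENNReal.ofReal_ne_top

/-- The solution is the Picard series. Its terms are dominated by the iterated integrals of the
measure with density `k`, hence by an exponential series, which also justifies integrating term by
term. -/
theorem exists_volterra {n : ℕ} {μ : Measure α} [SFinite μ]
    {A : α → Matrix (Fin n) (Fin n) ℂ} (hA : StronglyMeasurable A) {k : α → ℝ≥0∞}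
    (hk : Measurable k) (hAk : ∀ t v, ‖A t *ᵥ v‖ₑ ≤ k t * ‖v‖ₑ)
    (hint : ∀ x, ∫⁻ t in S x, k t ∂μ ≠ ⊤) {φ : α → Fin n → ℂ} (hφ : StronglyMeasurable φ)
    (hφb : ∀ x, ∃ C : ℝ≥0∞, C ≠ ⊤ ∧ ∀ t ∈ S x, ‖φ t‖ₑ ≤ C) :
    ∃ y : α → Fin n → ℂ, StronglyMeasurable y ∧
      (∀ x, ∃ C : ℝ≥0∞, C ≠ ⊤ ∧ ∀ t ∈ S x, ‖y t‖ₑ ≤ C) ∧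
      ∀ x, y x = φ x + ∫ t in S x, A t *ᵥ y t ∂μ := by
  have hmS := measurableSet_segment hS
  let κ := μ.withDensity k
  let T : ℕ → α → Fin n → ℂ :=
    fun m => Nat.rec φ (fun _ T x => ∫ t in S x, A t *ᵥ T t ∂μ) m
  have hTsucc : ∀ m x, T (m + 1) x = ∫ t in S x, A t *ᵥ T m t ∂μ := fun m x => rfl
  have hTm : ∀ m, StronglyMeasurable (T m) := by
    intro m
    induction m with
    | zero => exact hφ
    | succ m ih =>
      have h : ∀ x, T (m + 1) x =
          ∫ t, {p : α × α | p.2 ∈ S p.1}.indicator (fun p => A p.2 *ᵥ T m p.2) (x, t) ∂μ := by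
        intro x
        rw [hTsucc, ← integral_indicator (hmS x)]
        rfl
      rw [funext h]
      refine StronglyMeasurable.integral_prod_right
        (f := fun x t => {p : α × α | p.2 ∈ S p.1}.indicator (fun p => A p.2 *ᵥ T m p.2) (x, t)) ?_
      exact ((stronglyMeasurable_mulVec hA ih).comp_measurable measurable_snd).indicator hS
  have hstep : ∀ (x : α) (C : ℝ≥0∞) (m : ℕ), (∀ t ∈ S x, ‖T m t‖ₑ ≤ C * iterIntegral κ S m t) →
      ∫⁻ t in S x, ‖A t *ᵥ T m t‖ₑ ∂μ ≤ C * iterIntegral κ S (m + 1) x := by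
    intro x C m h
    have hE := measurable_iterIntegral hS κ m
    change _ ≤ C * ∫⁻ t in S x, iterIntegral κ S m t ∂(μ.withDensity k)
    rw [setLIntegral_withDensity_eq_setLIntegral_mul _ hk hE (hmS x),
      ← lintegral_const_mul _ (hk.mul hE)]
    refine setLIntegral_mono' (hmS x) fun t ht => (hAk t _).trans ?_
    calc k t * ‖T m t‖ₑ ≤ k t * (C * iterIntegral κ S m t) := by gcongr; exact h t ht
      _ = C * ((k * iterIntegral κ S m) t) := by rw [Pi.mul_apply]; ring
  have hbound : ∀ (x : α) (C : ℝ≥0∞), (∀ t ∈ S x, ‖φ t‖ₑ ≤ C) → ∀ m, ∀ t ∈ S x,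
      ‖T m t‖ₑ ≤ C * iterIntegral κ S m t := by
    intro x C hC m
    induction m with
    | zero => intro t ht; simpa [iterIntegral, T] using hC t ht
    | succ m ih =>
      intro t ht
      exact (enorm_integral_le_lintegral_enorm _).trans
        (hstep t C m fun s hs => ih s (htrans ht hs))
  have hκ : ∀ x, κ (S x) ≠ ⊤ := fun x => by
    rw [withDensity_apply _ (hmS x)]; exact hint x
  have hsum : ∀ (x : α) (C : ℝ≥0∞), C ≠ ⊤ → ∑' m : ℕ, C * iterIntegral κ S m x ≤
      C * ∑' m : ℕ, κ (S x) ^ m / (m.factorial : ℝ≥0∞) := fun x C _ => by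
    rw [ENNReal.tsum_mul_left]
    gcongr with m
    exact iterIntegral_le hS htrans hasymm κ m x
  have hTsum : ∀ x, ∑' m, ‖T m x‖ₑ ≠ ⊤ := by
    intro x
    obtain ⟨C, hC, hCb⟩ := hφb x
    -- The bound `C` holds on `S x`, which does not contain `x`; the term with `φ x` covers `m = 0`.
    have h1 : ∀ m, ‖T m x‖ₑ ≤ (C + ‖φ x‖ₑ) * iterIntegral κ S m x := by
      intro m
      rcases m with _ | m
      · simp [iterIntegral, T]
      · refine (enorm_integral_le_lintegral_enorm _).trans ((hstep x C m (hbound x C hCb m)).trans ?_)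
        gcongr
        exact le_self_add
    have hC' : C + ‖φ x‖ₑ ≠ ⊤ := ENNReal.add_ne_top.2 ⟨hC, enorm_ne_top⟩
    exact ne_top_of_le_ne_top (ENNReal.mul_ne_top hC' (tsum_pow_div_factorial_ne_top (hκ x)))
      ((ENNReal.tsum_le_tsum h1).trans (hsum x _ hC'))
  have hTs : ∀ x, Summable fun m => T m x := fun x => by
    refine Summable.of_nnnorm ?_
    exact ENNReal.tsum_coe_ne_top_iff_summable.1 (hTsum x)
  refine ⟨fun x => ∑' m, T m x, ?_, ?_, ?_⟩
  · refine stronglyMeasurable_of_tendsto (u := atTop)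
      (f := fun N x => ∑ m ∈ Finset.range N, T m x)
      (fun N => Finset.stronglyMeasurable_fun_sum _ fun m _ => hTm m) ?_
    exact tendsto_pi_nhds.2 fun x => (hTs x).hasSum.tendsto_sum_nat
  · intro x
    obtain ⟨C, hC, hCb⟩ := hφb x
    refine ⟨C * ∑' m : ℕ, κ (S x) ^ m / (m.factorial : ℝ≥0∞),
      ENNReal.mul_ne_top hC (tsum_pow_div_factorial_ne_top (hκ x)), fun t ht => ?_⟩
    calc ‖∑' m, T m t‖ₑ ≤ ∑' m, ‖T m t‖ₑ := enorm_tsum_le_tsum_enorm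
      _ ≤ ∑' m, C * iterIntegral κ S m t := ENNReal.tsum_le_tsum fun m => hbound x C hCb m t ht
      _ ≤ C * ∑' m : ℕ, κ (S t) ^ m / (m.factorial : ℝ≥0∞) := hsum t C hC
      _ ≤ _ := by
        gcongr
        exact htrans ht
  · intro x
    obtain ⟨C, hC, hCb⟩ := hφb x
    have h1 : ∀ t, A t *ᵥ (∑' m, T m t) = ∑' m, A t *ᵥ T m t := fun t =>
      (LinearMap.toContinuousLinearMap (A t).mulVecLin).map_tsum (hTs t)
    change ∑' m, T m x = _
    simp_rw [h1]
    rw [integral_tsum (fun m => (stronglyMeasurable_mulVec hA (hTm m)).aestronglyMeasurable),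
      (hTs x).tsum_eq_zero_add]
    · rfl
    · refine ne_top_of_le_ne_top
        (ENNReal.mul_ne_top hC (tsum_pow_div_factorial_ne_top (hκ x))) ?_
      calc ∑' m, ∫⁻ t in S x, ‖A t *ᵥ T m t‖ₑ ∂μ
          ≤ ∑' m, C * iterIntegral κ S (m + 1) x :=
            ENNReal.tsum_le_tsum fun m => hstep x C m (hbound x C hCb m)
        _ ≤ ∑' m, C * iterIntegral κ S m x :=
            ENNReal.tsum_comp_le_tsum_of_injective (add_left_injective 1)
              fun m => C * iterIntegral κ S m x
        _ ≤ _ := hsum x C hC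

end Volterra

/-! ### Points and compact subsets of the interval. -/

section Interval

variable {a b : EReal}

theorem isOpen_interval : IsOpen (interval a b) :=
  (isOpen_Ioo (a := a) (b := b)).preimage continuous_coe_real_ereal

theorem measurableSet_interval : MeasurableSet (interval a b) := isOpen_interval.measurableSet

instance ordConnected_interval : (interval a b).OrdConnected := ⟨fun _ hx _ hy _ hz =>
  ⟨hx.1.trans_le (EReal.coe_le_coe_iff.2 hz.1), (EReal.coe_le_coe_iff.2 hz.2).trans_lt hy.2⟩⟩

theorem Icc_subset_interval {x z : ℝ} (hx : x ∈ interval a b) (hz : z ∈ interval a b) :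
    Set.Icc x z ⊆ interval a b := Set.OrdConnected.out inferInstance hx hz

theorem exists_lt_mem_interval {x : ℝ} (hx : x ∈ interval a b) : ∃ c ∈ interval a b, c < x := by
  obtain ⟨c, h1, h2⟩ := EReal.exists_between_coe_real hx.1
  exact ⟨c, ⟨h1, h2.trans hx.2⟩, EReal.coe_lt_coe_iff.1 h2⟩

theorem exists_gt_mem_interval {x : ℝ} (hx : x ∈ interval a b) : ∃ c ∈ interval a b, x < c := by
  obtain ⟨c, h1, h2⟩ := EReal.exists_between_coe_real hx.2
  exact ⟨c, ⟨hx.1.trans h1, h2⟩, EReal.coe_lt_coe_iff.1 h1⟩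

theorem exists_Icc_superset {K : Set ℝ} (hK : IsCompact K) (hKI : K ⊆ interval a b)
    (hne : (interval a b).Nonempty) :
    ∃ c ∈ interval a b, ∃ d ∈ interval a b, c < d ∧ K ⊆ Set.Ioo c d := by
  obtain ⟨e, he⟩ := hne
  have hK' : IsCompact (insert e K) := hK.insert e
  have hKI' : insert e K ⊆ interval a b := Set.insert_subset he hKI
  obtain ⟨x, hx⟩ := hK'.exists_isLeast ⟨e, Set.mem_insert _ _⟩
  obtain ⟨z, hz⟩ := hK'.exists_isGreatest ⟨e, Set.mem_insert _ _⟩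
  obtain ⟨c, hc, hcx⟩ := exists_lt_mem_interval (hKI' hx.1)
  obtain ⟨d, hd, hzd⟩ := exists_gt_mem_interval (hKI' hz.1)
  exact ⟨c, hc, d, hd, (hcx.trans_le (hx.2 hz.1)).trans hzd, fun t ht =>
    ⟨hcx.trans_le (hx.2 (Set.mem_insert_of_mem _ ht)),
      (hz.2 (Set.mem_insert_of_mem _ ht)).trans_lt hzd⟩⟩

end Interval

/-! ### Set integrals over varying sets. -/

section Limits

variable {α E : Type*} [MeasurableSpace α] {μ : Measure α} [NormedAddCommGroup E] [NormedSpace ℝ E]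

theorem tendsto_setIntegral_of_eventually_mem_iff {ι : Type*} {l : Filter ι}
    [l.IsCountablyGenerated] {s : ι → Set α} {s₀ K : Set α} {F : α → E}
    (hs : ∀ᶠ i in l, MeasurableSet (s i)) (hs₀ : MeasurableSet s₀) (hF : IntegrableOn F K μ)
    (hK : MeasurableSet K) (hsub : ∀ᶠ i in l, s i ⊆ K)
    (hpt : ∀ x, ∀ᶠ i in l, (x ∈ s i ↔ x ∈ s₀)) :
    Tendsto (fun i => ∫ x in s i, F x ∂μ) l (𝓝 (∫ x in s₀, F x ∂μ)) := by
  have h1 : ∀ᶠ i in l, ∫ x in s i, F x ∂μ = ∫ x, (s i).indicator F x ∂μ :=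
    hs.mono fun i hi => (integral_indicator hi).symm
  rw [tendsto_congr' h1, ← integral_indicator hs₀]
  refine tendsto_integral_filter_of_dominated_convergence (K.indicator fun x => ‖F x‖) ?_ ?_ ?_ ?_
  · filter_upwards [hs, hsub] with i hi hi'
    exact ((hF.mono_set hi').integrable_indicator hi).aestronglyMeasurable
  · filter_upwards [hsub] with i hi
    refine Eventually.of_forall fun x => ?_
    rw [norm_indicator_eq_indicator_norm]
    exact Set.indicator_le_indicator_of_subset hi (fun _ => norm_nonneg _) x
  · exact IntegrableOn.integrable_indicator hF.norm hK
  · refine Eventually.of_forall fun x => ?_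
    refine tendsto_const_nhds.congr' ?_
    filter_upwards [hpt x] with i hi
    by_cases h : x ∈ s₀
    · rw [Set.indicator_of_mem h, Set.indicator_of_mem (hi.2 h)]
    · rw [Set.indicator_of_notMem h, Set.indicator_of_notMem fun h' => h (hi.1 h')]

end Limits

/-! ### Balanced functions whose derivative is a measure. -/

section Density

variable {a b : EReal} {μ : Measure ℝ} {E : Type*} [NormedAddCommGroup E] [NormedSpace ℝ E]

theorem tendsto_setIntegral_Ico_left {F : ℝ → E} {c x : ℝ} (hcx : c < x)
    (hF : IntegrableOn F (Set.Icc c x) μ) :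
    Tendsto (fun t => ∫ s in Set.Ico t x, F s ∂μ) (𝓝[<] x) (𝓝 0) := by
  have h := tendsto_setIntegral_of_eventually_mem_iff (l := 𝓝[<] x) (s := fun t => Set.Ico t x)
    (s₀ := ∅) (Eventually.of_forall fun _ => measurableSet_Ico) MeasurableSet.empty hF
    measurableSet_Icc ?_ ?_
  · simpa using h
  · filter_upwards [Ioo_mem_nhdsLT hcx] with t ht s hs using ⟨ht.1.le.trans hs.1, hs.2.le⟩
  · intro s
    rcases lt_or_ge s x with h | h
    · filter_upwards [Ioo_mem_nhdsLT h] with t ht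
      simp [ht.1]
    · exact Eventually.of_forall fun t => by simp [h]

theorem tendsto_setIntegral_Ico_right {F : ℝ → E} {x d : ℝ} (hxd : x < d)
    (hF : IntegrableOn F (Set.Icc x d) μ) :
    Tendsto (fun t => ∫ s in Set.Ico x t, F s ∂μ) (𝓝[>] x) (𝓝 (∫ s in {x}, F s ∂μ)) := by
  refine tendsto_setIntegral_of_eventually_mem_iff (l := 𝓝[>] x) (s := fun t => Set.Ico x t)
    (Eventually.of_forall fun _ => measurableSet_Ico) (measurableSet_singleton x) hF
    measurableSet_Icc ?_ ?_
  · filter_upwards [Ioo_mem_nhdsGT hxd] with t ht s hs using ⟨hs.1, hs.2.le.trans ht.2.le⟩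
  · intro s
    rcases lt_trichotomy s x with h | rfl | h
    · exact Eventually.of_forall fun t => by simp [h.ne, h.not_ge]
    · filter_upwards [self_mem_nhdsWithin] with t ht
      simpa using ht
    · filter_upwards [Ioo_mem_nhdsGT h] with t ht
      simp [h.ne', ht.2.le]

theorem tendsto_setIntegral_Ioc_right {F : ℝ → E} {x d : ℝ} (hxd : x < d)
    (hF : IntegrableOn F (Set.Icc x d) μ) :
    Tendsto (fun t => ∫ s in Set.Ioc x t, F s ∂μ) (𝓝[>] x) (𝓝 0) := by
  have h := tendsto_setIntegral_of_eventually_mem_iff (l := 𝓝[>] x) (s := fun t => Set.Ioc x t)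
    (s₀ := ∅) (Eventually.of_forall fun _ => measurableSet_Ioc) MeasurableSet.empty hF
    measurableSet_Icc ?_ ?_
  · simpa using h
  · filter_upwards [Ioo_mem_nhdsGT hxd] with t ht s hs using ⟨hs.1.le, hs.2.trans ht.2.le⟩
  · intro s
    rcases lt_or_ge x s with h | h
    · filter_upwards [Ioo_mem_nhdsGT h] with t ht
      simp [ht.2]
    · exact Eventually.of_forall fun t => by simp [h]

theorem norm_measureReal_smul_le {F : ℝ → E} {s : Set ℝ} {t : ℝ} (ht : t ∈ s)
    (hF : IntegrableOn F s μ) : ‖μ.real {t} • F t‖ ≤ ∫ r in s, ‖F r‖ ∂μ := by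
  rw [norm_smul, Real.norm_of_nonneg measureReal_nonneg, ← smul_eq_mul,
    ← integral_singleton (f := fun r => ‖F r‖)]
  exact setIntegral_mono_set hF.norm (Eventually.of_forall fun _ => norm_nonneg _)
    (Set.singleton_subset_iff.2 ht).eventuallyLE

/-- An atom at `t` contributes at most the integral of `‖F‖` over `[t, x)`, which vanishes as `t`
approaches `x`. Hence the half-jumps in balanced values disappear in one-sided limits. -/
theorem tendsto_atom_left {F : ℝ → E} {c x : ℝ} (hcx : c < x)
    (hF : IntegrableOn F (Set.Icc c x) μ) :
    Tendsto (fun t => μ.real {t} • F t) (𝓝[<] x) (𝓝 0) := by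
  refine squeeze_zero_norm' ?_ (tendsto_setIntegral_Ico_left hcx hF.norm)
  filter_upwards [Ioo_mem_nhdsLT hcx] with t ht
  exact norm_measureReal_smul_le (Set.left_mem_Ico.2 ht.2)
    (hF.mono_set fun s hs => ⟨ht.1.le.trans hs.1, hs.2.le⟩)

theorem tendsto_atom_right {F : ℝ → E} {x d : ℝ} (hxd : x < d)
    (hF : IntegrableOn F (Set.Icc x d) μ) :
    Tendsto (fun t => μ.real {t} • F t) (𝓝[>] x) (𝓝 0) := by
  refine squeeze_zero_norm' ?_ (tendsto_setIntegral_Ioc_right hxd hF.norm)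
  filter_upwards [Ioo_mem_nhdsGT hxd] with t ht
  exact norm_measureReal_smul_le (Set.right_mem_Ioc.2 ht.1)
    (hF.mono_set fun s hs => ⟨hs.1.le, hs.2.trans ht.2.le⟩)

/-- `u` is a balanced function of locally bounded variation on `(a, b)` whose derivative is the
measure `F μ`. -/
structure HasDensity (a b : EReal) (μ : Measure ℝ) (u F : ℝ → E) : Prop where
  integrableOn : ∀ x ∈ interval a b, ∀ z ∈ interval a b, IntegrableOn F (Set.Icc x z) μ
  tendsto_left : ∀ x ∈ interval a b, Tendsto u (𝓝[<] x) (𝓝 (Function.leftLim u x))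
  increment : ∀ x ∈ interval a b, ∀ z ∈ interval a b, x ≤ z →
    Function.leftLim u z - Function.leftLim u x = ∫ t in Set.Ico x z, F t ∂μ
  balanced : ∀ x ∈ interval a b, u x = Function.leftLim u x + (1 / 2 : ℝ) • μ.real {x} • F x

namespace HasDensity

variable {u F : ℝ → E} [CompleteSpace E]

omit [CompleteSpace E] in
-- The given primitive over half-open intervals is left continuous, and the half-jump at `t` tends
-- to zero as `t ↑ x`; so `Y` is the left limit of `u`.
theorem of_primitive {Y : ℝ → E}
    (hF : ∀ x ∈ interval a b, ∀ z ∈ interval a b, IntegrableOn F (Set.Icc x z) μ)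
    (hY : ∀ x ∈ interval a b, ∀ z ∈ interval a b, x ≤ z → Y z - Y x = ∫ t in Set.Ico x z, F t ∂μ)
    (hu : ∀ x ∈ interval a b, u x = Y x + (1 / 2 : ℝ) • μ.real {x} • F x) :
    HasDensity a b μ u F ∧ ∀ x ∈ interval a b, Function.leftLim u x = Y x := by
  have hlim : ∀ x ∈ interval a b, Tendsto u (𝓝[<] x) (𝓝 (Y x)) := by
    intro x hx
    obtain ⟨c, hc, hcx⟩ := exists_lt_mem_interval hx
    have h1 := tendsto_setIntegral_Ico_left hcx (hF c hc x hx)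
    have h2 := tendsto_atom_left hcx (hF c hc x hx)
    have h3 := (h1.const_sub (Y x)).add (h2.const_smul (1 / 2 : ℝ))
    rw [sub_zero, smul_zero, add_zero] at h3
    refine h3.congr' ?_
    filter_upwards [Ioo_mem_nhdsLT hcx] with t ht
    have htI := Icc_subset_interval hc hx ⟨ht.1.le, ht.2.le⟩
    rw [hu t htI, ← hY t htI x hx ht.2.le, sub_sub_cancel]
  have hl : ∀ x ∈ interval a b, Function.leftLim u x = Y x := fun x hx =>
    leftLim_eq_of_tendsto (hlim x hx)
  refine ⟨⟨hF, fun x hx => ?_, fun x hx z hz hxz => ?_, fun x hx => ?_⟩, hl⟩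
  · rw [hl x hx]; exact hlim x hx
  · rw [hl x hx, hl z hz]; exact hY x hx z hz hxz
  · rw [hl x hx]; exact hu x hx

theorem tendsto_leftLim_right (h : HasDensity a b μ u F) {x : ℝ} (hx : x ∈ interval a b) :
    Tendsto (Function.leftLim u) (𝓝[>] x) (𝓝 (Function.leftLim u x + μ.real {x} • F x)) := by
  obtain ⟨d, hd, hxd⟩ := exists_gt_mem_interval hx
  have h1 := (tendsto_setIntegral_Ico_right hxd (h.integrableOn x hx d hd)).const_add
    (Function.leftLim u x)
  rw [integral_singleton] at h1
  refine h1.congr' ?_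
  filter_upwards [Ioo_mem_nhdsGT hxd] with t ht
  rw [← h.increment x hx t (Icc_subset_interval hx hd ⟨ht.1.le, ht.2.le⟩) ht.1.le,
    add_sub_cancel]

theorem tendsto_right (h : HasDensity a b μ u F) {x : ℝ} (hx : x ∈ interval a b) :
    Tendsto u (𝓝[>] x) (𝓝 (Function.leftLim u x + μ.real {x} • F x)) := by
  obtain ⟨d, hd, hxd⟩ := exists_gt_mem_interval hx
  have h1 := (h.tendsto_leftLim_right hx).add
    ((tendsto_atom_right hxd (h.integrableOn x hx d hd)).const_smul (1 / 2 : ℝ))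
  rw [smul_zero, add_zero] at h1
  refine h1.congr' ?_
  filter_upwards [Ioo_mem_nhdsGT hxd] with t ht
  exact (h.balanced t (Icc_subset_interval hx hd ⟨ht.1.le, ht.2.le⟩)).symm

theorem rightLim_eq (h : HasDensity a b μ u F) {x : ℝ} (hx : x ∈ interval a b) :
    Function.rightLim u x = Function.leftLim u x + μ.real {x} • F x :=
  rightLim_eq_of_tendsto (h.tendsto_right hx)

omit [CompleteSpace E] in
-- A change on a null set cannot take place at an atom, so balanced values are unaffected.
theorem congr_ae {G : ℝ → E} (h : HasDensity a b μ u F)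
    (hG : ∀ᵐ x ∂μ, x ∈ interval a b → F x = G x) : HasDensity a b μ u G where
  integrableOn x hx z hz := (h.integrableOn x hx z hz).congr_fun_ae <| by
    rw [EventuallyEq, ae_restrict_iff' measurableSet_Icc]
    exact hG.mono fun t ht htI => ht (Icc_subset_interval hx hz htI)
  tendsto_left := h.tendsto_left
  increment x hx z hz hxz := by
    rw [h.increment x hx z hz hxz]
    refine setIntegral_congr_ae measurableSet_Ico (hG.mono fun t ht htI => ht ?_)
    exact Icc_subset_interval hx hz ⟨htI.1, htI.2.le⟩
  balanced x hx := by
    rw [h.balanced x hx]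
    by_cases h0 : μ {x} = 0
    · simp [measureReal_def, h0]
    · have : F x = G x := by
        by_contra hne
        refine h0 (measure_mono_null (Set.singleton_subset_iff.2 ?_) hG)
        exact fun h' => hne (h' hx)
      rw [this]

theorem comp_clm {E' : Type*} [NormedAddCommGroup E'] [NormedSpace ℝ E']
    [CompleteSpace E'] (h : HasDensity a b μ u F) (L : E →L[ℝ] E') :
    HasDensity a b μ (fun x => L (u x)) (fun x => L (F x)) ∧
      ∀ x ∈ interval a b, Function.leftLim (fun x => L (u x)) x = L (Function.leftLim u x) := by
  refine of_primitive (Y := fun x => L (Function.leftLim u x))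
    (fun x hx z hz => L.integrable_comp (h.integrableOn x hx z hz)) (fun x hx z hz hxz => ?_)
    (fun x hx => ?_)
  · rw [← map_sub, h.increment x hx z hz hxz, L.integral_comp_comm]
    exact (h.integrableOn x hx z hz).mono_set Set.Ico_subset_Icc_self
  · simp only [h.balanced x hx, map_add, map_smul]

theorem norm_sub_le (h : HasDensity a b μ u F) {s t : ℝ} (hs : s ∈ interval a b)
    (ht : t ∈ interval a b) (hst : s < t) : ‖u t - u s‖ ≤ (1 / 2 : ℝ) * (μ.real {s} * ‖F s‖) +
      ∫ r in Set.Ioo s t, ‖F r‖ ∂μ + (1 / 2 : ℝ) * (μ.real {t} * ‖F t‖) := by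
  have hi : IntegrableOn F (Set.Ioo s t) μ :=
    (h.integrableOn s hs t ht).mono_set Set.Ioo_subset_Icc_self
  have h1 : u t - u s = (1 / 2 : ℝ) • μ.real {s} • F s + ∫ r in Set.Ioo s t, F r ∂μ +
      (1 / 2 : ℝ) • μ.real {t} • F t := by
    have h2 := h.increment s hs t ht hst.le
    have h4 : IntegrableOn F {s} μ :=
      (h.integrableOn s hs t ht).mono_set (Set.singleton_subset_iff.2 ⟨le_rfl, hst.le⟩)
    rw [← Set.Ioo_union_left hst, Set.union_comm, setIntegral_union (by simp) measurableSet_Ioo h4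
      hi, integral_singleton] at h2
    rw [h.balanced t ht, h.balanced s hs, sub_eq_iff_eq_add.1 h2]
    module
  rw [h1]
  refine (norm_add_le _ _).trans (add_le_add ((norm_add_le _ _).trans (add_le_add ?_
    (norm_integral_le_integral_norm _))) ?_)
  all_goals
    rw [norm_smul, norm_smul, Real.norm_of_nonneg measureReal_nonneg]
    norm_num

/-- Increments of `u` are dominated by those of `g`, the balanced primitive of `‖F‖`. This function
is monotone and bounded on compact intervals, hence of bounded variation. -/
theorem locallyBoundedVariationOn (h : HasDensity a b μ u F) :
    LocallyBoundedVariationOn u (interval a b) := by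
  intro c d hc hd
  let g : ℝ → ℝ := fun t => ∫ r in Set.Ico c t, ‖F r‖ ∂μ + (1 / 2 : ℝ) * (μ.real {t} * ‖F t‖)
  have hsub : interval a b ∩ Set.Icc c d ⊆ Set.Icc c d := Set.inter_subset_right
  have hg : ∀ s ∈ interval a b ∩ Set.Icc c d, ∀ t ∈ interval a b ∩ Set.Icc c d, s ≤ t →
      ‖u t - u s‖ ≤ g t - g s := by
    intro s hs t ht hst
    rcases hst.eq_or_lt with rfl | hst
    · simp
    refine (h.norm_sub_le hs.1 ht.1 hst).trans (le_of_eq ?_)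
    have hi : IntegrableOn (fun r => ‖F r‖) (Set.Icc c d) μ := (h.integrableOn c hc d hd).norm
    have h1 : ∫ r in Set.Ico c t, ‖F r‖ ∂μ = ∫ r in Set.Ico c s, ‖F r‖ ∂μ +
        (μ.real {s} * ‖F s‖ + ∫ r in Set.Ioo s t, ‖F r‖ ∂μ) := by
      rw [← smul_eq_mul (μ.real {s}), ← integral_singleton (f := fun r => ‖F r‖),
        ← setIntegral_union (by simp) measurableSet_Ioo, Set.union_comm {s},
        Set.Ioo_union_left hst, ← setIntegral_union, Set.Ico_union_Ico_eq_Ico hs.2.1 hst.le]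
      · exact Set.disjoint_left.2 fun x hx hx' => hx.2.not_ge hx'.1
      · exact measurableSet_Ico
      · exact hi.mono_set fun x hx => ⟨hx.1, hx.2.le.trans hs.2.2⟩
      · exact hi.mono_set fun x hx => ⟨hs.2.1.trans hx.1, hx.2.le.trans ht.2.2⟩
      · exact hi.mono_set (Set.singleton_subset_iff.2 hs.2)
      · exact hi.mono_set fun x hx => ⟨hs.2.1.trans hx.1.le, hx.2.le.trans ht.2.2⟩
    change _ = _ + _ - (_ + _)
    rw [h1]
    ring
  have hmono : MonotoneOn g (interval a b ∩ Set.Icc c d) := fun s hs t ht hst => by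
    have := (norm_nonneg _).trans (hg s hs t ht hst)
    linarith
  have hgd : ∀ x ∈ interval a b ∩ Set.Icc c d, |g x| ≤ |g c| + |g d| := by
    intro x hx
    have hcd : c ≤ d := hx.2.1.trans hx.2.2
    have h1 := hmono ⟨hc, le_rfl, hcd⟩ hx hx.2.1
    have h2 := hmono hx ⟨hd, hcd, le_rfl⟩ hx.2.2
    rw [abs_le]
    constructor <;> [have := neg_abs_le (g c); have := le_abs_self (g d)] <;>
      linarith [abs_nonneg (g c), abs_nonneg (g d)]
  refine ne_top_of_le_ne_top (hmono.boundedVariationOn hgd) ?_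
  refine iSup_le fun p => ?_
  refine le_trans (Finset.sum_le_sum fun i _ => ?_)
    (eVariationOn.sum_le p.2.2.1 p.2.2.2)
  have h1 := hg _ (p.2.2.2 i) _ (p.2.2.2 (i + 1)) (p.2.2.1 (Nat.le_succ i))
  rw [edist_dist, edist_dist, dist_eq_norm, Real.dist_eq]
  exact ENNReal.ofReal_le_ofReal (h1.trans (le_abs_self _))

end HasDensity

end Density

/-! ### Integration by parts for balanced functions. -/

section ProductRule

/-- Fubini on the product measure, with the plane cut into the two open half-planes and the
diagonal, where the atoms contribute. -/
theorem integral_mul_integral_eq {ν : Measure ℝ} [SFinite ν] {F G : ℝ → ℂ} (hF : Integrable F ν)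
    (hG : Integrable G ν) :
    Integrable (fun t => (∫ s in Set.Iio t, F s ∂ν) * G t) ν ∧
    Integrable (fun s => F s * ∫ t in Set.Iio s, G t ∂ν) ν ∧
    Integrable (fun s => ν.real {s} • (F s * G s)) ν ∧
    (∫ s, F s ∂ν) * ∫ t, G t ∂ν = ∫ t, (∫ s in Set.Iio t, F s ∂ν) * G t ∂ν +
      ∫ s, F s * ∫ t in Set.Iio s, G t ∂ν ∂ν + ∫ s, ν.real {s} • (F s * G s) ∂ν := by
  let P : ℝ × ℝ → ℂ := fun p => F p.1 * G p.2
  have hP : Integrable P (ν.prod ν) := hF.mul_prod hG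
  have m1 : MeasurableSet {p : ℝ × ℝ | p.1 < p.2} := measurableSet_lt measurable_fst measurable_snd
  have m2 : MeasurableSet {p : ℝ × ℝ | p.2 < p.1} := measurableSet_lt measurable_snd measurable_fst
  have m3 : MeasurableSet {p : ℝ × ℝ | p.2 = p.1} := measurableSet_eq_fun measurable_snd measurable_fst
  have i1 := hP.indicator m1
  have i2 := hP.indicator m2
  have i3 := hP.indicator m3
  have e1 : ∀ t, ∫ s, {p : ℝ × ℝ | p.1 < p.2}.indicator P (s, t) ∂ν =
      (∫ s in Set.Iio t, F s ∂ν) * G t := fun t => by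
    rw [← integral_mul_const, ← integral_indicator measurableSet_Iio]
    rfl
  have e2 : ∀ s, ∫ t, {p : ℝ × ℝ | p.2 < p.1}.indicator P (s, t) ∂ν =
      F s * ∫ t in Set.Iio s, G t ∂ν := fun s => by
    rw [← integral_const_mul, ← integral_indicator measurableSet_Iio]
    rfl
  have e3 : ∀ s, ∫ t, {p : ℝ × ℝ | p.2 = p.1}.indicator P (s, t) ∂ν =
      ν.real {s} • (F s * G s) := fun s => by
    rw [← integral_singleton (f := fun t => F s * G t), ← integral_indicator (measurableSet_singleton s)]
    rfl
  have j1 := i1.integral_prod_right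
  have j2 := i2.integral_prod_left
  have j3 := i3.integral_prod_left
  simp only [e1, e2, e3] at j1 j2 j3
  refine ⟨j1, j2, j3, ?_⟩
  have hsplit : P = {p : ℝ × ℝ | p.1 < p.2}.indicator P + {p : ℝ × ℝ | p.2 < p.1}.indicator P +
      {p : ℝ × ℝ | p.2 = p.1}.indicator P := by
    funext p
    rcases lt_trichotomy p.1 p.2 with h | h | h
    · simp [h, h.not_gt, h.ne']
    · simp [h]
    · simp [h, h.not_gt, h.ne]
  rw [← integral_prod_mul, show (fun z : ℝ × ℝ => F z.1 * G z.2) = P from rfl, hsplit,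
    integral_add' (i1.add i2) i3, integral_add' i1 i2, integral_prod_symm _ i1, integral_prod _ i2,
    integral_prod _ i3]
  simp only [e1, e2, e3]

variable {a b : EReal} {μ : Measure ℝ} [SFinite μ]

/-- The diagonal term of the Fubini splitting is one full product of jumps. The balanced values of
`u` and `v` contain half a jump each, and the two halves together account for it exactly. -/
theorem HasDensity.mul {u F v G : ℝ → ℂ} (hu : HasDensity a b μ u F) (hv : HasDensity a b μ v G)
    {x z : ℝ} (hx : x ∈ interval a b) (hz : z ∈ interval a b) (hxz : x ≤ z) :
    IntegrableOn (fun t => u t * G t + F t * v t) (Set.Ico x z) μ ∧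
    Function.leftLim u z * Function.leftLim v z - Function.leftLim u x * Function.leftLim v x =
      ∫ t in Set.Ico x z, (u t * G t + F t * v t) ∂μ := by
  have hF : IntegrableOn F (Set.Ico x z) μ :=
    (hu.integrableOn x hx z hz).mono_set Set.Ico_subset_Icc_self
  have hG : IntegrableOn G (Set.Ico x z) μ :=
    (hv.integrableOn x hx z hz).mono_set Set.Ico_subset_Icc_self
  obtain ⟨j1, j2, j3, h⟩ := integral_mul_integral_eq hF hG
  have hmem : ∀ t ∈ Set.Ico x z, t ∈ interval a b := fun t ht =>
    Icc_subset_interval hx hz ⟨ht.1, ht.2.le⟩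
  have hr : ∀ t ∈ Set.Ico x z,
      (μ.restrict (Set.Ico x z)).restrict (Set.Iio t) = μ.restrict (Set.Ico x t) := fun t ht => by
    rw [Measure.restrict_restrict measurableSet_Iio]
    congr 1
    ext s
    simp only [Set.mem_inter_iff, Set.mem_Iio, Set.mem_Ico]
    exact ⟨fun h => ⟨h.2.1, h.1⟩, fun h => ⟨h.2, h.1, h.2.trans ht.2⟩⟩
  have hs : ∀ t ∈ Set.Ico x z, (μ.restrict (Set.Ico x z)).real {t} = μ.real {t} := fun t ht => by
    rw [measureReal_restrict_apply (measurableSet_singleton t),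
      Set.inter_eq_left.2 (Set.singleton_subset_iff.2 ht)]
  have hpt : ∀ t ∈ Set.Ico x z, u t * G t + F t * v t =
      ((∫ s in Set.Iio t, F s ∂(μ.restrict (Set.Ico x z))) * G t +
        F t * (∫ s in Set.Iio t, G s ∂(μ.restrict (Set.Ico x z))) +
        (μ.restrict (Set.Ico x z)).real {t} • (F t * G t)) +
        (Function.leftLim u x * G t + F t * Function.leftLim v x) := by
    intro t ht
    rw [hr t ht, hs t ht, hu.balanced t (hmem t ht), hv.balanced t (hmem t ht),
      ← hu.increment x hx t (hmem t ht) ht.1, ← hv.increment x hx t (hmem t ht) ht.1]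
    simp only [Complex.real_smul]
    push_cast
    ring
  have j4 := (hG.const_mul (Function.leftLim u x)).add (hF.mul_const (Function.leftLim v x))
  have j5 := ((j1.add j2).add j3).add j4
  refine ⟨j5.congr ?_, ?_⟩
  · rw [EventuallyEq, ae_restrict_iff' measurableSet_Ico]
    exact Eventually.of_forall fun t ht => (hpt t ht).symm
  · rw [setIntegral_congr_fun measurableSet_Ico hpt]
    change _ = ∫ t in Set.Ico x z, (((fun t => (∫ s in Set.Iio t, F s ∂(μ.restrict (Set.Ico x z))) * G t) +
      (fun t => F t * ∫ s in Set.Iio t, G s ∂(μ.restrict (Set.Ico x z))) +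
      fun t => (μ.restrict (Set.Ico x z)).real {t} • (F t * G t)) + ((fun t => Function.leftLim u x * G t) +
        fun t => F t * Function.leftLim v x)) t ∂μ
    rw [integral_add' ((j1.add j2).add j3) j4, integral_add' (j1.add j2) j3, integral_add' j1 j2,
      integral_add' (hG.const_mul _) (hF.mul_const _), ← h, integral_const_mul,
      integral_mul_const, ← hu.increment x hx z hz hxz, ← hv.increment x hx z hz hxz]
    ring

theorem HasDensity.pairing {n : ℕ} {u F v G : ℝ → Fin n → ℂ} (hv : HasDensity a b μ v G)
    (hu : HasDensity a b μ u F) (J : Matrix (Fin n) (Fin n) ℂ)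
    {x z : ℝ} (hx : x ∈ interval a b) (hz : z ∈ interval a b) (hxz : x ≤ z) :
    star (Function.leftLim v z) ⬝ᵥ (J *ᵥ Function.leftLim u z) -
      star (Function.leftLim v x) ⬝ᵥ (J *ᵥ Function.leftLim u x) =
      ∫ t in Set.Ico x z, (star (v t) ⬝ᵥ (J *ᵥ F t) + star (G t) ⬝ᵥ (J *ᵥ u t)) ∂μ := by
  let p : Fin n → (Fin n → ℂ) →L[ℝ] ℂ := fun i => ContinuousLinearMap.proj i
  -- Conjugation is only real-linear, which is why densities are transported by real-linear maps.
  let pc : Fin n → (Fin n → ℂ) →L[ℝ] ℂ := fun i => Complex.conjCLE.toContinuousLinearMap ∘L p i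
  have hpc : ∀ i (y : Fin n → ℂ), pc i y = star (y i) := fun i y => rfl
  have hp : ∀ i (y : Fin n → ℂ), p i y = y i := fun i y => rfl
  have key : ∀ i j, IntegrableOn (fun t => star (v t i) * F t j + star (G t i) * u t j)
        (Set.Ico x z) μ ∧
      star (Function.leftLim v z i) * Function.leftLim u z j -
        star (Function.leftLim v x i) * Function.leftLim u x j =
        ∫ t in Set.Ico x z, (star (v t i) * F t j + star (G t i) * u t j) ∂μ := fun i j => by
    have h := (hv.comp_clm (pc i)).1.mul (hu.comp_clm (p j)).1 hx hz hxz
    rwa [(hv.comp_clm (pc i)).2 x hx, (hv.comp_clm (pc i)).2 z hz,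
      (hu.comp_clm (p j)).2 x hx, (hu.comp_clm (p j)).2 z hz] at h
  have e : ∀ y y' : Fin n → ℂ, star y ⬝ᵥ (J *ᵥ y') = ∑ i, ∑ j, J i j * (star (y i) * y' j) := by
    intro y y'
    simp only [dotProduct, mulVec, Finset.mul_sum, Pi.star_apply]
    exact Finset.sum_congr rfl fun i _ => Finset.sum_congr rfl fun j _ => by ring
  have e2 : ∀ t, star (v t) ⬝ᵥ (J *ᵥ F t) + star (G t) ⬝ᵥ (J *ᵥ u t) =
      ∑ i, ∑ j, J i j * (star (v t i) * F t j + star (G t i) * u t j) := by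
    intro t
    rw [e, e, ← Finset.sum_add_distrib]
    refine Finset.sum_congr rfl fun i _ => ?_
    rw [← Finset.sum_add_distrib]
    exact Finset.sum_congr rfl fun j _ => by ring
  have e3 : ∫ t in Set.Ico x z, (star (v t) ⬝ᵥ (J *ᵥ F t) + star (G t) ⬝ᵥ (J *ᵥ u t)) ∂μ =
      ∑ i, ∑ j, J i j * (star (Function.leftLim v z i) * Function.leftLim u z j -
        star (Function.leftLim v x i) * Function.leftLim u x j) := by
    refine (integral_congr_ae (Eventually.of_forall e2)).trans ?_
    refine (integral_finsetSum _ fun i _ => integrable_finsetSum _ fun j _ =>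
      (key i j).1.const_mul (J i j)).trans (Finset.sum_congr rfl fun i _ => ?_)
    refine (integral_finsetSum _ fun j _ => (key i j).1.const_mul (J i j)).trans
      (Finset.sum_congr rfl fun j _ => ?_)
    exact (integral_const_mul (J i j) _).trans (congrArg _ (key i j).2.symm)
  rw [e3, e, e, ← Finset.sum_sub_distrib]
  refine Finset.sum_congr rfl fun i _ => ?_
  rw [← Finset.sum_sub_distrib]
  exact Finset.sum_congr rfl fun j _ => by ring

end ProductRule

/-! ### Measurability, bounds and one-sided limits of functions of bounded variation. -/

section Regularity

variable {a b : EReal} {n : ℕ}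

/-- The real and imaginary parts of the components are differences of monotone functions. -/
theorem aestronglyMeasurable_of_locallyBoundedVariationOn {u : ℝ → Fin n → ℂ}
    (hu : LocallyBoundedVariationOn u (interval a b)) (ν : Measure ℝ) :
    AEStronglyMeasurable u (ν.restrict (interval a b)) := by
  have hreal : ∀ g : ℝ → ℝ, LocallyBoundedVariationOn g (interval a b) →
      AEMeasurable g (ν.restrict (interval a b)) := by
    intro g hg
    obtain ⟨p, q, hp, hq, rfl⟩ := hg.exists_monotoneOn_sub_monotoneOn
    exact (aemeasurable_restrict_of_monotoneOn measurableSet_interval hp).sub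
      (aemeasurable_restrict_of_monotoneOn measurableSet_interval hq)
  refine (aemeasurable_pi_iff.2 fun i => ?_).aestronglyMeasurable
  have hre : LipschitzWith 1 fun y : Fin n → ℂ => (y i).re := by
    refine LipschitzWith.of_dist_le_mul fun y y' => ?_
    rw [NNReal.coe_one, one_mul, Real.dist_eq, ← Complex.sub_re, dist_eq_norm]
    exact (Complex.abs_re_le_norm _).trans (norm_le_pi_norm (y - y') i)
  have him : LipschitzWith 1 fun y : Fin n → ℂ => (y i).im := by
    refine LipschitzWith.of_dist_le_mul fun y y' => ?_
    rw [NNReal.coe_one, one_mul, Real.dist_eq, ← Complex.sub_im, dist_eq_norm]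
    exact (Complex.abs_im_le_norm _).trans (norm_le_pi_norm (y - y') i)
  have h1 := hreal _ (hre.comp_locallyBoundedVariationOn hu)
  have h2 := hreal _ (him.comp_locallyBoundedVariationOn hu)
  have h3 := (Complex.measurable_ofReal.comp_aemeasurable h1).add
    ((Complex.measurable_ofReal.comp_aemeasurable h2).mul_const Complex.I)
  refine h3.congr (Eventually.of_forall fun x => ?_)
  exact Complex.re_add_im (u x i)

theorem exists_bound_of_locallyBoundedVariationOn {E : Type*} [NormedAddCommGroup E] {u : ℝ → E}
    (hu : LocallyBoundedVariationOn u (interval a b)) {c d : ℝ} (hc : c ∈ interval a b)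
    (hd : d ∈ interval a b) : ∃ C, 0 ≤ C ∧ ∀ t ∈ Set.Icc c d, ‖u t‖ ≤ C := by
  have h := hu c d hc hd
  refine ⟨‖u c‖ + (eVariationOn u (interval a b ∩ Set.Icc c d)).toReal, by positivity,
    fun t ht => ?_⟩
  have h1 := h.dist_le (x := t) (y := c) ⟨Icc_subset_interval hc hd ht, ht⟩
    ⟨hc, le_rfl, ht.1.trans ht.2⟩
  rw [dist_eq_norm] at h1
  calc ‖u t‖ = ‖u c + (u t - u c)‖ := by rw [add_sub_cancel]
    _ ≤ ‖u c‖ + ‖u t - u c‖ := norm_add_le _ _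
    _ ≤ _ := by gcongr

theorem exists_tendsto_of_locallyBoundedVariationOn {E : Type*} [NormedAddCommGroup E]
    [CompleteSpace E] {u : ℝ → E} (hu : LocallyBoundedVariationOn u (interval a b)) {x : ℝ}
    (hx : x ∈ interval a b) :
    Tendsto u (𝓝[<] x) (𝓝 (Function.leftLim u x)) ∧
      Tendsto u (𝓝[>] x) (𝓝 (Function.rightLim u x)) := by
  obtain ⟨c, hc, hcx⟩ := exists_lt_mem_interval hx
  obtain ⟨d, hd, hxd⟩ := exists_gt_mem_interval hx
  have h := hu c d hc hd
  have hn : interval a b ∩ Set.Icc c d ∈ 𝓝 x :=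
    inter_mem (isOpen_interval.mem_nhds hx) (Icc_mem_nhds hcx hxd)
  obtain ⟨l, hl⟩ := h.exists_tendsto_left x
  obtain ⟨r, hr⟩ := h.exists_tendsto_right x
  rw [Set.inter_comm, nhdsWithin_inter_of_mem' (mem_nhdsWithin_of_mem_nhds hn)] at hl hr
  exact ⟨tendsto_leftLim_of_tendsto ⟨l, hl⟩, tendsto_rightLim_of_tendsto ⟨r, hr⟩⟩

end Regularity

/-! ### One-sided mollifiers and smooth cutoffs. -/

section Mollifier

variable {E : Type*} [NormedAddCommGroup E] [NormedSpace ℝ E] [CompleteSpace E]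

theorem contDiff_smoothTransition : ContDiff ℝ ∞ Real.smoothTransition :=
  Real.smoothTransition.contDiff (n := ⊤)

theorem continuous_deriv_smoothTransition : Continuous (deriv Real.smoothTransition) :=
  contDiff_smoothTransition.continuous_deriv (by simp)

theorem deriv_smoothTransition_eq_zero {s : ℝ} (hs : s ∉ Set.Icc (0 : ℝ) 1) :
    deriv Real.smoothTransition s = 0 := by
  rw [Set.mem_Icc, not_and_or, not_le, not_le] at hs
  rcases hs with hs | hs
  · have : Real.smoothTransition =ᶠ[𝓝 s] fun _ => 0 := by
      filter_upwards [Iio_mem_nhds hs] with t ht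
      exact Real.smoothTransition.zero_of_nonpos (le_of_lt ht)
    rw [this.deriv_eq, deriv_const]
  · have : Real.smoothTransition =ᶠ[𝓝 s] fun _ => 1 := by
      filter_upwards [Ioi_mem_nhds hs] with t ht
      exact Real.smoothTransition.one_of_one_le (le_of_lt ht)
    rw [this.deriv_eq, deriv_const]

theorem hasCompactSupport_deriv_smoothTransition :
    HasCompactSupport (deriv Real.smoothTransition) :=
  HasCompactSupport.intro isCompact_Icc fun _ => deriv_smoothTransition_eq_zero

theorem integral_deriv_smoothTransition : ∫ s, deriv Real.smoothTransition s = 1 := by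
  have h1 : ∫ s in (0 : ℝ)..1, deriv Real.smoothTransition s = 1 := by
    rw [intervalIntegral.integral_deriv_eq_sub
      (fun x _ => (contDiff_smoothTransition.differentiable (by simp)) x)
      (continuous_deriv_smoothTransition.intervalIntegrable _ _)]
    simp
  rw [← h1, intervalIntegral.integral_of_le zero_le_one, ← integral_Icc_eq_integral_Ioc]
  refine (setIntegral_eq_integral_of_forall_compl_eq_zero fun s hs => ?_).symm
  exact deriv_smoothTransition_eq_zero hs

/-- The kernel has integral one and is supported in `[x - ε, x]`, so it sees only values to the left
of `x`, apart from the null set `{x}`. -/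
theorem tendsto_mollifier_left {u : ℝ → E} (hu : AEStronglyMeasurable u volume) {x : ℝ} {l : E}
    (hl : Tendsto u (𝓝[<] x) (𝓝 l)) :
    Tendsto (fun ε : ℝ => ∫ t, (ε⁻¹ * deriv Real.smoothTransition ((t - x) / ε + 1)) • u t)
      (𝓝[>] 0) (𝓝 l) := by
  have hsub : ∀ ε : ℝ, 0 < ε →
      ∫ t, (ε⁻¹ * deriv Real.smoothTransition ((t - x) / ε + 1)) • u t =
      ∫ s, deriv Real.smoothTransition s • u (ε * s + (x - ε)) := by
    intro ε hε
    let h : ℝ → E := fun t => (ε⁻¹ * deriv Real.smoothTransition ((t - x) / ε + 1)) • u t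
    have e1 : ∀ s, deriv Real.smoothTransition s • u (ε * s + (x - ε)) =
        ε • h (ε * s + (x - ε)) := fun s => by
      have : (ε * s + (x - ε) - x) / ε + 1 = s := by field_simp; ring
      simp only [h, this, smul_smul, mul_inv_cancel_left₀ hε.ne']
    simp_rw [e1]
    rw [integral_smul, Measure.integral_comp_mul_left (fun t => h (t + (x - ε))) ε,
      integral_add_right_eq_self, smul_smul, abs_of_pos (inv_pos.2 hε), mul_inv_cancel₀ hε.ne',
      one_smul]
  obtain ⟨δ, hδ, C, hC⟩ : ∃ δ < x, ∃ C, ∀ t ∈ Set.Ioo δ x, ‖u t‖ ≤ C := by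
    have h1 : ∀ᶠ t in 𝓝[<] x, ‖u t‖ ≤ ‖l‖ + 1 :=
      (hl.norm.eventually_lt_const (lt_add_one ‖l‖)).mono fun _ h => h.le
    obtain ⟨δ, hδ, hδ'⟩ := (mem_nhdsLT_iff_exists_Ioo_subset).1 h1
    exact ⟨δ, hδ, ‖l‖ + 1, fun t ht => hδ' ht⟩
  have hfin : Tendsto (fun ε : ℝ => ∫ s, deriv Real.smoothTransition s • u (ε * s + (x - ε)))
      (𝓝[>] 0) (𝓝 (∫ s, deriv Real.smoothTransition s • l)) := by
    -- The point `s = 1` corresponds to `t = x`, where `u` need not be close to `l`.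
    have hne : ∀ᵐ s : ℝ, s ≠ 1 := Measure.ae_ne volume 1
    refine tendsto_integral_filter_of_dominated_convergence
      (fun s => ‖deriv Real.smoothTransition s‖ * C) ?_ ?_ ?_ ?_
    · filter_upwards [self_mem_nhdsWithin] with ε hε
      refine continuous_deriv_smoothTransition.aestronglyMeasurable.smul ?_
      refine hu.comp_quasiMeasurePreserving ?_
      refine (measurePreserving_add_right volume (x - ε)).quasiMeasurePreserving.comp ?_
      refine ⟨measurable_const_mul ε, ?_⟩
      rw [Real.map_volume_mul_left (ne_of_gt hε)]
      exact Measure.smul_absolutelyContinuous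
    · filter_upwards [Ioo_mem_nhdsGT (sub_pos.2 hδ)] with ε hε
      filter_upwards [hne] with s hs
      by_cases hs' : s ∈ Set.Icc (0 : ℝ) 1
      · rw [norm_smul]
        gcongr
        have h1 : s < 1 := lt_of_le_of_ne hs'.2 hs
        refine hC _ ⟨?_, ?_⟩
        · nlinarith [mul_nonneg hε.1.le hs'.1, hε.2]
        · nlinarith [mul_pos hε.1 (sub_pos.2 h1)]
      · simp [deriv_smoothTransition_eq_zero hs']
    · exact ((continuous_deriv_smoothTransition.integrable_of_hasCompactSupport
        hasCompactSupport_deriv_smoothTransition).norm).mul_const C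
    · filter_upwards [hne] with s hs
      by_cases hs' : s ∈ Set.Icc (0 : ℝ) 1
      · refine Tendsto.const_smul (hl.comp (tendsto_nhdsWithin_iff.2 ⟨?_, ?_⟩)) _
        · have : Tendsto (fun ε : ℝ => ε * s + (x - ε)) (𝓝 0) (𝓝 (0 * s + (x - 0))) := by
            refine Continuous.tendsto (by fun_prop) 0
          simp only [zero_mul, zero_add, sub_zero] at this
          exact this.mono_left nhdsWithin_le_nhds
        · filter_upwards [self_mem_nhdsWithin] with ε hε
          have h1 : s < 1 := lt_of_le_of_ne hs'.2 hs
          have : 0 < ε * (1 - s) := mul_pos hε (sub_pos.2 h1)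
          change ε * s + (x - ε) < x
          nlinarith
      · simp [deriv_smoothTransition_eq_zero hs']
  rw [integral_smul_const, integral_deriv_smoothTransition, one_smul] at hfin
  refine hfin.congr' ?_
  filter_upwards [self_mem_nhdsWithin] with ε hε using (hsub ε hε).symm

/-- A smooth approximation of the indicator function of `[x, z)`. -/
noncomputable def cutoff (x z ε t : ℝ) : ℝ :=
  Real.smoothTransition ((t - x) / ε + 1) - Real.smoothTransition ((t - z) / ε + 1)

theorem contDiff_cutoff (x z ε : ℝ) : ContDiff ℝ ∞ (cutoff x z ε) := by
  unfold cutoff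
  refine (contDiff_smoothTransition.comp ?_).sub (contDiff_smoothTransition.comp ?_) <;> fun_prop

theorem hasDerivAt_cutoff (x z ε t : ℝ) : HasDerivAt (cutoff x z ε)
    (ε⁻¹ * deriv Real.smoothTransition ((t - x) / ε + 1) -
      ε⁻¹ * deriv Real.smoothTransition ((t - z) / ε + 1)) t := by
  have h : ∀ y, HasDerivAt (fun t => Real.smoothTransition ((t - y) / ε + 1))
      (ε⁻¹ * deriv Real.smoothTransition ((t - y) / ε + 1)) t := by
    intro y
    have h1 : HasDerivAt (fun t : ℝ => (t - y) / ε + 1) ε⁻¹ t := by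
      have := (((hasDerivAt_id t).sub_const y).div_const ε).add_const 1
      rwa [one_div] at this
    have h2 := ((contDiff_smoothTransition.differentiable (by simp))
      ((t - y) / ε + 1)).hasDerivAt.comp t h1
    rwa [mul_comm] at h2
  exact (h x).sub (h z)

theorem cutoff_eq_zero {x z ε t : ℝ} (hxz : x ≤ z) (hε : 0 < ε) (ht : t ∉ Set.Icc (x - ε) z) :
    cutoff x z ε t = 0 := by
  rw [Set.mem_Icc, not_and_or, not_le, not_le] at ht
  unfold cutoff
  rcases ht with ht | ht
  · rw [Real.smoothTransition.zero_of_nonpos, Real.smoothTransition.zero_of_nonpos, sub_zero]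
    · have : (t - z) / ε ≤ -1 := by rw [div_le_iff₀ hε]; linarith
      linarith
    · have : (t - x) / ε ≤ -1 := by rw [div_le_iff₀ hε]; linarith
      linarith
  · rw [Real.smoothTransition.one_of_one_le, Real.smoothTransition.one_of_one_le, sub_self]
    · have : 0 ≤ (t - z) / ε := div_nonneg (by linarith) hε.le
      linarith
    · have : 0 ≤ (t - x) / ε := div_nonneg (by linarith) hε.le
      linarith

theorem abs_cutoff_le (x z ε t : ℝ) : |cutoff x z ε t| ≤ 1 := by
  unfold cutoff
  rw [abs_le]
  constructor <;> linarith [Real.smoothTransition.nonneg ((t - x) / ε + 1),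
    Real.smoothTransition.nonneg ((t - z) / ε + 1), Real.smoothTransition.le_one ((t - x) / ε + 1),
    Real.smoothTransition.le_one ((t - z) / ε + 1)]

theorem tendsto_cutoff {x z : ℝ} (hxz : x ≤ z) (t : ℝ) :
    Tendsto (fun ε => cutoff x z ε t) (𝓝[>] 0) (𝓝 ((Set.Ico x z).indicator 1 t)) := by
  have key : ∀ y : ℝ, Tendsto (fun ε => Real.smoothTransition ((t - y) / ε + 1)) (𝓝[>] 0)
      (𝓝 ((Set.Ici y).indicator 1 t)) := by
    intro y
    refine tendsto_const_nhds.congr' ?_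
    rcases le_or_gt y t with h | h
    · filter_upwards [self_mem_nhdsWithin] with ε hε
      have : 0 ≤ (t - y) / ε := div_nonneg (by linarith) (le_of_lt hε)
      rw [Set.indicator_of_mem (Set.mem_Ici.2 h), Real.smoothTransition.one_of_one_le (by linarith)]
      rfl
    · filter_upwards [Ioo_mem_nhdsGT (sub_pos.2 h)] with ε hε
      have : (t - y) / ε ≤ -1 := by rw [div_le_iff₀ hε.1]; linarith [hε.2]
      rw [Set.indicator_of_notMem (by simpa using h),
        Real.smoothTransition.zero_of_nonpos (by linarith)]
  suffices e : (Set.Ico x z).indicator (1 : ℝ → ℝ) t =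
      (Set.Ici x).indicator 1 t - (Set.Ici z).indicator 1 t by
    rw [e]
    exact (key x).sub (key z)
  by_cases h1 : x ≤ t <;> by_cases h2 : t < z
  · simp [Set.indicator, h1, h2, h2.not_ge]
  · simp [Set.indicator, h1, h2, not_lt.1 h2]
  · simp [Set.indicator, h1, h2, h2.not_ge]
  · exact absurd (hxz.trans (not_lt.1 h2)) h1

end Mollifier

/-! ### Distributional derivatives and densities. -/

section Weak

variable {a b : EReal} {μ : Measure ℝ} {n : ℕ}

/-- Testing with smooth cutoffs of `[x, z)` whose slopes lie to the left of `x` and of `z` produces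
the difference of left limits on one side and the integral of `F` over `[x, z)` on the other. The
balanced value then follows from the jump. -/
theorem HasDensity.of_weak {u F : ℝ → Fin n → ℂ}
    (hF : ∀ x ∈ interval a b, ∀ z ∈ interval a b, IntegrableOn F (Set.Icc x z) μ)
    (hu : IsBalancedBV a b u)
    (hweak : ∀ φ : ℝ → ℂ, IsTestFunction a b φ → -(∫ x, deriv φ x • u x) = ∫ x, φ x • F x ∂μ) :
    HasDensity a b μ u F := by
  have hlim := fun x (hx : x ∈ interval a b) => exists_tendsto_of_locallyBoundedVariationOn hu.bv hx
  have hinc : ∀ x ∈ interval a b, ∀ z ∈ interval a b, x ≤ z →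
      Function.leftLim u z - Function.leftLim u x = ∫ t in Set.Ico x z, F t ∂μ := by
    intro x hx z hz hxz
    obtain ⟨c, hc, hcx⟩ := exists_lt_mem_interval hx
    -- Nothing is known of `u` outside the interval; truncation makes it measurable on the whole
    -- line.
    let u' : ℝ → Fin n → ℂ := (interval a b).indicator u
    have hu' : AEStronglyMeasurable u' volume :=
      (aestronglyMeasurable_indicator_iff measurableSet_interval).2
        (aestronglyMeasurable_of_locallyBoundedVariationOn hu.bv volume)
    have hl : ∀ y ∈ interval a b, Tendsto u' (𝓝[<] y) (𝓝 (Function.leftLim u y)) := fun y hy => by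
      refine (hlim y hy).1.congr' ?_
      filter_upwards [mem_nhdsWithin_of_mem_nhds (isOpen_interval.mem_nhds hy)] with t ht
      exact (Set.indicator_of_mem ht u).symm
    have h1 : Tendsto (fun ε => -((∫ t, (ε⁻¹ * deriv Real.smoothTransition ((t - x) / ε + 1)) • u' t) -
        ∫ t, (ε⁻¹ * deriv Real.smoothTransition ((t - z) / ε + 1)) • u' t)) (𝓝[>] 0)
        (𝓝 (-(Function.leftLim u x - Function.leftLim u z))) :=
      ((tendsto_mollifier_left hu' (hl x hx)).sub (tendsto_mollifier_left hu' (hl z hz))).neg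
    have h2 : Tendsto (fun ε => ∫ t, (cutoff x z ε t : ℂ) • F t ∂μ) (𝓝[>] 0)
        (𝓝 (∫ t in Set.Ico x z, F t ∂μ)) := by
      rw [← integral_indicator measurableSet_Ico]
      have hFi : IntegrableOn F (Set.Icc c z) μ := hF c hc z hz
      have hzero : ∀ ε ∈ Set.Ioo 0 (x - c), ∀ t, t ∉ Set.Icc c z → cutoff x z ε t = 0 :=
        fun ε hε t ht => cutoff_eq_zero hxz hε.1 fun h' =>
          ht ⟨by linarith [h'.1, hε.2], h'.2⟩
      refine tendsto_integral_filter_of_dominated_convergence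
        ((Set.Icc c z).indicator fun t => ‖F t‖) ?_ ?_ ?_ ?_
      · filter_upwards [Ioo_mem_nhdsGT (sub_pos.2 hcx)] with ε hε
        have h3 : (fun t => (cutoff x z ε t : ℂ) • F t) =
            (Set.Icc c z).indicator fun t => (cutoff x z ε t : ℂ) • F t := by
          funext t
          by_cases ht : t ∈ Set.Icc c z
          · rw [Set.indicator_of_mem ht]
          · rw [Set.indicator_of_notMem ht, hzero ε hε t ht]; simp
        rw [h3, aestronglyMeasurable_indicator_iff measurableSet_Icc]
        refine AEStronglyMeasurable.smul (f := fun t => (cutoff x z ε t : ℂ)) ?_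
          hFi.aestronglyMeasurable
        exact (Complex.continuous_ofReal.comp
          (contDiff_cutoff x z ε).continuous).aestronglyMeasurable
      · filter_upwards [Ioo_mem_nhdsGT (sub_pos.2 hcx)] with ε hε
        refine Eventually.of_forall fun t => ?_
        by_cases ht : t ∈ Set.Icc c z
        · rw [Set.indicator_of_mem ht, norm_smul, Complex.norm_real, Real.norm_eq_abs]
          exact mul_le_of_le_one_left (norm_nonneg _) (abs_cutoff_le _ _ _ _)
        · rw [Set.indicator_of_notMem ht, hzero ε hε t ht]; simp
      · exact IntegrableOn.integrable_indicator hFi.norm measurableSet_Icc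
      · refine Eventually.of_forall fun t => ?_
        have h4 := ((Complex.continuous_ofReal.tendsto _).comp (tendsto_cutoff hxz t)).smul_const
          (F t)
        have e : (Set.Ico x z).indicator F t =
            (((Set.Ico x z).indicator 1 t : ℝ) : ℂ) • F t := by
          by_cases ht : t ∈ Set.Ico x z
          · simp [Set.indicator_of_mem ht]
          · simp [Set.indicator_of_notMem ht]
        rw [e]
        exact h4
    have h3 : ∀ᶠ ε in 𝓝[>] (0 : ℝ), ∫ t, (cutoff x z ε t : ℂ) • F t ∂μ =
        -((∫ t, (ε⁻¹ * deriv Real.smoothTransition ((t - x) / ε + 1)) • u' t) -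
        ∫ t, (ε⁻¹ * deriv Real.smoothTransition ((t - z) / ε + 1)) • u' t) := by
      filter_upwards [Ioo_mem_nhdsGT (sub_pos.2 hcx)] with ε hε
      have hsub : Set.Icc (x - ε) z ⊆ interval a b := fun t ht =>
        Icc_subset_interval hc hz ⟨by linarith [ht.1, hε.2], ht.2⟩
      have hts : tsupport (fun t => (cutoff x z ε t : ℂ)) ⊆ Set.Icc (x - ε) z := by
        refine closure_minimal (fun t ht => ?_) isClosed_Icc
        by_contra h
        exact ht (by simp [cutoff_eq_zero hxz hε.1 h])
      have htest : IsTestFunction a b fun t => (cutoff x z ε t : ℂ) :=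
        ⟨Complex.ofRealCLM.contDiff.comp (contDiff_cutoff x z ε),
          isCompact_Icc.of_isClosed_subset (isClosed_tsupport _) hts, hts.trans hsub⟩
      rw [← hweak _ htest]
      congr 1
      have hint : ∀ y ∈ interval a b, ε < y - c → Integrable fun t =>
          (ε⁻¹ * deriv Real.smoothTransition ((t - y) / ε + 1)) • u' t := by
        intro y hy hyε
        obtain ⟨C, hC0, hC⟩ := exists_bound_of_locallyBoundedVariationOn hu.bv hc hy
        have hcont : Continuous fun t => ε⁻¹ * deriv Real.smoothTransition ((t - y) / ε + 1) :=
          continuous_const.mul (continuous_deriv_smoothTransition.comp (by fun_prop))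
        have hz' : ∀ t, t ∉ Set.Icc c y →
            ε⁻¹ * deriv Real.smoothTransition ((t - y) / ε + 1) = 0 := by
          intro t ht
          rw [deriv_smoothTransition_eq_zero, mul_zero]
          intro h
          refine ht ⟨?_, ?_⟩
          · have h5 : -1 ≤ (t - y) / ε := by linarith [h.1]
            rw [le_div_iff₀ hε.1] at h5
            linarith
          · have h5 : (t - y) / ε ≤ 0 := by linarith [h.2]
            rw [div_le_iff₀ hε.1] at h5
            linarith
        have hci := hcont.integrable_of_hasCompactSupport (μ := volume)
          (HasCompactSupport.intro isCompact_Icc hz')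
        refine (hci.norm.mul_const C).mono' (hcont.aestronglyMeasurable.smul hu')
          (Eventually.of_forall fun t => ?_)
        by_cases ht : t ∈ Set.Icc c y
        · rw [norm_smul]
          gcongr
          change ‖(interval a b).indicator u t‖ ≤ C
          rw [Set.indicator_of_mem (Icc_subset_interval hc hy ht)]
          exact hC t ht
        · rw [hz' t ht]; simp
      rw [← integral_sub (hint x hx hε.2) (hint z hz (by linarith [hε.2]))]
      refine integral_congr_ae (Eventually.of_forall fun t => ?_)
      have hd : deriv (fun t => (cutoff x z ε t : ℂ)) t =
          ((ε⁻¹ * deriv Real.smoothTransition ((t - x) / ε + 1) -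
            ε⁻¹ * deriv Real.smoothTransition ((t - z) / ε + 1) : ℝ) : ℂ) :=
        (hasDerivAt_cutoff x z ε t).ofReal_comp.deriv
      by_cases ht : t ∈ interval a b
      · change deriv (fun t => (cutoff x z ε t : ℂ)) t • u t =
          _ • (interval a b).indicator u t - _ • (interval a b).indicator u t
        rw [Set.indicator_of_mem ht, hd, ← sub_smul]
        exact Complex.coe_smul _ _
      · have h6 : deriv (fun t => (cutoff x z ε t : ℂ)) t = 0 := by
          have := support_deriv_subset (f := fun t => (cutoff x z ε t : ℂ))
          by_contra h7
          exact ht (hsub (hts (this h7)))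
        change deriv (fun t => (cutoff x z ε t : ℂ)) t • u t =
          _ • (interval a b).indicator u t - _ • (interval a b).indicator u t
        rw [h6, Set.indicator_of_notMem ht, zero_smul, smul_zero, smul_zero, sub_zero]
    have h4 := tendsto_nhds_unique (h2.congr' h3) h1
    rw [h4, neg_sub]
  refine ⟨hF, fun x hx => (hlim x hx).1, hinc, fun x hx => ?_⟩
  have hr : Function.rightLim u x = Function.leftLim u x + μ.real {x} • F x := by
    obtain ⟨d, hd, hxd⟩ := exists_gt_mem_interval hx
    -- The right limit of `u` is also the right limit of its left-limit function, which the
    -- increments determine.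
    rw [← rightLim_leftLim (hlim x hx).2]
    refine rightLim_eq_of_tendsto ?_
    have h1 := (tendsto_setIntegral_Ico_right hxd (hF x hx d hd)).const_add (Function.leftLim u x)
    rw [integral_singleton] at h1
    refine h1.congr' ?_
    filter_upwards [Ioo_mem_nhdsGT hxd] with t ht
    rw [← hinc x hx t (Icc_subset_interval hx hd ⟨ht.1.le, ht.2.le⟩) ht.1.le, add_sub_cancel]
  rw [hu.balanced x hx, hr]
  have : ∀ y : Fin n → ℂ, (1 / 2 : ℝ) • y = (1 / 2 : ℂ) • y := fun y => by
    rw [← Complex.coe_smul]; norm_num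
  rw [this]
  module

theorem HasDensity.isBalancedBV {u F : ℝ → Fin n → ℂ} (h : HasDensity a b μ u F) :
    IsBalancedBV a b u := by
  refine ⟨h.locallyBoundedVariationOn, fun x hx => ?_⟩
  have : ∀ y : Fin n → ℂ, (1 / 2 : ℝ) • y = (1 / 2 : ℂ) • y := fun y => by
    rw [← Complex.coe_smul]; norm_num
  rw [h.rightLim_eq hx, h.balanced x hx, this]
  module

theorem integrable_smul_of_tsupport_subset {E : Type*} [NormedAddCommGroup E] [NormedSpace ℂ E]
    {ψ : ℝ → ℂ} (hψ : Continuous ψ) {c d : ℝ} (hs : tsupport ψ ⊆ Set.Icc c d) {F : ℝ → E}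
    (hF : IntegrableOn F (Set.Icc c d) μ) : Integrable (fun x => ψ x • F x) μ := by
  refine (integrableOn_iff_integrable_of_support_subset ?_).1
    (hF.continuousOn_smul hψ.continuousOn isCompact_Icc)
  intro x hx
  refine hs (subset_tsupport ψ fun h => hx ?_)
  simp [h]

/-- This is the product rule for `φ` and the components of `u` on an interval whose endpoints lie
outside the support of `φ`. Lebesgue measure must have a density with respect to `μ`, so that `φ`
too is a primitive with respect to `μ`. -/
theorem HasDensity.weak [SigmaFinite μ] (hμ : volume.restrict (interval a b) ≪ μ)
    {u F : ℝ → Fin n → ℂ} (h : HasDensity a b μ u F) {φ : ℝ → ℂ} (hφ : IsTestFunction a b φ) :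
    -(∫ x, deriv φ x • u x) = ∫ x, φ x • F x ∂μ := by
  by_cases hne : (interval a b).Nonempty
  swap
  · have h0 : ∀ x, φ x = 0 := fun x => by
      by_contra h'
      exact hne ⟨x, hφ.subset (subset_tsupport _ h')⟩
    have h0' : φ = fun _ => 0 := funext h0
    simp [h0']
  obtain ⟨c, hc, d, hd, hcd, hK⟩ := exists_Icc_superset hφ.compact hφ.subset hne
  let ν := volume.restrict (interval a b)
  let r : ℝ → ℝ := fun t => (ν.rnDeriv μ t).toReal
  have hφ' : Continuous (deriv φ) := hφ.smooth.continuous_deriv (by simp)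
  have hr : ∀ s ⊆ interval a b, MeasurableSet s → ∫ t in s, r t • deriv φ t ∂μ =
      ∫ t in s, deriv φ t := by
    intro s hs hsm
    rw [setIntegral_rnDeriv_smul hμ hsm, Measure.restrict_restrict hsm, Set.inter_eq_left.2 hs]
  have hri : Integrable (fun t => r t • deriv φ t) μ := by
    rw [integrable_rnDeriv_smul_iff hμ]
    exact (hφ'.integrable_of_hasCompactSupport hφ.compact.deriv).mono_measure Measure.restrict_le_self
  have hφd : HasDensity a b μ φ (fun t => r t • deriv φ t) ∧
      ∀ x ∈ interval a b, Function.leftLim φ x = φ x := by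
    refine HasDensity.of_primitive (Y := φ) (fun x _ z _ => hri.integrableOn) ?_ ?_
    · intro x hx z hz hxz
      rw [hr _ (Set.Ico_subset_Icc_self.trans (Icc_subset_interval hx hz)) measurableSet_Ico,
        integral_Ico_eq_integral_Ioc, ← intervalIntegral.integral_of_le hxz,
        intervalIntegral.integral_deriv_eq_sub
          (fun x _ => (hφ.smooth.differentiable (by simp)) x) (hφ'.intervalIntegrable _ _)]
    · intro x hx
      rw [← integral_singleton (μ := μ) (f := fun t => r t • deriv φ t),
        hr _ (Set.singleton_subset_iff.2 hx) (measurableSet_singleton x)]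
      simp
  have hφc : φ c = 0 := by
    by_contra h'
    exact (hK (subset_tsupport _ h')).1.false
  have hφdd : φ d = 0 := by
    by_contra h'
    exact (hK (subset_tsupport _ h')).2.false
  have hsI : tsupport φ ⊆ Set.Icc c d := hK.trans Set.Ioo_subset_Icc_self
  have i2 : Integrable (fun x => φ x • F x) μ :=
    integrable_smul_of_tsupport_subset hφ.smooth.continuous hsI (h.integrableOn c hc d hd)
  obtain ⟨C, hC0, hC⟩ :=
    exists_bound_of_locallyBoundedVariationOn h.locallyBoundedVariationOn hc hd
  have hui : IntegrableOn u (Set.Icc c d) := by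
    refine Integrable.of_bound ((aestronglyMeasurable_of_locallyBoundedVariationOn
      h.locallyBoundedVariationOn volume).mono_measure
        (Measure.restrict_mono_set _ (Icc_subset_interval hc hd))) C ?_
    rw [ae_restrict_iff' measurableSet_Icc]
    exact Eventually.of_forall hC
  have hds : tsupport (deriv φ) ⊆ Set.Icc c d := (tsupport_deriv_subset).trans hsI
  have i1 : Integrable (fun x => deriv φ x • u x) :=
    integrable_smul_of_tsupport_subset hφ' hds hui
  funext i
  have hi := (h.comp_clm (ContinuousLinearMap.proj (R := ℝ) (φ := fun _ : Fin n => ℂ) i)).1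
  obtain ⟨m1, m2⟩ := hφd.1.mul hi hc hd hcd.le
  rw [hφd.2 c hc, hφd.2 d hd, hφc, hφdd, zero_mul, zero_mul, sub_zero] at m2
  have e1 : (∫ x, deriv φ x • u x) i = ∫ x, deriv φ x * u x i :=
    (ContinuousLinearMap.integral_comp_comm
      (ContinuousLinearMap.proj (R := ℝ) (φ := fun _ : Fin n => ℂ) i) i1).symm
  have e2 : (∫ x, φ x • F x ∂μ) i = ∫ x, φ x * F x i ∂μ :=
    (ContinuousLinearMap.integral_comp_comm
      (ContinuousLinearMap.proj (R := ℝ) (φ := fun _ : Fin n => ℂ) i) i2).symm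
  have i1i : Integrable (fun x => deriv φ x * u x i) ν :=
    ((ContinuousLinearMap.proj (R := ℝ) (φ := fun _ : Fin n => ℂ) i).integrable_comp
      i1).mono_measure Measure.restrict_le_self
  have i2i : Integrable (fun x => φ x * F x i) μ :=
    (ContinuousLinearMap.proj (R := ℝ) (φ := fun _ : Fin n => ℂ) i).integrable_comp i2
  have i3 : Integrable (fun x => r x • (deriv φ x * u x i)) μ :=
    (integrable_rnDeriv_smul_iff hμ).2 i1i
  rw [Pi.neg_apply, e1, e2]
  have e3 : ∫ x, deriv φ x * u x i = ∫ x, r x • (deriv φ x * u x i) ∂μ := by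
    rw [integral_rnDeriv_smul hμ]
    refine (setIntegral_eq_integral_of_forall_compl_eq_zero fun x hx => ?_).symm
    have : deriv φ x = 0 := by
      by_contra h'
      exact hx (Icc_subset_interval hc hd (hds (subset_tsupport _ h')))
    rw [this, zero_mul]
  rw [e3, neg_eq_iff_add_eq_zero, ← integral_add i3 i2i, m2]
  refine (setIntegral_eq_integral_of_forall_compl_eq_zero (s := Set.Ico c d)
    fun x hx => ?_).symm.trans ?_
  · have h1 : φ x = 0 := by
      by_contra h'
      have := hK (subset_tsupport _ h')
      exact hx ⟨this.1.le, this.2⟩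
    have h2 : deriv φ x = 0 := by
      by_contra h'
      have := hK (tsupport_deriv_subset (subset_tsupport _ h'))
      exact hx ⟨this.1.le, this.2⟩
    rw [h1, h2]; simp
  · refine integral_congr_ae (Eventually.of_forall fun x => ?_)
    change r x • (deriv φ x * u x i) + φ x * F x i = φ x * F x i + r x • deriv φ x * u x i
    rw [smul_mul_assoc, add_comm]

end Weak

/-! ### A submultiplicative norm on matrices. -/

section EntrySum

variable {n : ℕ}

/-- The sum of the absolute values of the entries of a matrix. -/
noncomputable def entrySum (A : Matrix (Fin n) (Fin n) ℂ) : ℝ := ∑ i, ∑ j, ‖A i j‖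

theorem entrySum_nonneg (A : Matrix (Fin n) (Fin n) ℂ) : 0 ≤ entrySum A :=
  Finset.sum_nonneg fun _ _ => Finset.sum_nonneg fun _ _ => norm_nonneg _

theorem norm_mulVec_le (A : Matrix (Fin n) (Fin n) ℂ) (v : Fin n → ℂ) :
    ‖A *ᵥ v‖ ≤ entrySum A * ‖v‖ := by
  refine (pi_norm_le_iff_of_nonneg (mul_nonneg (entrySum_nonneg A) (norm_nonneg v))).2 fun i => ?_
  calc ‖∑ j, A i j * v j‖ ≤ ∑ j, ‖A i j * v j‖ := norm_sum_le _ _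
    _ ≤ ∑ j, ‖A i j‖ * ‖v‖ := Finset.sum_le_sum fun j _ => by
        rw [norm_mul]
        exact mul_le_mul_of_nonneg_left (norm_le_pi_norm v j) (norm_nonneg _)
    _ = (∑ j, ‖A i j‖) * ‖v‖ := (Finset.sum_mul _ _ _).symm
    _ ≤ entrySum A * ‖v‖ := by
        refine mul_le_mul_of_nonneg_right ?_ (norm_nonneg v)
        exact Finset.single_le_sum (f := fun i => ∑ j, ‖A i j‖)
          (fun i _ => Finset.sum_nonneg fun j _ => norm_nonneg (A i j)) (Finset.mem_univ i)

theorem entrySum_add_le (A B : Matrix (Fin n) (Fin n) ℂ) :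
    entrySum (A + B) ≤ entrySum A + entrySum B := by
  unfold entrySum
  rw [← Finset.sum_add_distrib]
  refine Finset.sum_le_sum fun i _ => ?_
  rw [← Finset.sum_add_distrib]
  exact Finset.sum_le_sum fun j _ => norm_add_le _ _

theorem entrySum_neg (A : Matrix (Fin n) (Fin n) ℂ) : entrySum (-A) = entrySum A := by
  simp [entrySum]

theorem entrySum_smul (c : ℂ) (A : Matrix (Fin n) (Fin n) ℂ) :
    entrySum (c • A) = ‖c‖ * entrySum A := by
  simp [entrySum, Finset.mul_sum]

theorem entrySum_mul_le (A B : Matrix (Fin n) (Fin n) ℂ) :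
    entrySum (A * B) ≤ entrySum A * entrySum B := by
  calc entrySum (A * B) ≤ ∑ i, ∑ j, ∑ k, ‖A i k‖ * ‖B k j‖ := by
        refine Finset.sum_le_sum fun i _ => Finset.sum_le_sum fun j _ => ?_
        rw [Matrix.mul_apply]
        exact (norm_sum_le _ _).trans_eq (Finset.sum_congr rfl fun k _ => norm_mul _ _)
    _ = ∑ i, ∑ k, ‖A i k‖ * ∑ j, ‖B k j‖ := by
        refine Finset.sum_congr rfl fun i _ => ?_
        rw [Finset.sum_comm]
        exact Finset.sum_congr rfl fun k _ => (Finset.mul_sum _ _ _).symm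
    _ ≤ ∑ i, ∑ k, ‖A i k‖ * entrySum B := by
        refine Finset.sum_le_sum fun i _ => Finset.sum_le_sum fun k _ => ?_
        refine mul_le_mul_of_nonneg_left ?_ (norm_nonneg _)
        exact Finset.single_le_sum (f := fun k => ∑ j, ‖B k j‖)
          (fun i _ => Finset.sum_nonneg fun j _ => norm_nonneg (B i j)) (Finset.mem_univ k)
    _ = entrySum A * entrySum B := by
        unfold entrySum
        simp only [Finset.sum_mul]

theorem continuous_entrySum : Continuous (entrySum (n := n)) :=
  continuous_finsetSum _ fun i _ => continuous_finsetSum _ fun j _ =>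
    (continuous_id.matrix_elem i j).norm

/-- In $(J+D)^{-1}=J^{-1}-J^{-1}D(J+D)^{-1}$ the last term has at most half the norm of the left
side and is absorbed there. -/
theorem entrySum_inv_le {J D : Matrix (Fin n) (Fin n) ℂ} (hJ : IsUnit J) (hJD : IsUnit (J + D))
    (hD : entrySum J⁻¹ * entrySum D ≤ 1 / 2) : entrySum (J + D)⁻¹ ≤ 2 * entrySum J⁻¹ := by
  have h : (J + D)⁻¹ = J⁻¹ + -(J⁻¹ * D * (J + D)⁻¹) := by
    have h1 : J⁻¹ * (J + D) * (J + D)⁻¹ = J⁻¹ := by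
      rw [mul_assoc, Matrix.mul_nonsing_inv _ ((Matrix.isUnit_iff_isUnit_det _).1 hJD), mul_one]
    rw [mul_add, Matrix.nonsing_inv_mul _ ((Matrix.isUnit_iff_isUnit_det _).1 hJ), add_mul,
      one_mul] at h1
    rw [← sub_eq_add_neg, eq_sub_iff_add_eq]
    exact h1
  have h2 : entrySum (J + D)⁻¹ ≤ entrySum J⁻¹ + 1 / 2 * entrySum (J + D)⁻¹ := by
    nth_rewrite 1 [h]
    refine (entrySum_add_le _ _).trans (add_le_add le_rfl ?_)
    rw [entrySum_neg]
    refine (entrySum_mul_le _ _).trans (mul_le_mul_of_nonneg_right ?_ (entrySum_nonneg _))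
    exact (entrySum_mul_le _ _).trans hD
  linarith

end EntrySum

/-! ### Finiteness of the large atoms. -/

section Atoms

variable {μ : Measure ℝ} {n : ℕ}

theorem measurable_measureReal_singleton [SFinite μ] : Measurable fun x => μ.real {x} := by
  have h : MeasurableSet {p : ℝ × ℝ | p.2 = p.1} := measurableSet_eq_fun measurable_snd measurable_fst
  exact (measurable_measure_prodMk_left (ν := μ) h).ennreal_toReal

theorem finite_large_atoms {f : ℝ → ℝ} {K : Set ℝ}
    (hf : IntegrableOn f K μ) {δ : ℝ} (hδ : 0 < δ) : {x ∈ K | δ ≤ ‖μ.real {x} • f x‖}.Finite := by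
  by_contra hinf
  set s := {x ∈ K | δ ≤ ‖μ.real {x} • f x‖}
  have h1 : ∀ t : Finset ℝ, (t : Set ℝ) ⊆ s → t.card * δ ≤ ∫ x in K, ‖f x‖ ∂μ := by
    intro t ht
    calc (t.card : ℝ) * δ = ∑ _x ∈ t, δ := by simp
      _ ≤ ∑ x ∈ t, ∫ y in {x}, ‖f y‖ ∂μ := by
        refine Finset.sum_le_sum fun x hx => ?_
        rw [integral_singleton]
        have := (ht hx).2
        rwa [norm_smul, Real.norm_of_nonneg measureReal_nonneg] at this
      _ = ∫ y in ⋃ x ∈ t, {x}, ‖f y‖ ∂μ := by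
        refine (integral_biUnion_finset t (fun x _ => measurableSet_singleton x) ?_ fun x hx => ?_).symm
        · intro x _ y _ hxy
          simpa using hxy
        · exact IntegrableOn.mono_set hf.norm (Set.singleton_subset_iff.2 (ht hx).1)
      _ ≤ _ := by
        refine setIntegral_mono_set hf.norm (Eventually.of_forall fun _ => norm_nonneg _)
          (LE.le.eventuallyLE ?_)
        exact Set.iUnion₂_subset fun x hx => Set.singleton_subset_iff.2 (ht hx).1
  obtain ⟨m, hm⟩ := exists_nat_gt ((∫ x in K, ‖f x‖ ∂μ) / δ)
  obtain ⟨t, ht, htm⟩ := (Set.not_finite.1 hinf).exists_subset_card_eq m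
  have := h1 t ht
  rw [htm] at this
  rw [div_lt_iff₀ hδ] at hm
  linarith

end Atoms

/-! ### One-sided initial value problems. -/

section Existence

variable {a b : EReal} {n : ℕ} {μ : Measure ℝ} {J : Matrix (Fin n) (Fin n) ℂ}
  {Q : ℝ → Matrix (Fin n) (Fin n) ℂ}

/-- `(J ± Δ(x)/2)⁻¹`, where `Δ` is the jump and `σ = ±1` is the sign. -/
noncomputable def transfer (μ : Measure ℝ) (J : Matrix (Fin n) (Fin n) ℂ)
    (Q : ℝ → Matrix (Fin n) (Fin n) ℂ) (σ x : ℝ) : Matrix (Fin n) (Fin n) ℂ :=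
  (J + ((σ / 2 * μ.real {x} : ℝ) : ℂ) • Q x)⁻¹

theorem stronglyMeasurable_transfer [SFinite μ] (hQ : StronglyMeasurable Q) (σ : ℝ) :
    StronglyMeasurable (transfer μ J Q σ) := by
  have hcm : StronglyMeasurable fun t => ((σ / 2 * μ.real {t} : ℝ) : ℂ) :=
    (Complex.measurable_ofReal.comp
      (measurable_measureReal_singleton.const_mul _)).stronglyMeasurable
  exact stronglyMeasurable_matrix_inv (stronglyMeasurable_const.add (hcm.smul hQ))

/-- At points of small mass the matrix is a small perturbation of `J`. Only finitely many points of
`K` remain, and there invertibility alone suffices: their norms are simply added. -/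
theorem exists_bound_transfer {K : Set ℝ} (hJ : IsUnit J)
    (hQi : IntegrableOn (fun x => entrySum (Q x)) K μ) {σ : ℝ}
    (hu : ∀ x ∈ K, IsUnit (J + ((σ / 2 * μ.real {x} : ℝ) : ℂ) • Q x)) :
    ∃ C, 0 ≤ C ∧ ∀ x ∈ K, entrySum (transfer μ J Q σ x) ≤ C := by
  -- Small enough that the perturbation hypothesis of `entrySum_inv_le` holds below it; the summands
  -- `1` keep it positive and finite.
  set δ : ℝ := 1 / ((|σ| + 1) * (entrySum J⁻¹ + 1)) with hδdef
  have hJ0 := entrySum_nonneg J⁻¹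
  have hδ : 0 < δ := by positivity
  have hfin := finite_large_atoms hQi hδ
  refine ⟨2 * entrySum J⁻¹ + ∑ x ∈ hfin.toFinset, entrySum (transfer μ J Q σ x),
    add_nonneg (by positivity) (Finset.sum_nonneg fun _ _ => entrySum_nonneg _), fun x hx => ?_⟩
  by_cases hxs : δ ≤ ‖μ.real {x} • entrySum (Q x)‖
  · have : entrySum (transfer μ J Q σ x) ≤
        ∑ x ∈ hfin.toFinset, entrySum (transfer μ J Q σ x) :=
      Finset.single_le_sum (f := fun x => entrySum (transfer μ J Q σ x))
        (fun _ _ => entrySum_nonneg _) (hfin.mem_toFinset.2 ⟨hx, hxs⟩)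
    linarith
  · have h1 : entrySum (transfer μ J Q σ x) ≤ 2 * entrySum J⁻¹ := by
      refine entrySum_inv_le hJ (hu x hx) ?_
      rw [entrySum_smul, Complex.norm_real, norm_mul, norm_div, Real.norm_eq_abs σ]
      rw [norm_smul, Real.norm_of_nonneg (entrySum_nonneg _), not_le] at hxs
      have h2 : entrySum J⁻¹ * (|σ| / ‖(2 : ℝ)‖ * ‖μ.real {x}‖ * entrySum (Q x)) =
          1 / 2 * (entrySum J⁻¹ * |σ| * (‖μ.real {x}‖ * entrySum (Q x))) := by
        rw [Real.norm_of_nonneg (zero_le_two : (0 : ℝ) ≤ 2)]; ring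
      rw [h2]
      have h3 : entrySum J⁻¹ * |σ| * (‖μ.real {x}‖ * entrySum (Q x)) ≤
          (entrySum J⁻¹ * |σ|) * δ := by gcongr
      have h4 : (entrySum J⁻¹ * |σ|) * δ ≤ 1 := by
        rw [hδdef, mul_one_div, div_le_one (by positivity)]
        nlinarith [abs_nonneg σ]
      linarith
    have : 0 ≤ ∑ x ∈ hfin.toFinset, entrySum (transfer μ J Q σ x) :=
      Finset.sum_nonneg fun _ _ => entrySum_nonneg _
    linarith

/-- The balanced value of a solution in terms of the one-sided limit `p`. -/
noncomputable def balancedValue (μ : Measure ℝ) (J : Matrix (Fin n) (Fin n) ℂ)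
    (Q : ℝ → Matrix (Fin n) (Fin n) ℂ) (G p : ℝ → Fin n → ℂ) (σ x : ℝ) : Fin n → ℂ :=
  transfer μ J Q σ x *ᵥ (J *ᵥ p x + ((σ / 2 * μ.real {x} : ℝ) : ℂ) • G x)

/-- At an atom the balanced value occurs on both sides of the equation, as the jump depends on it.
Solving this linear system is what requires $J\pm\frac12\Delta$ to be invertible: `p` is the left
limit when `σ = 1` and the right limit when `σ = -1`. -/
theorem balancedValue_eq (hJ : IsUnit J) {G p : ℝ → Fin n → ℂ} {σ x : ℝ}
    (hu : IsUnit (J + ((σ / 2 * μ.real {x} : ℝ) : ℂ) • Q x)) :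
    balancedValue μ J Q G p σ x = p x + ((σ / 2 * μ.real {x} : ℝ) : ℂ) •
      (J⁻¹ *ᵥ (G x - Q x *ᵥ balancedValue μ J Q G p σ x)) := by
  set c : ℂ := ((σ / 2 * μ.real {x} : ℝ) : ℂ) with hc
  set v := balancedValue μ J Q G p σ x with hv
  have h1 : (J + c • Q x) *ᵥ v = J *ᵥ p x + c • G x := by
    rw [hv, balancedValue, transfer, mulVec_mulVec,
      Matrix.mul_nonsing_inv _ ((Matrix.isUnit_iff_isUnit_det _).1 hu), one_mulVec]
  rw [add_mulVec, smul_mulVec] at h1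
  have h2 : J *ᵥ v = J *ᵥ p x + c • (G x - Q x *ᵥ v) := by
    rw [smul_sub, ← add_sub_assoc, ← h1, add_sub_cancel_right]
  have h3 := congrArg (J⁻¹ *ᵥ ·) h2
  simp only [mulVec_add, mulVec_mulVec, mulVec_smul,
    Matrix.nonsing_inv_mul _ ((Matrix.isUnit_iff_isUnit_det _).1 hJ), one_mulVec] at h3
  exact h3

/-- Eliminating the balanced value in favour of the one-sided limit `p` turns the system into a
Volterra equation for `p` over segments that exclude the current point. Its coefficient is
integrable since the transfer matrices are bounded on each segment. -/
theorem exists_one_sided [SFinite μ] (hJ : IsUnit J) (hQ : StronglyMeasurable Q)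
    {G : ℝ → Fin n → ℂ} (hG : StronglyMeasurable G) (u₀ : Fin n → ℂ) {σ : ℝ}
    {S : ℝ → Set ℝ} (hS : MeasurableSet {p : ℝ × ℝ | p.2 ∈ S p.1})
    (htrans : ∀ ⦃x t⦄, t ∈ S x → S t ⊆ S x) (hasymm : ∀ ⦃s t⦄, s ∈ S t → t ∉ S s)
    (hQi : ∀ x, IntegrableOn (fun t => entrySum (Q t)) (S x) μ)
    (hGi : ∀ x, IntegrableOn G (S x) μ)
    (hu : ∀ x, ∀ t ∈ S x, IsUnit (J + ((σ / 2 * μ.real {t} : ℝ) : ℂ) • Q t)) :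
    ∃ p : ℝ → Fin n → ℂ, StronglyMeasurable p ∧ ∀ x,
      IntegrableOn (fun t => J⁻¹ *ᵥ (G t - Q t *ᵥ balancedValue μ J Q G p σ t)) (S x) μ ∧
      p x = u₀ + σ • ∫ t in S x, J⁻¹ *ᵥ (G t - Q t *ᵥ balancedValue μ J Q G p σ t) ∂μ := by
  have hmS := measurableSet_segment hS
  set B := transfer μ J Q σ with hB
  have hBm : StronglyMeasurable B := stronglyMeasurable_transfer hQ σ
  have hcm : StronglyMeasurable fun t => ((σ / 2 * μ.real {t} : ℝ) : ℂ) :=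
    (Complex.measurable_ofReal.comp
      (measurable_measureReal_singleton.const_mul _)).stronglyMeasurable
  let A : ℝ → Matrix (Fin n) (Fin n) ℂ := fun t => -(J⁻¹ * Q t * B t * J)
  let ψ : ℝ → Fin n → ℂ := fun t =>
    J⁻¹ *ᵥ (G t - Q t *ᵥ (B t *ᵥ (((σ / 2 * μ.real {t} : ℝ) : ℂ) • G t)))
  have hmul : ∀ {A B : ℝ → Matrix (Fin n) (Fin n) ℂ}, StronglyMeasurable A →
      StronglyMeasurable B → StronglyMeasurable fun t => A t * B t := fun hA hB =>
    (continuous_fst.matrix_mul continuous_snd).comp_stronglyMeasurable (hA.prodMk hB)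
  have hAm : StronglyMeasurable A :=
    (hmul (hmul (hmul stronglyMeasurable_const hQ) hBm) stronglyMeasurable_const).neg
  have hψm : StronglyMeasurable ψ := stronglyMeasurable_mulVec stronglyMeasurable_const
    (hG.sub (stronglyMeasurable_mulVec hQ (stronglyMeasurable_mulVec hBm (hcm.smul hG))))
  have hsplit : ∀ (p : ℝ → Fin n → ℂ) t,
      J⁻¹ *ᵥ (G t - Q t *ᵥ balancedValue μ J Q G p σ t) = ψ t + A t *ᵥ p t := by
    intro p t
    simp only [ψ, A, balancedValue, ← hB, mulVec_sub, mulVec_add, neg_mulVec, ← mulVec_mulVec]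
    abel
  have hbound : ∀ x, ∃ C, 0 ≤ C ∧ ∀ t ∈ S x, entrySum (B t) ≤ C := fun x =>
    exists_bound_transfer hJ (hQi x) (hu x)
  have hAi : ∀ x, IntegrableOn (fun t => entrySum (A t)) (S x) μ := by
    intro x
    obtain ⟨C, hC0, hC⟩ := hbound x
    refine Integrable.mono' ((hQi x).const_mul (entrySum J⁻¹ * C * entrySum J))
      (continuous_entrySum.comp_stronglyMeasurable hAm).aestronglyMeasurable ?_
    rw [ae_restrict_iff' (hmS x)]
    refine Eventually.of_forall fun t ht => ?_
    rw [Real.norm_of_nonneg (entrySum_nonneg _), entrySum_neg]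
    have h1 := entrySum_nonneg J⁻¹
    have h2 := entrySum_nonneg J
    have h3 := entrySum_nonneg (Q t)
    have h4 := entrySum_nonneg (B t)
    calc entrySum (J⁻¹ * Q t * B t * J)
        ≤ entrySum (J⁻¹ * Q t * B t) * entrySum J := entrySum_mul_le _ _
      _ ≤ entrySum (J⁻¹ * Q t) * entrySum (B t) * entrySum J := by
          gcongr; exact entrySum_mul_le _ _
      _ ≤ entrySum J⁻¹ * entrySum (Q t) * C * entrySum J := by
          gcongr
          · exact entrySum_mul_le _ _
          · exact hC t ht
      _ = entrySum J⁻¹ * C * entrySum J * entrySum (Q t) := by ring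
  have hψi : ∀ x, IntegrableOn ψ (S x) μ := by
    intro x
    obtain ⟨C, hC0, hC⟩ := hbound x
    -- The mass of `G` at any single atom is at most this integral, so the term of `ψ` quadratic in
    -- the data is a bounded multiple of `entrySum (Q t)`.
    set g := ∫ r in S x, ‖G r‖ ∂μ
    refine Integrable.mono' (((hGi x).norm.const_mul (entrySum J⁻¹)).add
      ((hQi x).const_mul (entrySum J⁻¹ * C * (|σ / 2| * g)))) hψm.aestronglyMeasurable ?_
    rw [ae_restrict_iff' (hmS x)]
    refine Eventually.of_forall fun t ht => ?_
    have h1 := entrySum_nonneg J⁻¹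
    have h3 := entrySum_nonneg (Q t)
    have h4 := entrySum_nonneg (B t)
    have h5 : ‖((σ / 2 * μ.real {t} : ℝ) : ℂ) • G t‖ ≤ |σ / 2| * g := by
      rw [norm_smul, Complex.norm_real, norm_mul, mul_assoc, Real.norm_eq_abs (σ / 2)]
      have := norm_measureReal_smul_le ht (hGi x)
      rw [norm_smul] at this
      gcongr
    calc ‖ψ t‖ ≤ entrySum J⁻¹ * ‖G t - Q t *ᵥ (B t *ᵥ (((σ / 2 * μ.real {t} : ℝ) : ℂ) • G t))‖ :=
          norm_mulVec_le _ _
      _ ≤ entrySum J⁻¹ * (‖G t‖ + entrySum (Q t) * (C * (|σ / 2| * g))) := by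
          gcongr
          refine (norm_sub_le _ _).trans (add_le_add le_rfl ((norm_mulVec_le _ _).trans ?_))
          gcongr
          refine (norm_mulVec_le _ _).trans ?_
          gcongr
          exact hC t ht
      _ = _ := by
          simp only [Pi.add_apply]
          ring
  have hk : ∀ x, ∫⁻ t in S x, ‖entrySum (σ • A t)‖ₑ ∂μ ≠ ⊤ := by
    intro x
    have h1 : ∀ t, entrySum (σ • A t) = |σ| * entrySum (A t) := fun t => by
      have : σ • A t = (σ : ℂ) • A t := (Complex.coe_smul σ (A t)).symm
      rw [this, entrySum_smul, Complex.norm_real, Real.norm_eq_abs]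
    simp_rw [h1]
    exact ((hAi x).const_mul |σ|).2.ne
  have hint0 : StronglyMeasurable fun x => ∫ t in S x, ψ t ∂μ := by
    have h : ∀ x, ∫ t in S x, ψ t ∂μ =
        ∫ t, {p : ℝ × ℝ | p.2 ∈ S p.1}.indicator (fun p => ψ p.2) (x, t) ∂μ := by
      intro x
      rw [← integral_indicator (hmS x)]
      rfl
    rw [funext h]
    refine StronglyMeasurable.integral_prod_right
      (f := fun x t => {p : ℝ × ℝ | p.2 ∈ S p.1}.indicator (fun p => ψ p.2) (x, t)) ?_
    exact (hψm.comp_measurable measurable_snd).indicator hS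
  have hσA : StronglyMeasurable fun t => σ • A t := hAm.const_smul σ
  obtain ⟨p, hpm, hpb, hp⟩ := exists_volterra hS htrans hasymm (μ := μ) hσA
    (k := fun t => ‖entrySum (σ • A t)‖ₑ)
    (continuous_entrySum.comp_stronglyMeasurable hσA).measurable.enorm
    (fun t v => by
      rw [← enorm_norm v, ← enorm_mul, ← enorm_norm (_ *ᵥ _)]
      refine enorm_le_iff_norm_le.2 ?_
      rw [norm_norm, Real.norm_of_nonneg (mul_nonneg (entrySum_nonneg _) (norm_nonneg _))]
      exact norm_mulVec_le _ _) hk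
    (φ := fun x => u₀ + σ • ∫ t in S x, ψ t ∂μ)
    (stronglyMeasurable_const.add (hint0.const_smul σ))
    (fun x => ⟨‖u₀‖ₑ + ‖σ‖ₑ * ∫⁻ t in S x, ‖ψ t‖ₑ ∂μ,
      ENNReal.add_ne_top.2 ⟨enorm_ne_top, ENNReal.mul_ne_top enorm_ne_top (hψi x).2.ne⟩,
      fun t ht => by
        refine (enorm_add_le _ _).trans (add_le_add le_rfl ?_)
        rw [enorm_smul]
        gcongr
        exact (enorm_integral_le_lintegral_enorm _).trans (lintegral_mono_set (htrans ht))⟩)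
  have hApi : ∀ x, IntegrableOn (fun t => A t *ᵥ p t) (S x) μ := by
    intro x
    obtain ⟨C, hC, hCb⟩ := hpb x
    refine Integrable.mono' ((hAi x).mul_const C.toReal)
      (stronglyMeasurable_mulVec hAm hpm).aestronglyMeasurable ?_
    rw [ae_restrict_iff' (hmS x)]
    refine Eventually.of_forall fun t ht => (norm_mulVec_le _ _).trans ?_
    refine mul_le_mul_of_nonneg_left ?_ (entrySum_nonneg _)
    rw [← toReal_enorm]
    exact ENNReal.toReal_mono hC (hCb t ht)
  refine ⟨p, hpm, fun x => ?_⟩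
  simp only [hsplit]
  refine ⟨(hψi x).add (hApi x), ?_⟩
  have h1 : ∫ t in S x, (ψ t + A t *ᵥ p t) ∂μ =
      ∫ t in S x, ψ t ∂μ + ∫ t in S x, A t *ᵥ p t ∂μ := integral_add (hψi x) (hApi x)
  have h2 : ∫ t in S x, (σ • A t) *ᵥ p t ∂μ = σ • ∫ t in S x, A t *ᵥ p t ∂μ := by
    simp only [smul_mulVec]
    exact integral_smul σ _
  rw [h1, hp x, h2, smul_add, add_assoc]

end Existence

/-! ### Two-sided initial value problems. -/

section Existence

variable {a b : EReal} {n : ℕ} {μ : Measure ℝ} {J : Matrix (Fin n) (Fin n) ℂ}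
  {Q : ℝ → Matrix (Fin n) (Fin n) ℂ}

theorem isUnit_half {J D : Matrix (Fin n) (Fin n) ℂ} (h : IsUnit ((2 : ℂ) • J + D)) :
    IsUnit (J + (1 / 2 : ℂ) • D) := by
  have h1 : J + (1 / 2 : ℂ) • D = (1 / 2 : ℂ) • ((2 : ℂ) • J + D) := by
    rw [smul_add, smul_smul]; norm_num
  rw [h1, Matrix.isUnit_iff_isUnit_det, det_smul]
  exact (IsUnit.mk0 _ (by simp)).mul ((Matrix.isUnit_iff_isUnit_det _).1 h)

theorem stronglyMeasurable_balancedValue [SFinite μ] (hQ : StronglyMeasurable Q)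
    {G p : ℝ → Fin n → ℂ} (hG : StronglyMeasurable G) (hp : StronglyMeasurable p) (σ : ℝ) :
    StronglyMeasurable (balancedValue μ J Q G p σ) := by
  have hcm : StronglyMeasurable fun t => ((σ / 2 * μ.real {t} : ℝ) : ℂ) :=
    (Complex.measurable_ofReal.comp
      (measurable_measureReal_singleton.const_mul _)).stronglyMeasurable
  exact stronglyMeasurable_mulVec (stronglyMeasurable_transfer hQ σ)
    ((stronglyMeasurable_mulVec stronglyMeasurable_const hp).add (hcm.smul hG))

/-- To the right of `c` the equation is solved for left limits over `[c, x)`, to the left for right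
limits over `(x, c)`. The atom at `c` belongs to the right part, so that the prescribed value is the
left limit at `c`. -/
theorem exists_solution_of_stronglyMeasurable [SFinite μ] (hJ : IsUnit J)
    (hQ : StronglyMeasurable Q)
    (hQi : ∀ x ∈ interval a b, ∀ z ∈ interval a b,
      IntegrableOn (fun t => entrySum (Q t)) (Set.Icc x z) μ)
    (hu : ∀ x ∈ interval a b, IsUnit ((2 : ℂ) • J + (μ.real {x} : ℂ) • Q x) ∧
      IsUnit ((2 : ℂ) • J - (μ.real {x} : ℂ) • Q x))
    {G : ℝ → Fin n → ℂ} (hG : StronglyMeasurable G)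
    (hGi : ∀ x ∈ interval a b, ∀ z ∈ interval a b, IntegrableOn G (Set.Icc x z) μ)
    {c : ℝ} (hc : c ∈ interval a b) (u₀ : Fin n → ℂ) :
    ∃ u : ℝ → Fin n → ℂ, StronglyMeasurable u ∧
      HasDensity a b μ u (fun x => J⁻¹ *ᵥ (G x - Q x *ᵥ u x)) ∧ Function.leftLim u c = u₀ := by
  have hI := measurableSet_interval (a := a) (b := b)
  have hu1 : ∀ t ∈ interval a b, IsUnit (J + (((1 : ℝ) / 2 * μ.real {t} : ℝ) : ℂ) • Q t) := by
    intro t ht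
    have := isUnit_half (hu t ht).1
    rw [smul_smul] at this
    convert this using 3
    push_cast; ring
  have hu2 : ∀ t ∈ interval a b, IsUnit (J + (((-1 : ℝ) / 2 * μ.real {t} : ℝ) : ℂ) • Q t) := by
    intro t ht
    have h2 := (hu t ht).2
    rw [sub_eq_add_neg] at h2
    have := isUnit_half h2
    rw [← neg_smul, smul_smul] at this
    convert this using 3
    push_cast; ring
  have hsub1 : ∀ {x}, x ∈ interval a b → Set.Ico c x ⊆ Set.Icc c x ∧ Set.Icc c x ⊆ interval a b :=
    fun hx => ⟨Set.Ico_subset_Icc_self, Icc_subset_interval hc hx⟩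
  have hsub2 : ∀ {x}, x ∈ interval a b → Set.Ioo x c ⊆ Set.Icc x c ∧ Set.Icc x c ⊆ interval a b :=
    fun hx => ⟨Set.Ioo_subset_Icc_self, Icc_subset_interval hx hc⟩
  -- Segments are made empty for `x` outside the interval, so that integrability holds for every
  -- real `x`.
  let S₁ : ℝ → Set ℝ := fun x => {t | (c ≤ t ∧ t < x) ∧ x ∈ interval a b}
  let S₂ : ℝ → Set ℝ := fun x => {t | (x < t ∧ t < c) ∧ x ∈ interval a b}
  have hS₁ : ∀ {x}, x ∈ interval a b → S₁ x = Set.Ico c x := fun hx => by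
    ext t; simp [S₁, hx]
  have hS₂ : ∀ {x}, x ∈ interval a b → S₂ x = Set.Ioo x c := fun hx => by
    ext t; simp [S₂, hx]
  have hS₁' : ∀ {x}, x ∉ interval a b → S₁ x = ∅ := fun hx => by
    ext t; simp [S₁, hx]
  have hS₂' : ∀ {x}, x ∉ interval a b → S₂ x = ∅ := fun hx => by
    ext t; simp [S₂, hx]
  obtain ⟨p, hpm, hp⟩ := exists_one_sided (μ := μ) hJ hQ hG u₀ (σ := 1) (S := S₁)
    (((measurableSet_le measurable_const measurable_snd).inter
      (measurableSet_lt measurable_snd measurable_fst)).inter (measurable_fst hI))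
    (fun x t ht s hs => ⟨⟨hs.1.1, hs.1.2.trans ht.1.2⟩, ht.2⟩)
    (fun s t hs ht => lt_asymm hs.1.2 ht.1.2)
    (fun x => by
      by_cases hx : x ∈ interval a b
      · rw [hS₁ hx]; exact (hQi c hc x hx).mono_set (hsub1 hx).1
      · rw [hS₁' hx]; exact integrableOn_empty)
    (fun x => by
      by_cases hx : x ∈ interval a b
      · rw [hS₁ hx]; exact (hGi c hc x hx).mono_set (hsub1 hx).1
      · rw [hS₁' hx]; exact integrableOn_empty)
    (fun x t ht => hu1 t ((hsub1 ht.2).2 ⟨ht.1.1, ht.1.2.le⟩))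
  obtain ⟨r, hrm, hr⟩ := exists_one_sided (μ := μ) hJ hQ hG u₀ (σ := -1) (S := S₂)
    (((measurableSet_lt measurable_fst measurable_snd).inter
      (measurableSet_lt measurable_snd measurable_const)).inter (measurable_fst hI))
    (fun x t ht s hs => ⟨⟨ht.1.1.trans hs.1.1, hs.1.2⟩, ht.2⟩)
    (fun s t hs ht => lt_asymm hs.1.1 ht.1.1)
    (fun x => by
      by_cases hx : x ∈ interval a b
      · rw [hS₂ hx]; exact (hQi x hx c hc).mono_set (hsub2 hx).1
      · rw [hS₂' hx]; exact integrableOn_empty)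
    (fun x => by
      by_cases hx : x ∈ interval a b
      · rw [hS₂ hx]; exact (hGi x hx c hc).mono_set (hsub2 hx).1
      · rw [hS₂' hx]; exact integrableOn_empty)
    (fun x t ht => hu2 t ((hsub2 ht.2).2 ⟨ht.1.1.le, ht.1.2.le⟩))
  set V₁ := balancedValue μ J Q G p 1 with hV₁
  set V₂ := balancedValue μ J Q G r (-1) with hV₂
  let u : ℝ → Fin n → ℂ := (Set.Ici c).piecewise V₁ V₂
  have hum : StronglyMeasurable u := StronglyMeasurable.piecewise measurableSet_Ici
    (stronglyMeasurable_balancedValue hQ hG hpm 1) (stronglyMeasurable_balancedValue hQ hG hrm (-1))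
  let F : ℝ → Fin n → ℂ := fun x => J⁻¹ *ᵥ (G x - Q x *ᵥ u x)
  have huR : ∀ {t}, c ≤ t → u t = V₁ t := fun h => Set.piecewise_eq_of_mem _ _ _ h
  have huL : ∀ {t}, t < c → u t = V₂ t := fun h => Set.piecewise_eq_of_notMem _ _ _ (not_le.2 h)
  have hFR : ∀ {x}, x ∈ interval a b → IntegrableOn F (Set.Ico c x) μ ∧
      p x = u₀ + ∫ t in Set.Ico c x, F t ∂μ := by
    intro x hx
    obtain ⟨h1, h2⟩ := hp x
    rw [hS₁ hx] at h1 h2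
    have h3 : Set.EqOn (fun t => J⁻¹ *ᵥ (G t - Q t *ᵥ V₁ t)) F (Set.Ico c x) := fun t ht => by
      simp only [F, huR ht.1]
    rw [setIntegral_congr_fun measurableSet_Ico h3, one_smul] at h2
    exact ⟨h1.congr_fun h3 measurableSet_Ico, h2⟩
  have hFL : ∀ {x}, x ∈ interval a b → IntegrableOn F (Set.Ioo x c) μ ∧
      r x = u₀ - ∫ t in Set.Ioo x c, F t ∂μ := by
    intro x hx
    obtain ⟨h1, h2⟩ := hr x
    rw [hS₂ hx] at h1 h2
    have h3 : Set.EqOn (fun t => J⁻¹ *ᵥ (G t - Q t *ᵥ V₂ t)) F (Set.Ioo x c) := fun t ht => by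
      simp only [F, huL ht.2]
    rw [setIntegral_congr_fun measurableSet_Ioo h3, neg_one_smul, ← sub_eq_add_neg] at h2
    exact ⟨h1.congr_fun h3 measurableSet_Ioo, h2⟩
  have hFi : ∀ x ∈ interval a b, ∀ z ∈ interval a b, IntegrableOn F (Set.Icc x z) μ := by
    intro x hx z hz
    obtain ⟨x', hx', hxx'⟩ := exists_lt_mem_interval hx
    obtain ⟨z', hz', hzz'⟩ := exists_gt_mem_interval hz
    refine ((hFL hx').1.union (hFR hz').1).mono_set fun t ht => ?_
    rcases lt_or_ge t c with h | h
    · exact Or.inl ⟨hxx'.trans_le ht.1, h⟩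
    · exact Or.inr ⟨h, ht.2.trans_lt hzz'⟩
  have hIoi : ∀ x ∈ interval a b, ∀ z ∈ interval a b, IntegrableOn F (Set.Ico x z) μ :=
    fun x hx z hz => (hFi x hx z hz).mono_set Set.Ico_subset_Icc_self
  let Y : ℝ → Fin n → ℂ := fun x =>
    u₀ + (∫ t in Set.Ico c x, F t ∂μ) - ∫ t in Set.Ico x c, F t ∂μ
  have hY : ∀ x ∈ interval a b, ∀ z ∈ interval a b, x ≤ z →
      Y z - Y x = ∫ t in Set.Ico x z, F t ∂μ := by
    have hadd : ∀ x ∈ interval a b, ∀ y ∈ interval a b, ∀ z ∈ interval a b, x ≤ y → y ≤ z →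
        ∫ t in Set.Ico x z, F t ∂μ = (∫ t in Set.Ico x y, F t ∂μ) + ∫ t in Set.Ico y z, F t ∂μ := by
      intro x hx y hy z hz hxy hyz
      rw [← Set.Ico_union_Ico_eq_Ico hxy hyz]
      refine setIntegral_union ?_ measurableSet_Ico (hIoi x hx y hy) (hIoi y hy z hz)
      exact Set.disjoint_left.2 fun t ht ht' => ht.2.not_ge ht'.1
    intro x hx z hz hxz
    simp only [Y]
    rcases le_total c x with h | h
    · rw [hadd c hc x hx z hz h hxz, Set.Ico_eq_empty (not_lt.2 h),
        Set.Ico_eq_empty (not_lt.2 (h.trans hxz))]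
      simp
    · rcases le_total c z with h' | h'
      · rw [hadd x hx c hc z hz h h', Set.Ico_eq_empty (not_lt.2 h),
          Set.Ico_eq_empty (not_lt.2 h')]
        simp only [Measure.restrict_empty, integral_zero_measure]
        abel
      · rw [hadd x hx z hz c hc hxz h', Set.Ico_eq_empty (not_lt.2 h),
          Set.Ico_eq_empty (not_lt.2 h')]
        simp only [Measure.restrict_empty, integral_zero_measure]
        abel
  have hbal : ∀ x ∈ interval a b, u x = Y x + (1 / 2 : ℝ) • μ.real {x} • F x := by
    intro x hx
    rcases le_or_gt c x with h | h
    · have h1 := balancedValue_eq hJ (G := G) (p := p) (hu1 x hx)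
      have h2 : Y x = p x := by
        simp only [Y, (hFR hx).2, Set.Ico_eq_empty (not_lt.2 h)]
        simp
      rw [← hV₁, ← huR h, Complex.coe_smul, mul_smul] at h1
      rw [h2]; exact h1
    · have h1 := balancedValue_eq hJ (G := G) (p := r) (hu2 x hx)
      -- Here `r x` is the right limit, which exceeds the left limit `Y x` by the jump.
      have h2 : Y x = r x - μ.real {x} • F x := by
        simp only [Y, (hFL hx).2, Set.Ico_eq_empty (not_lt.2 h.le), Measure.restrict_empty,
          integral_zero_measure]
        rw [← Set.Ioo_union_left h, Set.union_comm, setIntegral_union (by simp) measurableSet_Ioo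
          ((hFi x hx x hx).mono_set (by simp)) (hFL hx).1, integral_singleton]
        abel
      rw [← hV₂, ← huL h, Complex.coe_smul] at h1
      rw [h2]
      refine h1.trans ?_
      simp only [F]
      module
  obtain ⟨h1, h2⟩ := HasDensity.of_primitive hFi hY hbal
  exact ⟨u, hum, h1, by rw [h2 c hc]; simp [Y]⟩

theorem measureReal_smul_eq_of_ae_eq {E : Type*} [AddCommGroup E] [Module ℂ E] {F G : ℝ → E}
    (h : F =ᵐ[μ] G) (x : ℝ) : (μ.real {x} : ℂ) • F x = (μ.real {x} : ℂ) • G x := by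
  by_cases h0 : μ {x} = 0
  · simp [measureReal_def, h0]
  · have : F x = G x := by
      by_contra hne
      exact h0 (measure_mono_null (Set.singleton_subset_iff.2 hne) h)
    rw [this]

/-- Strongly measurable representatives of `Q` and `G` have the same values at atoms, so the
conditions on jumps pass to them. -/
theorem exists_solution [SFinite μ] (hJ : IsUnit J) (hQ : AEStronglyMeasurable Q μ)
    (hQi : ∀ x ∈ interval a b, ∀ z ∈ interval a b,
      IntegrableOn (fun t => entrySum (Q t)) (Set.Icc x z) μ)
    (hu : ∀ x ∈ interval a b, IsUnit ((2 : ℂ) • J + (μ.real {x} : ℂ) • Q x) ∧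
      IsUnit ((2 : ℂ) • J - (μ.real {x} : ℂ) • Q x))
    {G : ℝ → Fin n → ℂ} (hG : AEStronglyMeasurable G μ)
    (hGi : ∀ x ∈ interval a b, ∀ z ∈ interval a b, IntegrableOn G (Set.Icc x z) μ)
    {c : ℝ} (hc : c ∈ interval a b) (u₀ : Fin n → ℂ) :
    ∃ u : ℝ → Fin n → ℂ, StronglyMeasurable u ∧
      HasDensity a b μ u (fun x => J⁻¹ *ᵥ (G x - Q x *ᵥ u x)) ∧ Function.leftLim u c = u₀ := by
  obtain ⟨u, h1, h2, h3⟩ := exists_solution_of_stronglyMeasurable hJ hQ.stronglyMeasurable_mk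
    (fun x hx z hz => (hQi x hx z hz).congr_fun_ae
      (ae_restrict_of_ae (hQ.ae_eq_mk.mono fun t ht => congrArg entrySum ht)))
    (fun x hx => by
      rw [← measureReal_smul_eq_of_ae_eq hQ.ae_eq_mk x]; exact hu x hx)
    hG.stronglyMeasurable_mk
    (fun x hx z hz => (hGi x hx z hz).congr_fun_ae (ae_restrict_of_ae hG.ae_eq_mk)) hc u₀
  refine ⟨u, h1, h2.congr_ae ?_, h3⟩
  filter_upwards [hG.ae_eq_mk, hQ.ae_eq_mk] with x hx hx' _
  rw [hx, hx']

end Existence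

/-! ### Densities with respect to a common measure. -/

section Reference

variable {a b : EReal} {n : ℕ}

theorem sigmaFinite_of_finite_on_compacts {ν : Measure ℝ} (h0 : ν (interval a b)ᶜ = 0)
    (hK : ∀ K : Set ℝ, IsCompact K → K ⊆ interval a b → ν K < ⊤) : SigmaFinite ν := by
  let S : Set (Set ℝ) := insert (interval a b)ᶜ
    {s | s ⊆ interval a b ∧ s ∈ Set.range fun p : ℚ × ℚ => Set.Icc (p.1 : ℝ) p.2}
  have hS : S.Countable :=
    ((Set.countable_range _).mono fun s hs => hs.2).insert _
  refine Measure.sigmaFinite_of_countable hS ?_ ?_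
  · rintro s (rfl | ⟨hs, ⟨p, rfl⟩⟩)
    · rw [h0]; exact ENNReal.zero_lt_top
    · exact hK _ isCompact_Icc hs
  · refine Set.eq_univ_of_forall fun t => ?_
    by_cases ht : t ∈ interval a b
    · obtain ⟨c, hc, hct⟩ := exists_lt_mem_interval ht
      obtain ⟨d, hd, htd⟩ := exists_gt_mem_interval ht
      obtain ⟨c', hc1, hc2⟩ := exists_rat_btwn hct
      obtain ⟨d', hd1, hd2⟩ := exists_rat_btwn htd
      refine ⟨Set.Icc (c' : ℝ) d', Or.inr ⟨fun s hs => Icc_subset_interval hc hd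
        ⟨hc1.le.trans hs.1, hs.2.trans hd2.le⟩, ⟨(c', d'), rfl⟩⟩, hc2.le, hd1.le⟩
    · exact ⟨_, Or.inl rfl, ht⟩

namespace MatrixMeasure

instance (m : MatrixMeasure a b n) : SigmaFinite m.μ :=
  sigmaFinite_of_finite_on_compacts m.carried m.finite_of_compact

/-- The density of `m` with respect to `μ`. -/
noncomputable def density (m : MatrixMeasure a b n) (μ : Measure ℝ) (x : ℝ) :
    Matrix (Fin n) (Fin n) ℂ :=
  (m.μ.rnDeriv μ x).toReal • m.h x

variable (m : MatrixMeasure a b n) {μ : Measure ℝ}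

theorem density_mulVec (x : ℝ) (v : Fin n → ℂ) :
    m.density μ x *ᵥ v = (m.μ.rnDeriv μ x).toReal • (m.h x *ᵥ v) := smul_mulVec _ _ _

variable [SigmaFinite μ]

theorem ae_smul_of_ae {p : ℝ → Prop} (h : ∀ᵐ x ∂m.μ, p x) :
    ∀ᵐ x ∂μ, (m.μ.rnDeriv μ x).toReal = 0 ∨ p x := by
  filter_upwards [Measure.ae_rnDeriv_ne_zero_imp_of_ae (ν := μ) h] with x hx
  by_cases h0 : m.μ.rnDeriv μ x = 0
  · exact Or.inl (by simp [h0])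
  · exact Or.inr (hx h0)

theorem aestronglyMeasurable_rnDeriv_smul {E : Type*} [NormedAddCommGroup E] [NormedSpace ℝ E]
    {f : ℝ → E} (hf : AEStronglyMeasurable f m.μ) :
    AEStronglyMeasurable (fun x => (m.μ.rnDeriv μ x).toReal • f x) μ := by
  refine ⟨fun x => (m.μ.rnDeriv μ x).toReal • hf.mk f x,
    ((Measure.measurable_rnDeriv _ _).ennreal_toReal.stronglyMeasurable).smul
      hf.stronglyMeasurable_mk, ?_⟩
  filter_upwards [m.ae_smul_of_ae hf.ae_eq_mk] with x hx
  rcases hx with hx | hx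
  · simp [hx]
  · rw [hx]

theorem aestronglyMeasurable_density : AEStronglyMeasurable (m.density μ) μ := by
  refine aestronglyMeasurable_matrix fun i j => ?_
  exact m.aestronglyMeasurable_rnDeriv_smul
    ((continuous_id.matrix_elem i j).comp_aestronglyMeasurable m.aestronglyMeasurable)

theorem isHermitian_density (h : m.IsHermitian) : ∀ᵐ x ∂μ, (m.density μ x).IsHermitian := by
  filter_upwards [m.ae_smul_of_ae h] with x hx
  rcases hx with hx | hx
  · simp [density, hx]
  · unfold density Matrix.IsHermitian
    rw [conjTranspose_smul, hx.eq, star_trivial]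

variable (hm : m.μ ≪ μ)
include hm

theorem integrableOn_rnDeriv_smul_iff {E : Type*} [NormedAddCommGroup E] [NormedSpace ℝ E]
    {f : ℝ → E} {s : Set ℝ} (hs : MeasurableSet s) :
    IntegrableOn (fun x => (m.μ.rnDeriv μ x).toReal • f x) s μ ↔ IntegrableOn f s m.μ := by
  rw [← integrable_indicator_iff hs, ← integrable_indicator_iff hs,
    ← integrable_rnDeriv_smul_iff (ν := μ) hm]
  refine integrable_congr (Eventually.of_forall fun x => ?_)
  by_cases hx : x ∈ s <;> simp [hx]

theorem integrableOn_density {x z : ℝ} (hx : x ∈ interval a b) (hz : z ∈ interval a b) :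
    IntegrableOn (fun t => entrySum (m.density μ t)) (Set.Icc x z) μ := by
  refine integrable_finsetSum _ fun i _ => integrable_finsetSum _ fun j _ => Integrable.norm ?_
  exact (m.integrableOn_rnDeriv_smul_iff hm measurableSet_Icc).2
    ((m.locallyIntegrable i j).integrableOn_compact_subset (Icc_subset_interval hx hz)
      isCompact_Icc)

theorem mulApply_eq (f : ℝ → Fin n → ℂ) (φ : ℝ → ℂ) :
    m.mulApply f φ = ∫ x, φ x • (m.density μ x *ᵥ f x) ∂μ := by
  unfold mulApply
  rw [← integral_rnDeriv_smul hm]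
  refine integral_congr_ae (Eventually.of_forall fun x => ?_)
  change (m.μ.rnDeriv μ x).toReal • φ x • (m.h x *ᵥ f x) = φ x • (m.density μ x *ᵥ f x)
  rw [density_mulVec, smul_comm]

theorem measureReal_smul_density (x : ℝ) : (μ.real {x} : ℂ) • m.density μ x = m.jump x := by
  have h := Measure.setLIntegral_rnDeriv (ν := μ) hm {x}
  rw [lintegral_singleton] at h
  unfold density jump
  rw [← Complex.coe_smul (m.μ.rnDeriv μ x).toReal, smul_smul, measureReal_def, measureReal_def,
    ← h, ENNReal.toReal_mul, Complex.ofReal_mul, mul_comm]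

theorem integrableOn_density_mulVec_of_bounded {u : ℝ → Fin n → ℂ}
    (hu : LocallyBoundedVariationOn u (interval a b)) {x z : ℝ} (hx : x ∈ interval a b)
    (hz : z ∈ interval a b) : IntegrableOn (fun t => m.density μ t *ᵥ u t) (Set.Icc x z) μ := by
  obtain ⟨C, hC, hb⟩ := exists_bound_of_locallyBoundedVariationOn hu hx hz
  refine Integrable.mono' ((m.integrableOn_density hm hx hz).mul_const C)
    (aestronglyMeasurable_mulVec m.aestronglyMeasurable_density.restrict
      ((aestronglyMeasurable_of_locallyBoundedVariationOn hu μ).mono_measure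
        (Measure.restrict_mono (Icc_subset_interval hx hz) le_rfl))) ?_
  rw [ae_restrict_iff' measurableSet_Icc]
  refine Eventually.of_forall fun t ht => (norm_mulVec_le _ _).trans ?_
  exact mul_le_mul_of_nonneg_left (hb t ht) (entrySum_nonneg _)

end MatrixMeasure

variable (w : Weight a b n)

variable {w} in
theorem MemL2.indicator {f : ℝ → Fin n → ℂ} (hf : MemL2 w f) {s : Set ℝ} (hs : MeasurableSet s) :
    MemL2 w (s.indicator f) := by
  refine ⟨hf.meas.indicator hs, ?_⟩
  have : sesq w (s.indicator f) (s.indicator f) = s.indicator (sesq w f f) := by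
    funext x
    by_cases hx : x ∈ s <;> simp [sesq, hx]
  rw [this]
  exact hf.int.indicator hs

theorem memL2_indicator_of_bounded {K : Set ℝ} (hK : IsCompact K) (hKI : K ⊆ interval a b)
    {f : ℝ → Fin n → ℂ} (hf : AEStronglyMeasurable f (w.μ.restrict K)) {C : ℝ}
    (hC : ∀ x ∈ K, ‖f x‖ ≤ C) : MemL2 w (K.indicator f) := by
  have hm : AEStronglyMeasurable (K.indicator f) w.μ :=
    (aestronglyMeasurable_indicator_iff hK.measurableSet).2 hf
  refine ⟨hm, ?_⟩
  have hi : IntegrableOn (fun t => entrySum (w.h t)) K w.μ :=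
    integrable_finsetSum _ fun i _ => integrable_finsetSum _ fun j _ => Integrable.norm
      ((w.locallyIntegrable i j).integrableOn_compact_subset hKI hK)
  refine Integrable.mono' ((hi.integrable_indicator hK.measurableSet).const_mul (n * C * C))
    (sesq_meas w hm hm) (Eventually.of_forall fun x => ?_)
  by_cases hx : x ∈ K
  · have hC0 : 0 ≤ C := (norm_nonneg _).trans (hC x hx)
    have h0 := entrySum_nonneg (w.h x)
    simp only [sesq, Set.indicator_of_mem hx, dotProduct, Pi.star_apply]
    calc ‖∑ i, star (f x i) * (w.h x *ᵥ f x) i‖ ≤ ∑ i, ‖star (f x i) * (w.h x *ᵥ f x) i‖ :=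
          norm_sum_le _ _
      _ ≤ ∑ _i : Fin n, C * (entrySum (w.h x) * C) := by
          refine Finset.sum_le_sum fun i _ => ?_
          rw [norm_mul, norm_star]
          refine mul_le_mul ((norm_le_pi_norm _ i).trans (hC x hx)) ?_ (norm_nonneg _) hC0
          refine (norm_le_pi_norm _ i).trans ((norm_mulVec_le _ _).trans ?_)
          exact mul_le_mul_of_nonneg_left (hC x hx) h0
      _ = n * C * C * entrySum (w.h x) := by
          simp only [Finset.sum_const, Finset.card_univ, Fintype.card_fin, nsmul_eq_mul]
          ring
  · simp [sesq, hx]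

/-- A component of $wf$ is $e_i^*wf$, and $e_i$ cut off to a compact interval lies in $\mathcal
L^2(w)$. -/
theorem MemL2.integrableOn_mulVec {f : ℝ → Fin n → ℂ} (hf : MemL2 w f) {x z : ℝ}
    (hx : x ∈ interval a b) (hz : z ∈ interval a b) :
    IntegrableOn (fun t => w.h t *ᵥ f t) (Set.Icc x z) w.μ := by
  refine Integrable.of_eval fun i => ?_
  have h1 : MemL2 w ((Set.Icc x z).indicator fun _ => Pi.single i 1) :=
    memL2_indicator_of_bounded w isCompact_Icc (Icc_subset_interval hx hz)
      aestronglyMeasurable_const (C := ‖(Pi.single i 1 : Fin n → ℂ)‖) fun _ _ => le_rfl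
  have h2 := (sesq_integrable w h1 hf).integrableOn (s := Set.Icc x z)
  refine h2.congr_fun (fun t ht => ?_) measurableSet_Icc
  simp [sesq, Set.indicator_of_mem ht]

/-- A measure with respect to which `q`, `w` and Lebesgue measure on `(a, b)` have densities. -/
noncomputable def refMeasure (q : MatrixMeasure a b n) (w : Weight a b n) : Measure ℝ :=
  q.μ + w.μ + volume.restrict (interval a b)

instance (q : MatrixMeasure a b n) : SigmaFinite (refMeasure q w) := by
  unfold refMeasure; infer_instance

theorem left_absolutelyContinuous (q : MatrixMeasure a b n) : q.μ ≪ refMeasure q w := by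
  unfold refMeasure
  rw [add_assoc]
  exact Measure.AbsolutelyContinuous.rfl.add_right _

theorem weight_absolutelyContinuous (q : MatrixMeasure a b n) : w.μ ≪ refMeasure q w := by
  unfold refMeasure
  rw [add_comm q.μ, add_assoc]
  exact Measure.AbsolutelyContinuous.rfl.add_right _

theorem volume_absolutelyContinuous (q : MatrixMeasure a b n) :
    volume.restrict (interval a b) ≪ refMeasure q w := by
  unfold refMeasure
  rw [add_comm]
  exact Measure.AbsolutelyContinuous.rfl.add_right _

end Reference

/-! ### The system as an equation of densities, and Green's formula. -/

section Green

variable {a b : EReal} {n : ℕ} {J : Matrix (Fin n) (Fin n) ℂ} {q : MatrixMeasure a b n}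
  {w : Weight a b n}

theorem nonempty_interval (hab : a < b) : (interval a b).Nonempty := by
  obtain ⟨c, h1, h2⟩ := EReal.exists_between_coe_real hab
  exact ⟨c, h1, h2⟩

theorem inv_mulVec_mulVec (hJ : IsUnit J) (v : Fin n → ℂ) : J⁻¹ *ᵥ (J *ᵥ v) = v := by
  rw [mulVec_mulVec, Matrix.nonsing_inv_mul _ ((Matrix.isUnit_iff_isUnit_det _).1 hJ), one_mulVec]

theorem mulVec_inv_mulVec (hJ : IsUnit J) (v : Fin n → ℂ) : J *ᵥ (J⁻¹ *ᵥ v) = v := by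
  rw [mulVec_mulVec, Matrix.mul_nonsing_inv _ ((Matrix.isUnit_iff_isUnit_det _).1 hJ), one_mulVec]

/-- Multiplication by a matrix as a continuous linear map. -/
noncomputable def mulVecCLM (A : Matrix (Fin n) (Fin n) ℂ) : (Fin n → ℂ) →L[ℂ] (Fin n → ℂ) :=
  LinearMap.toContinuousLinearMap A.mulVecLin

theorem integrable_mulVec {α : Type*} [MeasurableSpace α] {ν : Measure α}
    (A : Matrix (Fin n) (Fin n) ℂ) {g : α → Fin n → ℂ} (hg : Integrable g ν) :
    Integrable (fun x => A *ᵥ g x) ν := (mulVecCLM A).integrable_comp hg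

/-- Invertibility removes the need for integrability: if one integrand is not integrable, neither is
the other, and both integrals are zero by convention. -/
theorem integral_mulVec {α : Type*} [MeasurableSpace α] {ν : Measure α} (hJ : IsUnit J)
    (g : α → Fin n → ℂ) : ∫ x, J *ᵥ g x ∂ν = J *ᵥ ∫ x, g x ∂ν := by
  by_cases hg : Integrable g ν
  · exact (mulVecCLM J).integral_comp_comm hg
  · rw [integral_undef hg, mulVec_zero, integral_undef fun h => hg ?_]
    have := integrable_mulVec J⁻¹ h
    simpa only [inv_mulVec_mulVec hJ] using this

/-- The density of `u'` when `J u' + q u = w f`. -/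
noncomputable def systemDensity (J : Matrix (Fin n) (Fin n) ℂ) (q : MatrixMeasure a b n)
    (w : Weight a b n) (u f : ℝ → Fin n → ℂ) (x : ℝ) : Fin n → ℂ :=
  J⁻¹ *ᵥ (w.density (refMeasure q w) x *ᵥ f x - q.density (refMeasure q w) x *ᵥ u x)

theorem MemL2.integrableOn_density_mulVec (q : MatrixMeasure a b n) {f : ℝ → Fin n → ℂ}
    (hf : MemL2 w f) {x z : ℝ} (hx : x ∈ interval a b) (hz : z ∈ interval a b) :
    IntegrableOn (fun t => w.density (refMeasure q w) t *ᵥ f t) (Set.Icc x z)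
      (refMeasure q w) := by
  simp only [MatrixMeasure.density_mulVec]
  exact (w.integrableOn_rnDeriv_smul_iff (weight_absolutelyContinuous w q) measurableSet_Icc).2
    (hf.integrableOn_mulVec w hx hz)

theorem integrableOn_density_mulVec_left {u : ℝ → Fin n → ℂ}
    (hu : LocallyBoundedVariationOn u (interval a b)) {x z : ℝ} (hx : x ∈ interval a b)
    (hz : z ∈ interval a b) :
    IntegrableOn (fun t => q.density (refMeasure q w) t *ᵥ u t) (Set.Icc x z) (refMeasure q w) :=
  q.integrableOn_density_mulVec_of_bounded (left_absolutelyContinuous w q) hu hx hz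

theorem integral_smul_systemDensity (hab : a < b) (hJ : IsUnit J) {u f : ℝ → Fin n → ℂ}
    (hu : LocallyBoundedVariationOn u (interval a b)) (hf : MemL2 w f) {φ : ℝ → ℂ}
    (hφ : IsTestFunction a b φ) : ∫ x, φ x • systemDensity J q w u f x ∂(refMeasure q w) =
      J⁻¹ *ᵥ (w.toMatrixMeasure.mulApply f φ - q.mulApply u φ) := by
  obtain ⟨c, hc, d, hd, hcd, hsub⟩ := exists_Icc_superset hφ.compact hφ.subset
    (nonempty_interval hab)
  have hs : tsupport φ ⊆ Set.Icc c d := hsub.trans Set.Ioo_subset_Icc_self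
  rw [w.mulApply_eq (weight_absolutelyContinuous w q),
    q.mulApply_eq (left_absolutelyContinuous w q), ← integral_sub
      (integrable_smul_of_tsupport_subset hφ.smooth.continuous hs
        (hf.integrableOn_density_mulVec q hc hd))
      (integrable_smul_of_tsupport_subset hφ.smooth.continuous hs
        (integrableOn_density_mulVec_left hu hc hd)),
    ← integral_mulVec (Matrix.isUnit_nonsing_inv_iff.2 hJ)]
  refine integral_congr_ae (Eventually.of_forall fun x => ?_)
  simp only [systemDensity, ← smul_sub, mulVec_smul]

/-- The distributional equation multiplied by `J⁻¹` is the weak form of a density. With the converse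
`IsMaxPair.of_hasDensity`, membership in $\mathcal T_{\max}$ becomes a pointwise statement about
balanced primitives. -/
theorem IsMaxPair.hasDensity (hab : a < b) (hJ : IsUnit J) {u f : ScriptL2 w}
    (h : IsMaxPair J q w u f) :
    HasDensity a b (refMeasure q w) u.fn (systemDensity J q w u.fn f.fn) := by
  refine HasDensity.of_weak (fun x hx z hz => integrable_mulVec _
    ((f.memL2.integrableOn_density_mulVec q hx hz).sub
      (integrableOn_density_mulVec_left h.balancedBV.bv hx hz))) h.balancedBV fun φ hφ => ?_
  rw [integral_smul_systemDensity hab hJ h.balancedBV.bv f.memL2 hφ, ← h.solves φ hφ,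
    add_sub_cancel_right, mulVec_neg]
  simp only [← mulVec_smul]
  rw [integral_mulVec hJ, inv_mulVec_mulVec hJ]

theorem IsMaxPair.of_hasDensity (hab : a < b) (hJ : IsUnit J) {u f : ScriptL2 w}
    (h : HasDensity a b (refMeasure q w) u.fn (systemDensity J q w u.fn f.fn)) :
    IsMaxPair J q w u f := by
  refine ⟨h.isBalancedBV, fun φ hφ => ?_⟩
  have h1 := h.weak (volume_absolutelyContinuous w q) hφ
  rw [integral_smul_systemDensity hab hJ h.isBalancedBV.bv f.memL2 hφ] at h1
  have h2 := congrArg (J *ᵥ ·) h1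
  simp only [mulVec_inv_mulVec hJ] at h2
  rw [mulVec_neg, ← integral_mulVec hJ] at h2
  simp only [mulVec_smul] at h2
  rw [h2, sub_add_cancel]

/-- Skewness of `J` moves it onto the derivative of `v` with a sign, after which the terms with `D`
cancel because `D` is Hermitian. -/
theorem pairing_systemDensity (hJ : IsUnit J) (hJskew : Jᴴ = -J) {D W : Matrix (Fin n) (Fin n) ℂ}
    (hD : D.IsHermitian) (v g u f : Fin n → ℂ) :
    star v ⬝ᵥ (J *ᵥ (J⁻¹ *ᵥ (W *ᵥ f - D *ᵥ u))) + star (J⁻¹ *ᵥ (W *ᵥ g - D *ᵥ v)) ⬝ᵥ (J *ᵥ u) =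
      star v ⬝ᵥ (W *ᵥ f) - star (W *ᵥ g) ⬝ᵥ u := by
  have h1 : star (J⁻¹ *ᵥ (W *ᵥ g - D *ᵥ v)) ⬝ᵥ (J *ᵥ u) =
      -(star (W *ᵥ g - D *ᵥ v) ⬝ᵥ u) := by
    have : J *ᵥ u = -(Jᴴ *ᵥ u) := by rw [hJskew, neg_mulVec, neg_neg]
    rw [this, dotProduct_neg, dotProduct_mulVec, ← star_mulVec, mulVec_inv_mulVec hJ]
  have h2 : star v ⬝ᵥ (D *ᵥ u) = star (D *ᵥ v) ⬝ᵥ u := by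
    rw [star_mulVec, hD.eq, dotProduct_mulVec]
  rw [mulVec_inv_mulVec hJ, h1, dotProduct_sub, star_sub, sub_dotProduct, h2]
  ring

theorem ae_sesq_eq (w : Weight a b n) (μ : Measure ℝ) [SigmaFinite μ] :
    ∀ᵐ x ∂μ, ∀ v g u f : ℝ → Fin n → ℂ,
      star (v x) ⬝ᵥ (w.density μ x *ᵥ f x) - star (w.density μ x *ᵥ g x) ⬝ᵥ u x =
      (w.μ.rnDeriv μ x).toReal • (sesq w v f x - sesq w g u x) := by
  filter_upwards [w.isHermitian_density (w.nonneg.mono fun x hx => hx.isHermitian)] with x hx v g u f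
  rw [star_mulVec, hx.eq, ← dotProduct_mulVec]
  simp only [MatrixMeasure.density_mulVec, dotProduct_smul, smul_sub, sesq]

/-- Green's formula. -/
theorem HasDensity.green (hJ : IsUnit J) (hJskew : Jᴴ = -J)
    (hq : q.IsHermitian) {v g u f : ℝ → Fin n → ℂ}
    (hv : HasDensity a b (refMeasure q w) v (systemDensity J q w v g))
    (hu : HasDensity a b (refMeasure q w) u (systemDensity J q w u f)) {x z : ℝ}
    (hx : x ∈ interval a b) (hz : z ∈ interval a b) (hxz : x ≤ z) :
    star (Function.leftLim v z) ⬝ᵥ (J *ᵥ Function.leftLim u z) -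
      star (Function.leftLim v x) ⬝ᵥ (J *ᵥ Function.leftLim u x) =
      ∫ t in Set.Ico x z, (sesq w v f t - sesq w g u t) ∂w.μ := by
  rw [hv.pairing hu J hx hz hxz, ← setIntegral_rnDeriv_smul (weight_absolutelyContinuous w q)
    measurableSet_Ico]
  refine integral_congr_ae (ae_restrict_of_ae ?_)
  filter_upwards [q.isHermitian_density (μ := refMeasure q w) hq,
    ae_sesq_eq w (refMeasure q w)] with t h1 h2
  rw [← h2]
  exact pairing_systemDensity hJ hJskew h1 _ _ _ _

end Green

/-! ### The endpoint filters. -/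

section Ends

variable {a b : EReal}

theorem eventually_atRightEnd {c : EReal} (hcb : c < b) :
    ∀ᶠ x : ℝ in atRightEnd b, c < x ∧ (x : EReal) < b :=
  (show ∀ᶠ y in 𝓝[<] b, c < y ∧ y < b from Ioo_mem_nhdsLT hcb).comap _

theorem eventually_atLeftEnd {c : EReal} (hac : a < c) :
    ∀ᶠ x : ℝ in atLeftEnd a, a < x ∧ (x : EReal) < c :=
  (show ∀ᶠ y in 𝓝[>] a, a < y ∧ y < c from Ioo_mem_nhdsGT hac).comap _

theorem neBot_atRightEnd (hab : a < b) : (atRightEnd b).NeBot := by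
  refine comap_neBot_iff.2 fun t ht => ?_
  obtain ⟨l, hl, hlt⟩ := (mem_nhdsLT_iff_exists_Ioo_subset' hab).1 ht
  obtain ⟨x, h1, h2⟩ := EReal.exists_between_coe_real hl
  exact ⟨x, hlt ⟨h1, h2⟩⟩

theorem neBot_atLeftEnd (hab : a < b) : (atLeftEnd a).NeBot := by
  refine comap_neBot_iff.2 fun t ht => ?_
  obtain ⟨l, hl, hlt⟩ := (mem_nhdsGT_iff_exists_Ioo_subset' hab).1 ht
  obtain ⟨x, h1, h2⟩ := EReal.exists_between_coe_real hl
  exact ⟨x, hlt ⟨h1, h2⟩⟩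

instance : (atRightEnd b).IsCountablyGenerated := by unfold atRightEnd; infer_instance

instance : (atLeftEnd a).IsCountablyGenerated := by unfold atLeftEnd; infer_instance

theorem HasBoundaryForm.unique {n : ℕ} (hab : a < b) {J : Matrix (Fin n) (Fin n) ℂ}
    {v u : ℝ → Fin n → ℂ} {c c' : ℂ} (h : HasBoundaryForm a b J v u c)
    (h' : HasBoundaryForm a b J v u c') : c = c' := by
  obtain ⟨β, α, h1, h2, rfl⟩ := h
  obtain ⟨β', α', h1', h2', rfl⟩ := h'
  have := neBot_atRightEnd hab
  have := neBot_atLeftEnd hab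
  rw [tendsto_nhds_unique h1 h1', tendsto_nhds_unique h2 h2']

end Ends

/-! ### Existence and value of the boundary form. -/

section Boundary

variable {a b : EReal} {n : ℕ} {J : Matrix (Fin n) (Fin n) ℂ} {q : MatrixMeasure a b n}
  {w : Weight a b n}

theorem tendsto_form (J : Matrix (Fin n) (Fin n) ℂ) {l : Filter ℝ} {f g : ℝ → Fin n → ℂ}
    {y z : Fin n → ℂ} (hf : Tendsto f l (𝓝 y)) (hg : Tendsto g l (𝓝 z)) :
    Tendsto (fun x => star (f x) ⬝ᵥ (J *ᵥ g x)) l (𝓝 (star y ⬝ᵥ (J *ᵥ z))) := by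
  have hJ : Continuous fun y : Fin n → ℂ => J *ᵥ y := continuous_const.matrix_mulVec continuous_id
  have h1 : Tendsto (fun x => J *ᵥ g x) l (𝓝 (J *ᵥ z)) := (hJ.tendsto z).comp hg
  exact tendsto_finsetSum _ fun i _ =>
    ((tendsto_pi_nhds.1 hf i).star).mul (tendsto_pi_nhds.1 h1 i)

theorem tendsto_setIntegral_ends {ν : Measure ℝ} (hν : ν (interval a b)ᶜ = 0) {k : ℝ → ℂ}
    (hk : Integrable k ν) {c : ℝ} (hc : c ∈ interval a b) :
    Tendsto (fun x => ∫ t in Set.Ico c x, k t ∂ν) (atRightEnd b) (𝓝 (∫ t in Set.Ici c, k t ∂ν)) ∧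
    Tendsto (fun x => ∫ t in Set.Ioo x c, k t ∂ν) (atLeftEnd a)
      (𝓝 (∫ t in Set.Iio c, k t ∂ν)) := by
  have hab : a < b := hc.1.trans hc.2
  -- Since `ν` is carried by the interval, half-lines may be cut down to it; this treats finite and
  -- infinite endpoints alike.
  have hI : ∀ s : Set ℝ, ∫ t in s, k t ∂ν = ∫ t in s ∩ interval a b, k t ∂ν := fun s =>
    (setIntegral_congr_set (inter_ae_eq_left_of_ae_eq_univ (ae_eq_univ.2 hν))).symm
  constructor
  · rw [hI (Set.Ici c)]
    refine tendsto_setIntegral_of_eventually_mem_iff (K := Set.univ)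
      (Eventually.of_forall fun _ => measurableSet_Ico)
      (measurableSet_Ici.inter measurableSet_interval) hk.integrableOn
      MeasurableSet.univ (Eventually.of_forall fun _ => Set.subset_univ _) fun t => ?_
    by_cases ht : (t : EReal) < b
    · filter_upwards [eventually_atRightEnd ht] with x hx
      exact ⟨fun h => ⟨h.1, hc.1.trans_le (EReal.coe_le_coe_iff.2 h.1), ht⟩,
        fun h => ⟨h.1, EReal.coe_lt_coe_iff.1 hx.1⟩⟩
    · filter_upwards [eventually_atRightEnd hab] with x hx
      exact ⟨fun h => absurd ((EReal.coe_lt_coe_iff.2 h.2).trans hx.2) ht,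
        fun h => absurd h.2.2 ht⟩
  · rw [hI (Set.Iio c)]
    refine tendsto_setIntegral_of_eventually_mem_iff (K := Set.univ)
      (Eventually.of_forall fun _ => measurableSet_Ioo)
      (measurableSet_Iio.inter measurableSet_interval) hk.integrableOn
      MeasurableSet.univ (Eventually.of_forall fun _ => Set.subset_univ _) fun t => ?_
    by_cases ht : a < (t : EReal)
    · filter_upwards [eventually_atLeftEnd ht] with x hx
      exact ⟨fun h => ⟨h.2, ht, (EReal.coe_lt_coe_iff.2 h.2).trans hc.2⟩,
        fun h => ⟨EReal.coe_lt_coe_iff.1 hx.2, h.1⟩⟩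
    · filter_upwards [eventually_atLeftEnd hab] with x hx
      exact ⟨fun h => absurd (hx.1.trans (EReal.coe_lt_coe_iff.2 h.1)) ht,
        fun h => absurd h.2.1 ht⟩

theorem tendsto_setIntegral_Ico_Ioo {ν : Measure ℝ} {k : ℝ → ℂ} (hk : Integrable k ν) (x c : ℝ) :
    Tendsto (fun y => ∫ t in Set.Ico y c, k t ∂ν) (𝓝[>] x) (𝓝 (∫ t in Set.Ioo x c, k t ∂ν)) := by
  refine tendsto_setIntegral_of_eventually_mem_iff (K := Set.univ)
    (Eventually.of_forall fun _ => measurableSet_Ico) measurableSet_Ioo hk.integrableOn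
    MeasurableSet.univ (Eventually.of_forall fun _ => Set.subset_univ _) fun t => ?_
  rcases le_or_gt t x with h | h
  · filter_upwards [self_mem_nhdsWithin] with y hy
    simp [h.not_gt, (h.trans_lt hy).not_ge]
  · filter_upwards [Ioo_mem_nhdsGT h] with y hy
    simp [h, hy.2.le]

/-- Starting from an interior point `c`, Green's formula expresses the form at `x` by an integral
between `c` and `x`. Integrability of `k` gives both limits, and the two half-line integrals add up
to the whole. -/
theorem HasDensity.hasBoundaryForm {μ ν : Measure ℝ} {v g u f : ℝ → Fin n → ℂ} {k : ℝ → ℂ}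
    (hv : HasDensity a b μ v g) (hu : HasDensity a b μ u f) (hab : a < b)
    (hν : ν (interval a b)ᶜ = 0) (hk : Integrable k ν)
    (hgreen : ∀ x ∈ interval a b, ∀ z ∈ interval a b, x ≤ z →
      star (Function.leftLim v z) ⬝ᵥ (J *ᵥ Function.leftLim u z) -
        star (Function.leftLim v x) ⬝ᵥ (J *ᵥ Function.leftLim u x) = ∫ t in Set.Ico x z, k t ∂ν) :
    HasBoundaryForm a b J v u (∫ t, k t ∂ν) := by
  obtain ⟨c, hc⟩ := nonempty_interval hab
  obtain ⟨hr, hl⟩ := tendsto_setIntegral_ends hν hk hc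
  let B : ℝ → ℂ := fun x => star (Function.leftLim v x) ⬝ᵥ (J *ᵥ Function.leftLim u x)
  have hBl : ∀ x ∈ interval a b, Function.leftLim (fun x => star (v x) ⬝ᵥ (J *ᵥ u x)) x = B x :=
    fun x hx => leftLim_eq_of_tendsto (tendsto_form J (hv.tendsto_left x hx) (hu.tendsto_left x hx))
  have hBr : ∀ x ∈ interval a b, x < c →
      Function.rightLim (fun x => star (v x) ⬝ᵥ (J *ᵥ u x)) x =
        B c - ∫ t in Set.Ioo x c, k t ∂ν := by
    intro x hx hxc
    have h1 := tendsto_form J (hv.tendsto_right hx) (hu.tendsto_right hx)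
    -- The right limit of the form at `x` is computed along left limits at points decreasing to `x`,
    -- where Green's formula applies.
    have h2 := tendsto_form J (hv.tendsto_leftLim_right hx) (hu.tendsto_leftLim_right hx)
    refine (rightLim_eq_of_tendsto h1).trans (tendsto_nhds_unique h2 ?_)
    refine ((tendsto_setIntegral_Ico_Ioo hk x c).const_sub (B c)).congr' ?_
    filter_upwards [Ioo_mem_nhdsGT hxc] with y hy
    have h3 : B c - B y = ∫ t in Set.Ico y c, k t ∂ν :=
      hgreen y (Icc_subset_interval hx hc ⟨hy.1.le, hy.2.le⟩) c hc hy.2.le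
    rw [← h3, sub_sub_cancel]
  refine ⟨B c + ∫ t in Set.Ici c, k t ∂ν, B c - ∫ t in Set.Iio c, k t ∂ν, ?_, ?_, ?_⟩
  · refine (hr.const_add (B c)).congr' ?_
    filter_upwards [eventually_atRightEnd hc.2] with x hx
    have hxI : x ∈ interval a b := ⟨hc.1.trans hx.1, hx.2⟩
    have h3 : B x - B c = ∫ t in Set.Ico c x, k t ∂ν :=
      hgreen c hc x hxI (EReal.coe_le_coe_iff.1 hx.1.le)
    rw [hBl x hxI, ← h3, add_sub_cancel]
  · refine (hl.const_sub (B c)).congr' ?_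
    filter_upwards [eventually_atLeftEnd hc.1] with x hx
    rw [hBr x ⟨hx.1, hx.2.trans hc.2⟩ (EReal.coe_lt_coe_iff.1 hx.2)]
  · have h := integral_add_compl (measurableSet_Ici (a := c)) hk
    rw [Set.compl_Ici] at h
    rw [← h]
    ring

theorem IsMaxPair.hasBoundaryForm (hab : a < b) (hJ : IsUnit J) (hJskew : Jᴴ = -J)
    (hq : q.IsHermitian) {v g u f : ScriptL2 w} (hv : IsMaxPair J q w v g)
    (hu : IsMaxPair J q w u f) :
    HasBoundaryForm a b J v.fn u.fn (inner ℂ (cls v) (cls f) - inner ℂ (cls g) (cls u)) := by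
  have h1 := sesq_integrable w v.memL2 f.memL2
  have h2 := sesq_integrable w g.memL2 u.memL2
  have h := (hv.hasDensity hab hJ).hasBoundaryForm (hu.hasDensity hab hJ) hab w.carried
    (h1.sub h2) fun x hx z hz hxz =>
      (hv.hasDensity hab hJ).green hJ hJskew hq (hu.hasDensity hab hJ) hx hz hxz
  exact (integral_sub h1 h2) ▸ h

theorem boundaryFormEq (hab : a < b) (hJ : IsUnit J) (hJskew : Jᴴ = -J)
    (hq : q.IsHermitian) (P Q : L2 w × L2 w) :
    BoundaryFormEq J q w P Q (inner ℂ P.1 Q.2 - inner ℂ P.2 Q.1) := by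
  rintro v g u f hv rfl hu rfl
  exact hv.hasBoundaryForm hab hJ hJskew hq hu

/-- Membership in `Tmax` supplies representatives; without them `BoundaryFormEq` would hold
vacuously for every `c`. -/
theorem boundaryFormEq_iff (hab : a < b) (hJ : IsUnit J) (hJskew : Jᴴ = -J)
    (hq : q.IsHermitian) {P Q : L2 w × L2 w} (hP : P ∈ Tmax J q w) (hQ : Q ∈ Tmax J q w) (c : ℂ) :
    BoundaryFormEq J q w P Q c ↔ inner ℂ P.1 Q.2 - inner ℂ P.2 Q.1 = c := by
  have h := boundaryFormEq hab hJ hJskew hq P Q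
  refine ⟨fun hc => ?_, fun hc => hc ▸ h⟩
  obtain ⟨v, g, hv, hP⟩ := hP
  obtain ⟨u, f, hu, hQ⟩ := hQ
  exact (h v g u f hv hP hu hQ).unique hab (hc v g u f hv hP hu hQ)

end Boundary

/-! ### Linear combinations of balanced primitives. -/

section Linear

variable {a b : EReal} {μ : Measure ℝ} {E : Type*} [NormedAddCommGroup E] [NormedSpace ℝ E]

theorem HasDensity.add {u F v G : ℝ → E} (hu : HasDensity a b μ u F) (hv : HasDensity a b μ v G) :
    HasDensity a b μ (u + v) (F + G) ∧
      ∀ x ∈ interval a b, Function.leftLim (u + v) x = Function.leftLim u x +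
        Function.leftLim v x := by
  refine HasDensity.of_primitive (Y := fun x => Function.leftLim u x + Function.leftLim v x)
    (fun x hx z hz => (hu.integrableOn x hx z hz).add (hv.integrableOn x hx z hz))
    (fun x hx z hz hxz => ?_) (fun x hx => ?_)
  · have h : ∫ t in Set.Ico x z, (F + G) t ∂μ =
        (∫ t in Set.Ico x z, F t ∂μ) + ∫ t in Set.Ico x z, G t ∂μ := integral_add
      ((hu.integrableOn x hx z hz).mono_set Set.Ico_subset_Icc_self)
      ((hv.integrableOn x hx z hz).mono_set Set.Ico_subset_Icc_self)
    rw [h, ← hu.increment x hx z hz hxz, ← hv.increment x hx z hz hxz]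
    abel
  · rw [Pi.add_apply, Pi.add_apply, hu.balanced x hx, hv.balanced x hx]
    module

theorem HasDensity.const_smul [CompleteSpace E] [NormedSpace ℂ E] {u F : ℝ → E}
    (hu : HasDensity a b μ u F) (c : ℂ) :
    HasDensity a b μ (c • u) (c • F) ∧
      ∀ x ∈ interval a b, Function.leftLim (c • u) x = c • Function.leftLim u x :=
  hu.comp_clm ((c • ContinuousLinearMap.id ℂ E).restrictScalars ℝ)

theorem hasDensity_zero : HasDensity a b μ (0 : ℝ → E) 0 ∧
    ∀ x ∈ interval a b, Function.leftLim (0 : ℝ → E) x = 0 :=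
  HasDensity.of_primitive (Y := 0) (fun _ _ _ _ => integrable_zero _ _ _)
    (fun _ _ _ _ _ => by simp) (fun _ _ => by simp)

theorem HasDensity.sum [CompleteSpace E] [NormedSpace ℂ E] {ι : Type*} {u F : ι → ℝ → E}
    (hu : ∀ i, HasDensity a b μ (u i) (F i)) (s : Finset ι) (k : ι → ℂ) :
    HasDensity a b μ (∑ i ∈ s, k i • u i) (∑ i ∈ s, k i • F i) ∧
      ∀ x ∈ interval a b, Function.leftLim (∑ i ∈ s, k i • u i) x =
        ∑ i ∈ s, k i • Function.leftLim (u i) x := by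
  classical
  induction s using Finset.induction_on with
  | empty => simpa using hasDensity_zero
  | insert i s hi ih =>
    have h1 := (hu i).const_smul (k i)
    have h2 := h1.1.add ih.1
    simp only [Finset.sum_insert hi]
    exact ⟨h2.1, fun x hx => by rw [h2.2 x hx, h1.2 x hx, ih.2 x hx]⟩

/-- The right limit at `x` is a limit of left limits at larger points, hence zero, so there is no
jump at `x` and the balanced value is zero. -/
theorem HasDensity.eq_zero_of_leftLim [CompleteSpace E] {u F : ℝ → E} (h : HasDensity a b μ u F)
    {x d : ℝ} (hx : x ∈ interval a b) (hxd : x < d)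
    (h0 : ∀ t ∈ interval a b, x ≤ t → t < d → Function.leftLim u t = 0) : u x = 0 := by
  obtain ⟨d', hd', hxd'⟩ := exists_gt_mem_interval hx
  have h1 : Function.leftLim u x + μ.real {x} • F x = 0 := by
    refine tendsto_nhds_unique (h.tendsto_leftLim_right hx) (tendsto_const_nhds.congr' ?_)
    filter_upwards [Ioo_mem_nhdsGT (lt_min hxd hxd')] with t ht
    exact (h0 t (Icc_subset_interval hx hd' ⟨ht.1.le, (ht.2.trans_le (min_le_right _ _)).le⟩)
      ht.1.le (ht.2.trans_le (min_le_left _ _))).symm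
  rw [h0 x hx le_rfl hxd, zero_add] at h1
  rw [h.balanced x hx, h0 x hx le_rfl hxd, h1, smul_zero, add_zero]

end Linear

/-! ### Homogeneous solutions. -/

section Fundamental

variable {a b : EReal} {n : ℕ} {J : Matrix (Fin n) (Fin n) ℂ} {q : MatrixMeasure a b n}
  {w : Weight a b n}

theorem systemDensity_add (u f v g : ℝ → Fin n → ℂ) :
    systemDensity J q w u f + systemDensity J q w v g = systemDensity J q w (u + v) (f + g) := by
  funext x
  simp only [systemDensity, Pi.add_apply, ← mulVec_add]
  congr 1
  simp only [mulVec_add]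
  abel

theorem systemDensity_sum {ι : Type*} (u : ι → ℝ → Fin n → ℂ) (s : Finset ι) (k : ι → ℂ) :
    ∑ i ∈ s, k i • systemDensity J q w (u i) 0 = systemDensity J q w (∑ i ∈ s, k i • u i) 0 := by
  funext x
  simp only [systemDensity, Finset.sum_apply, Pi.smul_apply, Pi.zero_apply, mulVec_zero, zero_sub,
    mulVec_neg, ← mulVec_smul, ← mulVec_sum, smul_neg, Finset.sum_neg_distrib]

theorem exists_systemSolution (hJ : IsUnit J)
    (hJq : ∀ x ∈ interval a b, IsUnit ((2 : ℂ) • J + q.jump x) ∧ IsUnit ((2 : ℂ) • J - q.jump x))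
    {f : ℝ → Fin n → ℂ} (hf : MemL2 w f) {c : ℝ} (hc : c ∈ interval a b) (u₀ : Fin n → ℂ) :
    ∃ u : ℝ → Fin n → ℂ, StronglyMeasurable u ∧
      HasDensity a b (refMeasure q w) u (systemDensity J q w u f) ∧
      Function.leftLim u c = u₀ := by
  have hqm := left_absolutelyContinuous w q
  refine exists_solution (G := fun x => w.density (refMeasure q w) x *ᵥ f x) hJ
    q.aestronglyMeasurable_density (fun x hx z hz => q.integrableOn_density hqm hx hz)
    (fun x hx => ?_) ?_ (fun x hx z hz => hf.integrableOn_density_mulVec q hx hz) hc u₀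
  · rw [q.measureReal_smul_density hqm]
    exact hJq x hx
  · simp only [MatrixMeasure.density_mulVec]
    exact w.aestronglyMeasurable_rnDeriv_smul
      (aestronglyMeasurable_mulVec w.aestronglyMeasurable hf.meas)

theorem memL2_zero : MemL2 w 0 := (l2Submodule w).zero_mem

theorem eq_zero_of_forall_star_dotProduct {y : Fin n → ℂ} (h : ∀ z : Fin n → ℂ, star z ⬝ᵥ y = 0) :
    y = 0 := dotProduct_star_self_eq_zero.1 (h y)

/-- `U k` is the homogeneous solution with left limit `k` at `c`. By Green's formula $U^*JU$ is
constant on left limits, so these remain a basis at every point, and pairing with them through `J`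
detects every vector. -/
theorem exists_fundamental (hab : a < b) (hJ : IsUnit J) (hJskew : Jᴴ = -J) (hq : q.IsHermitian)
    (hJq : ∀ x ∈ interval a b,
      IsUnit ((2 : ℂ) • J + q.jump x) ∧ IsUnit ((2 : ℂ) • J - q.jump x)) :
    ∃ U : (Fin n → ℂ) →ₗ[ℂ] (ℝ → Fin n → ℂ), (∀ k, StronglyMeasurable (U k)) ∧
      (∀ k, HasDensity a b (refMeasure q w) (U k) (systemDensity J q w (U k) 0)) ∧
      ∀ x ∈ interval a b, ∀ y : Fin n → ℂ,
        (∀ k, star (Function.leftLim (U k) x) ⬝ᵥ (J *ᵥ y) = 0) → y = 0 := by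
  obtain ⟨c, hc⟩ := nonempty_interval hab
  choose B hBm hB hBc using fun j : Fin n =>
    exists_systemSolution (w := w) hJ hJq memL2_zero hc (Pi.single j 1)
  let U : (Fin n → ℂ) →ₗ[ℂ] (ℝ → Fin n → ℂ) := Fintype.linearCombination ℂ B
  have hUeq : ∀ k, U k = ∑ j, k j • B j := fun k => Fintype.linearCombination_apply ℂ B k
  have hU : ∀ k, HasDensity a b (refMeasure q w) (U k) (systemDensity J q w (U k) 0) := fun k => by
    have h := (HasDensity.sum hB Finset.univ k).1
    rwa [systemDensity_sum, ← hUeq] at h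
  have hUl : ∀ k, ∀ x ∈ interval a b,
      Function.leftLim (U k) x = ∑ j, k j • Function.leftLim (B j) x := fun k => by
    rw [hUeq]; exact (HasDensity.sum hB Finset.univ k).2
  have hUc : ∀ k, Function.leftLim (U k) c = k := fun k => by
    rw [hUl k c hc]
    funext i
    simp [hBc, Finset.sum_apply, Pi.single_apply]
  have hform : ∀ x ∈ interval a b, ∀ k l, star (Function.leftLim (U k) x) ⬝ᵥ
      (J *ᵥ Function.leftLim (U l) x) = star k ⬝ᵥ (J *ᵥ l) := by
    intro x hx k l
    have h0 : ∀ t, sesq w (U k) 0 t - sesq w 0 (U l) t = 0 := fun t => by simp [sesq]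
    rcases le_total c x with h | h
    · have := (hU k).green hJ hJskew hq (hU l) hc hx h
      simp only [h0, integral_zero] at this
      rw [hUc, hUc] at this
      exact sub_eq_zero.1 this
    · have := (hU k).green hJ hJskew hq (hU l) hx hc h
      simp only [h0, integral_zero] at this
      rw [hUc, hUc] at this
      exact (sub_eq_zero.1 this).symm
  refine ⟨U, fun k => ?_, hU, fun x hx y hy => ?_⟩
  · rw [hUeq]
    exact Finset.stronglyMeasurable_sum _ fun j _ => (hBm j).const_smul (k j)
  · let L : (Fin n → ℂ) →ₗ[ℂ] (Fin n → ℂ) :=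
      Fintype.linearCombination ℂ fun j => Function.leftLim (B j) x
    have hL : ∀ k, L k = Function.leftLim (U k) x := fun k => by
      rw [hUl k x hx]; exact Fintype.linearCombination_apply ℂ _ k
    have hinj : Function.Injective L := (injective_iff_map_eq_zero L).2 fun l hl => by
      have h1 : J *ᵥ l = 0 := eq_zero_of_forall_star_dotProduct fun k => by
        rw [← hform x hx k l, ← hL l, hl, mulVec_zero, dotProduct_zero]
      rw [← inv_mulVec_mulVec hJ l, h1, mulVec_zero]
    have h2 : J *ᵥ y = 0 := eq_zero_of_forall_star_dotProduct fun z => by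
      obtain ⟨k, rfl⟩ := LinearMap.injective_iff_surjective.1 hinj z
      rw [hL]; exact hy k
    rw [← inv_mulVec_mulVec hJ y, h2, mulVec_zero]

end Fundamental

/-! ### Solutions with compact support. -/

section Minimal

variable {a b : EReal} {n : ℕ} {J : Matrix (Fin n) (Fin n) ℂ} {q : MatrixMeasure a b n}
  {w : Weight a b n}

theorem ae_mem_interval (w : Weight a b n) : ∀ᵐ x ∂w.μ, x ∈ interval a b := by
  rw [ae_iff]; exact w.carried

theorem MemL2.of_mulVec_eq {f g : ℝ → Fin n → ℂ} (hf : MemL2 w f)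
    (hg : AEStronglyMeasurable g w.μ) (h : ∀ᵐ x ∂w.μ, w.h x *ᵥ (f x - g x) = 0) : MemL2 w g := by
  refine ⟨hg, hf.int.congr ?_⟩
  filter_upwards [h, w.nonneg] with x hx hw
  rw [mulVec_sub, sub_eq_zero] at hx
  unfold sesq
  rw [hx, ← hw.isHermitian.eq, ← hw.isHermitian.eq, dotProduct_mulVec, ← star_mulVec,
    hw.isHermitian.eq, hx, star_mulVec, hw.isHermitian.eq, ← dotProduct_mulVec]

/-- The integral of a non-negative density vanishes only if the density does so almost everywhere,
and for positive semidefinite $w$ the equation $y^*wy=0$ forces $wy=0$. -/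
theorem cls_eq_cls_iff {f g : ScriptL2 w} :
    cls f = cls g ↔ ∀ᵐ x ∂w.μ, w.h x *ᵥ (f.fn x - g.fn x) = 0 := by
  have h1 : cls f = cls g ↔ ∫ x, sesq w (f - g).fn (f - g).fn x ∂w.μ = 0 :=
    sub_eq_zero.symm.trans (inner_self_eq_zero (𝕜 := ℂ) (x := cls (f - g))).symm
  have hint : Integrable (fun x => (sesq w (f - g).fn (f - g).fn x).re) w.μ :=
    (f - g).memL2.int.re
  have h3 : ∀ᵐ x ∂w.μ, sesq w (f - g).fn (f - g).fn x =
      ((sesq w (f - g).fn (f - g).fn x).re : ℂ) := by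
    filter_upwards [sesq_self_nonneg w] with x hx
    exact Complex.ext rfl (Complex.le_def.1 (hx _)).2.symm
  rw [h1, integral_congr_ae h3, integral_complex_ofReal, Complex.ofReal_eq_zero,
    integral_eq_zero_iff_of_nonneg_ae _ hint]
  · refine eventually_congr ?_
    filter_upwards [h3, w.nonneg] with x hx hw
    rw [Pi.zero_apply, ← Complex.ofReal_eq_zero, ← hx]
    exact hw.dotProduct_mulVec_zero_iff _
  · filter_upwards [sesq_self_nonneg w] with x hx
    exact (Complex.le_def.1 (hx _)).1

/-- A function `u` from the minimal relation vanishes near both ends, so its boundary form with any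
`v` is zero. -/
theorem Tmax_subset_adjoint (hab : a < b) (hJ : IsUnit J) (hJskew : Jᴴ = -J)
    (hq : q.IsHermitian) : Tmax J q w ⊆ adjoint (Tmin J q w) := by
  rintro _ ⟨v, g, hv, rfl⟩ _ ⟨u, f, hu, rfl⟩
  obtain ⟨K, hK, hKI, hK0⟩ := hu.compactSupport
  obtain ⟨c, hc, d, hd, hcd, hsub⟩ := exists_Icc_superset hK hKI (nonempty_interval hab)
  have h0 : ∀ x ∈ interval a b, (x ≤ c ∨ d ≤ x) → star (v.fn x) ⬝ᵥ (J *ᵥ u.fn x) = 0 := by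
    intro x hx hx'
    rw [hK0 x hx fun h => ?_, mulVec_zero, dotProduct_zero]
    have := hsub h
    rcases hx' with hx' | hx' <;> [exact hx'.not_gt this.1; exact hx'.not_gt this.2]
  have h : HasBoundaryForm a b J v.fn u.fn 0 := by
    refine ⟨0, 0, ?_, ?_, sub_zero 0⟩
    · refine tendsto_const_nhds.congr' ?_
      filter_upwards [eventually_atRightEnd hd.2] with x hx
      have hdx := EReal.coe_lt_coe_iff.1 hx.1
      refine (leftLim_eq_of_tendsto (tendsto_const_nhds.congr' ?_)).symm
      filter_upwards [Ioo_mem_nhdsLT hdx] with t ht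
      exact (h0 t (Icc_subset_interval hd ⟨hd.1.trans hx.1, hx.2⟩ ⟨ht.1.le, ht.2.le⟩)
        (Or.inr ht.1.le)).symm
    · refine tendsto_const_nhds.congr' ?_
      filter_upwards [eventually_atLeftEnd hc.1] with x hx
      have hxc := EReal.coe_lt_coe_iff.1 hx.2
      refine (rightLim_eq_of_tendsto (tendsto_const_nhds.congr' ?_)).symm
      filter_upwards [Ioo_mem_nhdsGT hxc] with t ht
      exact (h0 t (Icc_subset_interval ⟨hx.1, hx.2.trans hc.2⟩ hc ⟨ht.1.le, ht.2.le⟩)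
        (Or.inl ht.2.le)).symm
  have h1 := h.unique hab (hv.hasBoundaryForm hab hJ hJskew hq hu.toIsMaxPair)
  exact (sub_eq_zero.1 h1.symm).symm

theorem Tmin_subset_Tmax : Tmin J q w ⊆ Tmax J q w := by
  rintro _ ⟨u, f, hu, rfl⟩
  exact ⟨u, f, hu.toIsMaxPair, rfl⟩

/-- The solution with left limit zero at `c` stays zero to the left of `c`. Paired through `J` with
the homogeneous solutions at points from `d` on, it gives the integrals of `f` against them, which
vanish by `hort`; so it is zero there as well. -/
theorem exists_isMinPair (hab : a < b) (hJ : IsUnit J) (hJskew : Jᴴ = -J) (hq : q.IsHermitian)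
    (hJq : ∀ x ∈ interval a b,
      IsUnit ((2 : ℂ) • J + q.jump x) ∧ IsUnit ((2 : ℂ) • J - q.jump x))
    {U : (Fin n → ℂ) →ₗ[ℂ] (ℝ → Fin n → ℂ)}
    (hU : ∀ k, HasDensity a b (refMeasure q w) (U k) (systemDensity J q w (U k) 0))
    (hU' : ∀ x ∈ interval a b, ∀ y : Fin n → ℂ,
      (∀ k, star (Function.leftLim (U k) x) ⬝ᵥ (J *ᵥ y) = 0) → y = 0)
    {c d : ℝ} (hc : c ∈ interval a b) (hd : d ∈ interval a b) (hcd : c < d) (f : ScriptL2 w)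
    (hf : ∀ x ∉ Set.Ico c d, f.fn x = 0)
    (hort : ∀ k, ∫ x in Set.Ico c d, sesq w (U k) f.fn x ∂w.μ = 0) :
    ∃ u : ScriptL2 w, IsMinPair J q w u f ∧ Function.leftLim u.fn c = 0 ∧
      Function.leftLim u.fn d = 0 ∧ ∀ x ∈ interval a b, x ∉ Set.Ico c d → u.fn x = 0 := by
  obtain ⟨u, hum, hu, huc⟩ := exists_systemSolution (w := w) hJ hJq f.memL2 hc 0
  have hgreen : ∀ k, ∀ x ∈ interval a b, ∀ z ∈ interval a b, x ≤ z →
      star (Function.leftLim (U k) z) ⬝ᵥ (J *ᵥ Function.leftLim u z) -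
        star (Function.leftLim (U k) x) ⬝ᵥ (J *ᵥ Function.leftLim u x) =
        ∫ t in Set.Ico x z, sesq w (U k) f.fn t ∂w.μ := fun k x hx z hz hxz => by
    have h := (hU k).green hJ hJskew hq hu hx hz hxz
    have h0 : ∀ t, sesq w (U k) f.fn t - sesq w 0 u t = sesq w (U k) f.fn t := fun t => by
      simp [sesq]
    simpa only [h0] using h
  have hsesq : ∀ k, ∀ x ∉ Set.Ico c d, sesq w (U k) f.fn x = 0 := fun k x hx => by
    simp [sesq, hf x hx]
  have hl : ∀ x ∈ interval a b, x ≤ c → Function.leftLim u x = 0 := fun x hx hxc => by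
    refine hU' x hx _ fun k => ?_
    have h := hgreen k x hx c hc hxc
    rw [huc, mulVec_zero, dotProduct_zero, zero_sub, setIntegral_eq_zero_of_forall_eq_zero
      fun t ht => hsesq k t fun h => ht.2.not_ge h.1] at h
    exact neg_eq_zero.1 h
  have hr : ∀ x ∈ interval a b, d ≤ x → Function.leftLim u x = 0 := fun x hx hdx => by
    refine hU' x hx _ fun k => ?_
    have h := hgreen k c hc x hx (hcd.le.trans hdx)
    rw [huc, mulVec_zero, dotProduct_zero, sub_zero] at h
    rw [h, ← hort k]
    refine setIntegral_eq_of_subset_of_forall_sdiff_eq_zero measurableSet_Ico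
      (Set.Ico_subset_Ico_right hdx) fun t ht => hsesq k t ht.2
  have hu0 : ∀ x ∈ interval a b, x ∉ Set.Ico c d → u x = 0 := by
    intro x hx hxcd
    rcases lt_or_ge x c with h | h
    · exact hu.eq_zero_of_leftLim hx h fun t ht _ htc => hl t ht htc.le
    · have h' : d ≤ x := not_lt.1 fun h' => hxcd ⟨h, h'⟩
      exact hu.eq_zero_of_leftLim hx (lt_add_one x) fun t ht htx _ => hr t ht (h'.trans htx)
  have hL : MemL2 w u := by
    obtain ⟨C, -, hC⟩ := exists_bound_of_locallyBoundedVariationOn hu.locallyBoundedVariationOn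
      hc hd
    refine (memL2_indicator_of_bounded w isCompact_Icc (Icc_subset_interval hc hd)
      hum.aestronglyMeasurable hC).of_mulVec_eq hum.aestronglyMeasurable ?_
    filter_upwards [ae_mem_interval w] with x hx
    by_cases h : x ∈ Set.Icc c d
    · rw [Set.indicator_of_mem h, sub_self, mulVec_zero]
    · rw [Set.indicator_of_notMem h, hu0 x hx fun h' => h (Set.Ico_subset_Icc_self h'), sub_self,
        mulVec_zero]
  refine ⟨⟨u, hL⟩, ⟨IsMaxPair.of_hasDensity hab hJ hu, Set.Icc c d, isCompact_Icc,
    Icc_subset_interval hc hd, fun x hx h => hu0 x hx fun h' => h (Set.Ico_subset_Icc_self h')⟩,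
    huc, hr d hd le_rfl, hu0⟩

end Minimal

/-! ### The adjoint of the minimal relation. -/

section Adjoint

variable {a b : EReal} {n : ℕ} {J : Matrix (Fin n) (Fin n) ℂ} {q : MatrixMeasure a b n}
  {w : Weight a b n}

theorem memL2_indicator_Ico {y : ℝ → Fin n → ℂ} (hym : StronglyMeasurable y)
    (hy : LocallyBoundedVariationOn y (interval a b)) {c d : ℝ} (hc : c ∈ interval a b)
    (hd : d ∈ interval a b) : MemL2 w ((Set.Ico c d).indicator y) := by
  obtain ⟨C, -, hC⟩ := exists_bound_of_locallyBoundedVariationOn hy hc hd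
  have h := (memL2_indicator_of_bounded w isCompact_Icc (Icc_subset_interval hc hd)
    hym.aestronglyMeasurable hC).indicator (measurableSet_Ico (a := c) (b := d))
  rwa [Set.indicator_indicator, Set.inter_eq_left.2 Set.Ico_subset_Icc_self] at h

/-- On `[c, d)` the difference `v - v₁` is orthogonal to everything orthogonal to the homogeneous
solutions. These span a finite-dimensional, hence closed, subspace, so the difference belongs to it
modulo the kernel of `w`. -/
theorem exists_homogeneous_correction (hab : a < b) (hJ : IsUnit J) (hJskew : Jᴴ = -J)
    (hq : q.IsHermitian) (hJq : ∀ x ∈ interval a b,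
      IsUnit ((2 : ℂ) • J + q.jump x) ∧ IsUnit ((2 : ℂ) • J - q.jump x))
    {U : (Fin n → ℂ) →ₗ[ℂ] (ℝ → Fin n → ℂ)} (hUm : ∀ k, StronglyMeasurable (U k))
    (hU : ∀ k, HasDensity a b (refMeasure q w) (U k) (systemDensity J q w (U k) 0))
    (hU' : ∀ x ∈ interval a b, ∀ y : Fin n → ℂ,
      (∀ k, star (Function.leftLim (U k) x) ⬝ᵥ (J *ᵥ y) = 0) → y = 0)
    {v g : ScriptL2 w} (hvg : (cls v, cls g) ∈ adjoint (Tmin J q w)) {v₁ : ℝ → Fin n → ℂ}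
    (hv₁m : StronglyMeasurable v₁)
    (hv₁ : HasDensity a b (refMeasure q w) v₁ (systemDensity J q w v₁ g.fn))
    {c d : ℝ} (hc : c ∈ interval a b) (hd : d ∈ interval a b) (hcd : c < d) :
    ∃ k, ∀ᵐ x ∂w.μ, x ∈ Set.Ico c d → w.h x *ᵥ (v.fn x - v₁ x - U k x) = 0 := by
  let S := Set.Ico c d
  have hS : MeasurableSet S := measurableSet_Ico
  have hUL : ∀ k, MemL2 w (S.indicator (U k)) := fun k =>
    memL2_indicator_Ico (hUm k) (hU k).locallyBoundedVariationOn hc hd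
  have hv₁L : MemL2 w (S.indicator v₁) :=
    memL2_indicator_Ico hv₁m hv₁.locallyBoundedVariationOn hc hd
  let T : (Fin n → ℂ) →ₗ[ℂ] L2 w :=
    { toFun := fun k => cls ⟨S.indicator (U k), hUL k⟩
      map_add' := fun k l => congrArg cls <| ScriptL2.ext_fn w <| by
        change S.indicator (U (k + l)) = S.indicator (U k) + S.indicator (U l)
        rw [map_add, Set.indicator_add']
      map_smul' := fun k l => congrArg cls <| ScriptL2.ext_fn w <| by
        change S.indicator (U (k • l)) = k • S.indicator (U l)
        rw [map_smul]
        exact Set.indicator_const_smul S k (U l) }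
  let h : ScriptL2 w := ⟨S.indicator v.fn, v.memL2.indicator hS⟩ - ⟨S.indicator v₁, hv₁L⟩
  have hmem : cls h ∈ LinearMap.range T := by
    rw [← Submodule.orthogonal_orthogonal (LinearMap.range T), Submodule.mem_orthogonal]
    intro y hy
    obtain ⟨f₀, rfl⟩ := SeparationQuotient.surjective_mk y
    let f : ScriptL2 w := ⟨S.indicator f₀.fn, f₀.memL2.indicator hS⟩
    have hff : ∀ x ∈ S, f.fn x = f₀.fn x := fun x hx => Set.indicator_of_mem hx _
    have hf0 : ∀ x ∉ S, f.fn x = 0 := fun x hx => Set.indicator_of_notMem hx _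
    have hind : ∀ y : ℝ → Fin n → ℂ,
        sesq w (S.indicator y) f₀.fn = S.indicator (sesq w y f.fn) := fun y => by
      funext x
      by_cases hx : x ∈ S
      · simp [sesq, hx, hff x hx]
      · simp [sesq, hx]
    have hort : ∀ k, ∫ x in S, sesq w (U k) f.fn x ∂w.μ = 0 := fun k => by
      have h1 : ∫ x, sesq w (S.indicator (U k)) f₀.fn x ∂w.μ = 0 :=
        (Submodule.mem_orthogonal _ _).1 hy _ ⟨k, rfl⟩
      rwa [hind, integral_indicator hS] at h1
    obtain ⟨u, hu, huc, hud, hu0⟩ :=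
      exists_isMinPair hab hJ hJskew hq hJq hU hU' hc hd hcd f hf0 hort
    have hadj : ∫ x, sesq w g.fn u.fn x ∂w.μ = ∫ x, sesq w v.fn f.fn x ∂w.μ :=
      hvg _ ⟨u, f, hu, rfl⟩
    have hi : ∀ y : ℝ → Fin n → ℂ, MemL2 w (S.indicator y) →
        IntegrableOn (sesq w y f.fn) S w.μ := fun y hy => by
      have h1 := sesq_integrable w hy f₀.memL2
      rw [hind] at h1
      exact (integrable_indicator_iff hS).1 h1
    have h4 : ∫ x in S, sesq w g.fn u.fn x ∂w.μ = ∫ x, sesq w g.fn u.fn x ∂w.μ := by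
      refine setIntegral_eq_integral_of_ae_compl_eq_zero ?_
      filter_upwards [ae_mem_interval w] with x hx hxS
      simp [sesq, hu0 x hx hxS]
    -- Both boundary terms vanish, so `v₁` pairs with `f` as `g` pairs with `u`; by the adjoint
    -- relation `v` does the same.
    have hg := hv₁.green hJ hJskew hq (hu.hasDensity hab hJ) hc hd hcd.le
    rw [huc, hud, mulVec_zero, dotProduct_zero, dotProduct_zero, sub_zero,
      integral_sub (hi v₁ hv₁L) (sesq_integrable w g.memL2 u.memL2).integrableOn, h4,
      hadj] at hg
    rw [← inner_conj_symm]
    have h2 : inner ℂ (cls h) (SeparationQuotient.mk f₀) =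
        (∫ x, sesq w (S.indicator v.fn) f₀.fn x ∂w.μ) -
          ∫ x, sesq w (S.indicator v₁) f₀.fn x ∂w.μ :=
      inner_sub_left (𝕜 := ℂ) (cls ⟨S.indicator v.fn, v.memL2.indicator hS⟩)
        (cls ⟨S.indicator v₁, hv₁L⟩) (cls f₀)
    have h3 : ∫ x in S, sesq w v.fn f.fn x ∂w.μ = ∫ x, sesq w v.fn f.fn x ∂w.μ := by
      refine setIntegral_eq_integral_of_forall_compl_eq_zero fun x hx => ?_
      simp [sesq, hf0 x hx]
    rw [h2, hind, hind, integral_indicator hS, integral_indicator hS, h3, ← neg_sub, ← hg, neg_zero,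
      map_zero]
  obtain ⟨k, hk⟩ := hmem
  refine ⟨k, ?_⟩
  filter_upwards [cls_eq_cls_iff.1 hk.symm] with x hx hxS
  change w.h x *ᵥ (S.indicator v.fn x - S.indicator v₁ x - S.indicator (U k) x) = 0 at hx
  rwa [Set.indicator_of_mem hxS, Set.indicator_of_mem hxS, Set.indicator_of_mem hxS] at hx

/-- The vectors `k` for which `w (U k)` vanishes on `[c, d)`. -/
def nullVectors (w : Weight a b n) (U : (Fin n → ℂ) →ₗ[ℂ] (ℝ → Fin n → ℂ)) (c d : ℝ) :
    Submodule ℂ (Fin n → ℂ) where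
  carrier := {k | ∀ᵐ x ∂w.μ, x ∈ Set.Ico c d → w.h x *ᵥ U k x = 0}
  zero_mem' := by
    change ∀ᵐ x ∂w.μ, x ∈ Set.Ico c d → w.h x *ᵥ U 0 x = 0
    refine Eventually.of_forall fun x _ => ?_
    rw [map_zero, Pi.zero_apply, mulVec_zero]
  add_mem' := fun {k l} hk hl => by
    change ∀ᵐ x ∂w.μ, x ∈ Set.Ico c d → w.h x *ᵥ U (k + l) x = 0
    filter_upwards [Set.mem_ofPred_eq ▸ hk, Set.mem_ofPred_eq ▸ hl] with x h1 h2 hx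
    rw [map_add, Pi.add_apply, mulVec_add, h1 hx, h2 hx, add_zero]
  smul_mem' := fun r k hk => by
    change ∀ᵐ x ∂w.μ, x ∈ Set.Ico c d → w.h x *ᵥ U (r • k) x = 0
    filter_upwards [Set.mem_ofPred_eq ▸ hk] with x h1 hx
    rw [map_smul, Pi.smul_apply, mulVec_smul, h1 hx, smul_zero]

theorem mem_nullVectors {U : (Fin n → ℂ) →ₗ[ℂ] (ℝ → Fin n → ℂ)} {c d : ℝ} {k : Fin n → ℂ} :
    k ∈ nullVectors w U c d ↔ ∀ᵐ x ∂w.μ, x ∈ Set.Ico c d → w.h x *ᵥ U k x = 0 := Iff.rfl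

/-- The correction on an interval is unique up to `nullVectors`, which shrink as the interval grows.
In finite dimension some interval attains a minimal such space; a correction chosen there differs
from one on any larger interval by a vector that is null on the larger interval too, and so serves
everywhere. -/
theorem exists_global_correction (hab : a < b) {U : (Fin n → ℂ) →ₗ[ℂ] (ℝ → Fin n → ℂ)}
    {y : ℝ → Fin n → ℂ} (h : ∀ c ∈ interval a b, ∀ d ∈ interval a b, c < d →
      ∃ k, ∀ᵐ x ∂w.μ, x ∈ Set.Ico c d → w.h x *ᵥ (y x - U k x) = 0) :
    ∃ k, ∀ᵐ x ∂w.μ, w.h x *ᵥ (y x - U k x) = 0 := by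
  let 𝒩 : Set (Submodule ℂ (Fin n → ℂ)) :=
    {N | ∃ c ∈ interval a b, ∃ d ∈ interval a b, c < d ∧ N = nullVectors w U c d}
  have hne : 𝒩.Nonempty := by
    obtain ⟨c, hc⟩ := nonempty_interval hab
    obtain ⟨d, hd, hcd⟩ := exists_gt_mem_interval hc
    exact ⟨_, c, hc, d, hd, hcd, rfl⟩
  obtain ⟨N, ⟨c, hc, d, hd, hcd, rfl⟩, hmin⟩ := wellFounded_lt.has_min 𝒩 hne
  obtain ⟨k, hk⟩ := h c hc d hd hcd
  have hall : ∀ c' ∈ interval a b, ∀ d' ∈ interval a b, c' < d' →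
      ∀ᵐ x ∂w.μ, x ∈ Set.Ico c' d' → w.h x *ᵥ (y x - U k x) = 0 := by
    intro c' hc' d' hd' hcd'
    have hC : min c c' ∈ interval a b := by rcases min_choice c c' with h | h <;> rwa [h]
    have hD : max d d' ∈ interval a b := by rcases max_choice d d' with h | h <;> rwa [h]
    have hCD : min c c' < max d d' := (min_le_left _ _).trans_lt (hcd.trans_le (le_max_left _ _))
    have hsub : Set.Ico c d ⊆ Set.Ico (min c c') (max d d') :=
      Set.Ico_subset_Ico (min_le_left _ _) (le_max_left _ _)
    have hsub' : Set.Ico c' d' ⊆ Set.Ico (min c c') (max d d') :=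
      Set.Ico_subset_Ico (min_le_right _ _) (le_max_right _ _)
    obtain ⟨l, hl⟩ := h _ hC _ hD hCD
    have hle : nullVectors w U (min c c') (max d d') ≤ nullVectors w U c d := fun m hm =>
      (mem_nullVectors.1 hm).mono fun x hx hx' => hx (hsub hx')
    have heq := hle.eq_of_not_lt (hmin _ ⟨_, hC, _, hD, hCD, rfl⟩)
    have hkl : l - k ∈ nullVectors w U c d := by
      rw [mem_nullVectors]
      filter_upwards [hk, hl] with x h1 h2 hx
      have h3 := h1 hx
      have h4 := h2 (hsub hx)
      rw [map_sub, Pi.sub_apply, ← sub_sub_sub_cancel_left (U k x) (U l x) (y x), mulVec_sub,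
        h3, h4, sub_zero]
    rw [← heq, mem_nullVectors] at hkl
    filter_upwards [hkl, hl] with x h1 h2 hx
    have h3 := h1 (hsub' hx)
    rw [map_sub, Pi.sub_apply] at h3
    have h4 : y x - U k x = (y x - U l x) + (U l x - U k x) := by abel
    rw [h4, mulVec_add, h2 (hsub' hx), h3, add_zero]
  refine ⟨k, ?_⟩
  let s : Set ℝ := {x | x ∈ interval a b ∧ ¬ w.h x *ᵥ (y x - U k x) = 0}
  -- The exceptional set is null in a neighbourhood of each of its points, hence null.
  have hs : w.μ s = 0 := by
    refine measure_null_of_locally_null s fun x hx => ?_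
    obtain ⟨c', hc', h1⟩ := exists_lt_mem_interval hx.1
    obtain ⟨d', hd', h2⟩ := exists_gt_mem_interval hx.1
    refine ⟨s ∩ Set.Ioo c' d', inter_mem_nhdsWithin _ (Ioo_mem_nhds h1 h2), ?_⟩
    refine measure_mono_null ?_ (ae_iff.1 (hall c' hc' d' hd' (h1.trans h2)))
    rintro t ⟨ht, ht'⟩ h0
    exact ht.2 (h0 ⟨ht'.1.le, ht'.2⟩)
  filter_upwards [ae_mem_interval w, measure_eq_zero_iff_ae_notMem.1 hs] with x hx hxs
  by_contra h0
  exact hxs ⟨hx, h0⟩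

/-- For `(v, g)` in the adjoint, a particular solution for `g` plus a suitable homogeneous one
represents the class of `v` and is balanced, so the pair lies in the maximal relation. -/
theorem adjoint_Tmin (hab : a < b) (hJ : IsUnit J) (hJskew : Jᴴ = -J)
    (hq : q.IsHermitian) (hJq : ∀ x ∈ interval a b,
      IsUnit ((2 : ℂ) • J + q.jump x) ∧ IsUnit ((2 : ℂ) • J - q.jump x)) :
    (adjoint (Tmin J q w) : Set (L2 w × L2 w)) = Tmax J q w := by
  refine Set.Subset.antisymm ?_ (Tmax_subset_adjoint hab hJ hJskew hq)
  rintro ⟨p₁, p₂⟩ hp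
  obtain ⟨v, rfl⟩ := SeparationQuotient.surjective_mk p₁
  obtain ⟨g, rfl⟩ := SeparationQuotient.surjective_mk p₂
  obtain ⟨U, hUm, hU, hU'⟩ := exists_fundamental (w := w) hab hJ hJskew hq hJq
  obtain ⟨c, hc⟩ := nonempty_interval hab
  obtain ⟨v₁, hv₁m, hv₁, -⟩ := exists_systemSolution hJ hJq g.memL2 hc 0
  obtain ⟨k, hk⟩ := exists_global_correction (y := v.fn - v₁) hab fun c hc d hd hcd =>
    exists_homogeneous_correction hab hJ hJskew hq hJq hUm hU hU' hp hv₁m hv₁ hc hd hcd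
  have hk' : ∀ᵐ x ∂w.μ, w.h x *ᵥ (v.fn x - (v₁ + U k) x) = 0 := hk.mono fun x hx => by
    rwa [Pi.sub_apply, sub_sub] at hx
  have hd := (hv₁.add (hU k)).1
  rw [systemDensity_add, add_zero] at hd
  let u : ScriptL2 w :=
    ⟨v₁ + U k, v.memL2.of_mulVec_eq (hv₁m.add (hUm k)).aestronglyMeasurable hk'⟩
  exact ⟨u, g, IsMaxPair.of_hasDensity hab hJ hd, Prod.ext (cls_eq_cls_iff.2 hk') rfl⟩

end Adjoint

/-! ### Boundary conditions as orthogonality, and the theorem. -/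

theorem snd_neg_fst_mem_adjoint {H : Type*} [NormedAddCommGroup H] [InnerProductSpace ℂ H]
    {S : Set (H × H)} {x : H × H}
    (hx : x ∈ deficiencySpace S Complex.I ⊔ deficiencySpace S (-Complex.I)) :
    (x.2, -x.1) ∈ adjoint S := by
  obtain ⟨p, ⟨hp, hp'⟩, r, ⟨hr, hr'⟩, rfl⟩ := Submodule.mem_sup.1 hx
  have h := (adjoint S).add_mem ((adjoint S).smul_mem Complex.I hp)
    ((adjoint S).smul_mem (-Complex.I) hr)
  convert h using 1
  ext1
  · simp [hp', hr']
  · simp [hp', hr', smul_smul, add_comm]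

/-- By Green's formula the boundary form of $(g_j,-v_j)$ and $(u,f)$ equals $\langle
g_j,f\rangle+\langle v_j,u\rangle$, which is the condition in the abstract extension theorem. -/
theorem boundaryRelation_eq {a b : EReal} {n : ℕ} {J : Matrix (Fin n) (Fin n) ℂ}
    {q : MatrixMeasure a b n} {w : Weight a b n} (hab : a < b) (hJ : IsUnit J) (hJskew : Jᴴ = -J)
    (hq : q.IsHermitian) {N : ℕ} {x : Fin N → L2 w × L2 w}
    (hx : ∀ j, ((x j).2, -(x j).1) ∈ Tmax J q w) :
    boundaryRelation J q w x = {p | p ∈ Tmax J q w ∧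
      ∀ j, inner ℂ (x j).2 p.2 + inner ℂ (x j).1 p.1 = 0} := by
  ext p
  refine and_congr_right fun hp => forall_congr' fun j => ?_
  rw [boundaryFormEq_iff hab hJ hJskew hq (hx j) hp, inner_neg_left, sub_neg_eq_add]

end DistODE

theorem theoremT (a b : EReal) (hab : a < b) (n : ℕ)
    (J : Matrix (Fin n) (Fin n) ℂ) (hJ : IsUnit J) (hJskew : Jᴴ = -J)
    (q : DistODE.MatrixMeasure a b n) (hq : q.IsHermitian) (w : DistODE.Weight a b n)
    (hJq : ∀ x ∈ DistODE.interval a b,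
      IsUnit ((2 : ℂ) • J + q.jump x) ∧ IsUnit ((2 : ℂ) • J - q.jump x))
    (N : ℕ) (hN : 0 < N)
    (hplus : Module.finrank ℂ
      (DistODE.deficiencySpace (DistODE.Tmin J q w) Complex.I) = N)
    (hminus : Module.finrank ℂ
      (DistODE.deficiencySpace (DistODE.Tmin J q w) (-Complex.I)) = N) :
    -- the boundary forms exist and depend on the classes only
    (∀ P ∈ DistODE.Tmax J q w, ∀ Q ∈ DistODE.Tmax J q w,
      ∃ c : ℂ, DistODE.BoundaryFormEq J q w P Q c) ∧
    -- for every isotropic system `(v_j, g_j)`, `(g_j, -v_j)` lies in `T_max`, and the boundary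
    -- conditions define a self-adjoint restriction of `T_max`
    (∀ x : Fin N → DistODE.L2 w × DistODE.L2 w, DistODE.IsIsotropicSystem J q w x →
      (∀ j, ((x j).2, -(x j).1) ∈ DistODE.Tmax J q w) ∧
      ∃ T : Submodule ℂ (DistODE.L2 w × DistODE.L2 w),
        (T : Set (DistODE.L2 w × DistODE.L2 w)) = DistODE.boundaryRelation J q w x ∧
        DistODE.IsSelfAdjointRelation T) ∧
    -- the self-adjoint restrictions of `T_max` are exactly the relations obtained in this way
    (∀ T : Submodule ℂ (DistODE.L2 w × DistODE.L2 w),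
      ((T : Set (DistODE.L2 w × DistODE.L2 w)) ⊆ DistODE.Tmax J q w ∧
        DistODE.IsSelfAdjointRelation T) ↔
      ∃ x : Fin N → DistODE.L2 w × DistODE.L2 w, DistODE.IsIsotropicSystem J q w x ∧
        (T : Set (DistODE.L2 w × DistODE.L2 w)) = DistODE.boundaryRelation J q w x) := by
  have hadj := DistODE.adjoint_Tmin (w := w) hab hJ hJskew hq hJq
  have hmem : ∀ p, p ∈ DistODE.adjoint (DistODE.Tmin J q w) ↔ p ∈ DistODE.Tmax J q w := fun p => by
    rw [← hadj]; rfl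
  have hS : DistODE.Tmin J q w ⊆ DistODE.adjoint (DistODE.Tmin J q w) :=
    hadj ▸ DistODE.Tmin_subset_Tmax
  obtain ⟨hext, hchar⟩ := DistODE.symmetric_selfAdjoint_extensions _ hS hN hplus hminus
  simp only [hmem] at hext hchar
  have hrot : ∀ {x : Fin N → DistODE.L2 w × DistODE.L2 w},
      (∀ j, x j ∈ DistODE.defectSum J q w) → ∀ j, ((x j).2, -(x j).1) ∈ DistODE.Tmax J q w :=
    fun hx j => (hmem _).1 (DistODE.snd_neg_fst_mem_adjoint (hx j))
  refine ⟨fun P _ Q _ => ⟨_, DistODE.boundaryFormEq hab hJ hJskew hq P Q⟩, fun x hx => ?_,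
    fun T => ⟨fun hT => ?_, ?_⟩⟩
  · refine ⟨hrot hx.mem, ?_⟩
    rw [DistODE.boundaryRelation_eq hab hJ hJskew hq (hrot hx.mem)]
    exact hext x hx.linearIndependent hx.mem hx.isotropic
  · obtain ⟨x, h1, h2, h3, h4⟩ := hchar T (fun p hp => (hmem p).2 (hT.1 hp)) hT.2
    refine ⟨x, ⟨h1, h2, h3⟩, ?_⟩
    rw [DistODE.boundaryRelation_eq hab hJ hJskew hq (hrot h2)]
    exact h4
  · rintro ⟨x, hx, hTx⟩
    refine ⟨hTx ▸ fun p hp => hp.1, ?_⟩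
    obtain ⟨T', hT', hsa⟩ := hext x hx.linearIndependent hx.mem hx.isotropic
    rw [← DistODE.boundaryRelation_eq hab hJ hJskew hq (hrot hx.mem), ← hTx] at hT'
    exact SetLike.coe_injective hT' ▸ hsa
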